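/- For an integer $k\ge 0$, let $\mathrm{abba}(k)$ denote the ordered graph $a\,(k)\,b\,b\,(k)\,a$ with vertices $1,2,\dots,2k+4$ in natural order and exactly two edges, $\{1,2k+4\}$ and $\{k+2,k+3\}$. An ordered graph (a finite graph with a fixed linear order on its vertex set) is $\mathrm{abba}(k)$-free if it does not contain $\mathrm{abba}(k)$ as an induced subgraph with the same relative order of vertices. In the Maximum Weight Independent Set problem (MWIS) one is given a graph $G$ and a weight function $w:V(G)\to\mathbb{Q}_{>0}$, and has to find an independent set of $G$ of maximum total weight. Theorem. For every fixed integer $k\ge 0$ there are a constant $C$ and an algorithm that, given an $\mathrm{abba}(k)$-free ordered graph $G$ on $n$ vertices and weights $w:V(G)\to\mathbb{Q}_{>0}$, returns a maximum-weight independent set of $(G,w)$ in time $n^{O(n^{2/3}\log^3 n)}$, that is, in at most $C\cdot n^{C\, n^{2/3}(\log_2 n)^3}$ steps for all $n$ (the factor $C$ only matters for $n\le 1$; we read $\log_2 0=0$ and $0^0=1$). Here time is measured on a unit-cost random access machine, on which additions, subtractions and comparisons of weights, and of natural numbers, take constant time; the graph is given by its adjacency matrix with respect to the vertex order. -/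

import Mathlib

/-! ### Ordered graphs -/

/-- The ordered graph `G` contains the ordered graph `H` as an (ordered) induced subgraph: there is
an order-preserving injection of the vertices that preserves both adjacency and non-adjacency. -/
def OrderedContains {U V : Type*} [LinearOrder U] [LinearOrder V]
    (H : SimpleGraph U) (G : SimpleGraph V) : Prop :=
  ∃ f : U ↪o V, ∀ a b : U, G.Adj (f a) (f b) ↔ H.Adj a b

/-- `G` is `H`-free, as an ordered graph. -/
def OrderedFree {U V : Type*} [LinearOrder U] [LinearOrder V]
    (H : SimpleGraph U) (G : SimpleGraph V) : Prop :=
  ¬ OrderedContains H G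

/-- The ordered graph `a (k) b b (k) a` on `2k+4` vertices (here `0, …, 2k+3` in natural order):
two nested edges, one joining the first and the last vertex and one joining the two middle
vertices, with `k` isolated vertices in each of the two gaps between their left, respectively
right, endpoints. -/
def abbaGraph (k : ℕ) : SimpleGraph (Fin (2 * k + 4)) :=
  SimpleGraph.fromRel fun i j =>
    (i.val = 0 ∧ j.val = 2 * k + 3) ∨ (i.val = k + 1 ∧ j.val = k + 2)

/-- `I` is an independent set of maximum total weight in the vertex-weighted graph `(G, w)`. -/
def IsMaxWeightIndepSet {V : Type*} (G : SimpleGraph V) (w : V → ℚ) (I : Finset V) : Prop :=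
  G.IsIndepSet (I : Set V) ∧
    ∀ J : Finset V, G.IsIndepSet (J : Set V) → ∑ v ∈ J, w v ≤ ∑ v ∈ I, w v

/-! ### The machine model: a unit-cost random access machine

The machine has registers and a random-access memory, both holding natural numbers, and a separate
random-access memory holding rational weights. Natural numbers can only be added, subtracted
(truncated at zero) and compared, and so can weights, except that their subtraction is exact; each
such operation takes one time step. Programs are finite structured programs over these
instructions, so a program mentions only finitely many registers. -/

namespace RAM

/-- A configuration of the memory of the machine. -/
structure State where
  /-- The registers. -/
  reg : ℕ → ℕ
  /-- The random-access memory of natural numbers. -/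
  mem : ℕ → ℕ
  /-- The random-access memory of weights. -/
  wt : ℕ → ℚ

/-- Elementary instructions. Parameters are names of registers, except that the parameter `c` of
`const` is a literal. The memories are accessed through addresses held in registers. -/
inductive Instr where
  /-- `reg d := c` -/
  | const (d c : ℕ)
  /-- `reg d := reg a + reg b` -/
  | add (d a b : ℕ)
  /-- `reg d := max (reg a - reg b) 0` -/
  | sub (d a b : ℕ)
  /-- `reg d := mem[reg a]` -/
  | load (d a : ℕ)
  /-- `mem[reg d] := reg a` -/
  | store (d a : ℕ)
  /-- `wt[reg d] := 0` -/
  | wzero (d : ℕ)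
  /-- `wt[reg d] := wt[reg a]` -/
  | wcopy (d a : ℕ)
  /-- `wt[reg d] := wt[reg a] + wt[reg b]` -/
  | wadd (d a b : ℕ)
  /-- `wt[reg d] := wt[reg a] - wt[reg b]` -/
  | wsub (d a b : ℕ)

/-- The effect of an elementary instruction. -/
def Instr.run : Instr → State → State
  | .const d c, s => { s with reg := Function.update s.reg d c }
  | .add d a b, s => { s with reg := Function.update s.reg d (s.reg a + s.reg b) }
  | .sub d a b, s => { s with reg := Function.update s.reg d (s.reg a - s.reg b) }
  | .load d a, s => { s with reg := Function.update s.reg d (s.mem (s.reg a)) }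
  | .store d a, s => { s with mem := Function.update s.mem (s.reg d) (s.reg a) }
  | .wzero d, s => { s with wt := Function.update s.wt (s.reg d) 0 }
  | .wcopy d a, s => { s with wt := Function.update s.wt (s.reg d) (s.wt (s.reg a)) }
  | .wadd d a b, s =>
      { s with wt := Function.update s.wt (s.reg d) (s.wt (s.reg a) + s.wt (s.reg b)) }
  | .wsub d a b, s =>
      { s with wt := Function.update s.wt (s.reg d) (s.wt (s.reg a) - s.wt (s.reg b)) }

/-- Elementary tests. Parameters are names of registers. -/
inductive Test where
  /-- `reg a = reg b` -/
  | eq (a b : ℕ)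
  /-- `reg a < reg b` -/
  | lt (a b : ℕ)
  /-- `wt[reg a] < wt[reg b]` -/
  | wlt (a b : ℕ)

/-- The truth of an elementary test in a state. -/
def Test.Holds : Test → State → Prop
  | .eq a b, s => s.reg a = s.reg b
  | .lt a b, s => s.reg a < s.reg b
  | .wlt a b, s => s.wt (s.reg a) < s.wt (s.reg b)

/-- Programs. -/
inductive Program where
  /-- a single elementary instruction -/
  | instr (i : Instr)
  /-- sequential composition -/
  | seq (p q : Program)
  /-- if `b` then `p` else `q` -/
  | cond (b : Test) (p q : Program)
  /-- while `b` do `p` -/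
  | loop (b : Test) (p : Program)

/-- `Exec p s s' t`: started in state `s`, the program `p` halts in state `s'` after exactly `t`
time steps. Each elementary instruction and each evaluation of a test takes one step. -/
inductive Exec : Program → State → State → ℕ → Prop where
  | instr (i : Instr) (s : State) : Exec (.instr i) s (i.run s) 1
  | seq {p q : Program} {s s' s'' : State} {t t' : ℕ} :
      Exec p s s' t → Exec q s' s'' t' → Exec (.seq p q) s s'' (t + t')
  | cond_true {b : Test} {p q : Program} {s s' : State} {t : ℕ} :
      b.Holds s → Exec p s s' t → Exec (.cond b p q) s s' (t + 1)
  | cond_false {b : Test} {p q : Program} {s s' : State} {t : ℕ} :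
      ¬ b.Holds s → Exec q s s' t → Exec (.cond b p q) s s' (t + 1)
  | loop_true {b : Test} {p : Program} {s s' s'' : State} {t t' : ℕ} :
      b.Holds s → Exec p s s' t → Exec (.loop b p) s' s'' t' →
        Exec (.loop b p) s s'' (t + t' + 1)
  | loop_false {b : Test} {p : Program} {s : State} :
      ¬ b.Holds s → Exec (.loop b p) s s 1

open Classical in
/-- The initial state on input `(G, w)`, where `G` is an ordered graph on `0, …, n-1` in natural
order: register `0` holds `n`, the cells `0, …, n²-1` of the memory hold the adjacency matrix of
`G` row by row, the cells `0, …, n-1` of the weight memory hold the weights, and everything else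
is zero. -/
noncomputable def input {n : ℕ} (G : SimpleGraph (Fin n)) (w : Fin n → ℚ) : State where
  reg r := if r = 0 then n else 0
  mem a := if ∃ i j : Fin n, a = i.val * n + j.val ∧ G.Adj i j then 1 else 0
  wt a := if h : a < n then w ⟨a, h⟩ else 0

/-- The set of vertices returned in a final state: `v` belongs to it iff cell `v` of the memory is
non-zero. -/
def output (n : ℕ) (s : State) : Finset (Fin n) :=
  Finset.univ.filter fun v => s.mem v.val ≠ 0

end RAM

/-- The program `p` solves MWIS in the class `𝒞` of ordered graphs in time `T`: on every `n`-vertex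
graph of the class and all positive rational weights, it halts after at most `T n` steps and
returns an independent set of maximum total weight. -/
def SolvesMWISInTime (p : RAM.Program) (𝒞 : ∀ n : ℕ, SimpleGraph (Fin n) → Prop) (T : ℕ → ℝ) :
    Prop :=
  ∀ (n : ℕ) (G : SimpleGraph (Fin n)), 𝒞 n G → ∀ w : Fin n → ℚ, (∀ v, 0 < w v) →
    ∃ (s : RAM.State) (t : ℕ), RAM.Exec p (RAM.input G w) s t ∧ (t : ℝ) ≤ T n ∧
      IsMaxWeightIndepSet G w (RAM.output n s)

/-! ### Elimination depth -/

/-! The algorithm is a recursion on pairs (X, r) of a vertex set and a budget. If X is empty or r =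
0, the answer is the empty set. A disconnected G[X] is split along a component. In a connected G[X]
a vertex v of maximum degree yields the subproblem X - v with the full budget r, and every z in X
(including v) yields X - z and X - N[z] with budget r - 1. The returned set is independent whatever
the budget, and it is optimal if the budget suffices (`IsBudget`). There are at most
3(n+1)(6(n+1)²)^r subproblems (`treeSize`), so it remains to show that a budget of order n^(2/3) log
n suffices.

Let d = 2^j, where j is minimal with n ≤ 8^j. Taking a vertex of degree at least d discards at least
d vertices, which can happen at most n/d ≤ 4^j times; not taking it costs no budget, only a vertex.
Once all degrees are below d, the relevant parameter is `ElimDepth`, a form of treedepth: there is a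
vertex z whose deletion lowers the depth of G[X], and so does deleting N[z]. The algorithm does not
know z, but it tries every vertex. `Affordable` adds up the two costs and `isBudget_affordable`
shows that their sum is a sufficient budget. The graph theory is thus concentrated in
`elimDepth_of_abbaFree`: in an abba(k)-free graph, vertex sets with degrees below 2^j have
elimination depth O_k(4^j (j+1)).

For that, the vertices of X are renumbered by rank. With small degrees, two nested edges that have
more than g = (2k+4)(d+1) positions in both gaps and no adjacent ends would extend greedily to an
induced abba(k); this gives `NoWideNest`. Hence an edge that jumps widely over an edge xy has an end
in N(x) ∪ N(y). Two consequences are used. A short edge, of length at most 4^j, gives a separator of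
its left side from its right side consisting of its span, margins of width g and two neighbourhoods;
halving the interval of positions removes all short edges with O(j) nested separators of this kind
(`elimDepth_interval`). If all edges are long, let f(z) be the smallest right end of an edge
starting at z or later. Iterating f from 0 cuts the positions into at most 2^j nonempty levels, and
edges off a small separator only join consecutive levels. A cut chooses a position in every level,
compatibly with f, such that after deleting a zone of size O(g+d) around each chosen position and
each level boundary, no edge crosses from below to above (`mem_lowSide_iff_of_adj`). The cuts can be
moved one position at a time (`IsCut.exists_insert`), so one of them halves X, and O(j) rounds of
such balanced separators finish (`elimDepth_of_long`).

The machine runs the recursion without a stack. A first pass writes all subproblems into a queue,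
children behind their parents; a second pass goes backwards and hands every solution to the parent.
The tag tells how: tag n + 1 means that the solution is united with that of the parent (split), tag
n that it competes with it, and a tag z < n that it competes after z has been added. -/

/-- `ElimDepth G X t`: the graph induced on `X` can be reduced to nothing by splitting it into
non-adjacent parts and by deleting single vertices, with at most `t` nested deletions. -/
inductive ElimDepth {V : Type*} [DecidableEq V] (G : SimpleGraph V) : Finset V → ℕ → Prop
  | empty (t : ℕ) : ElimDepth G ∅ t
  | split {Y Z : Finset V} {t : ℕ} : (∀ y ∈ Y, ∀ z ∈ Z, ¬ G.Adj y z) →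
      ElimDepth G Y t → ElimDepth G Z t → ElimDepth G (Y ∪ Z) t
  | branch {X : Finset V} {t : ℕ} (v : V) : ElimDepth G (X.erase v) t → ElimDepth G X (t + 1)

namespace ElimDepth

variable {V W : Type*} [DecidableEq V] [DecidableEq W] {G : SimpleGraph V} {H : SimpleGraph W}

theorem mono {X : Finset V} {t t' : ℕ} (h : ElimDepth G X t) (htt : t ≤ t') :
    ElimDepth G X t' := by
  induction h generalizing t' with
  | empty t => exact .empty _
  | split hn _ _ h1 h2 => exact .split hn (h1 htt) (h2 htt)
  | branch v _ ih =>
    obtain ⟨t'', rfl⟩ : ∃ t'', t' = t'' + 1 := ⟨t' - 1, by omega⟩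
    exact .branch v (ih (by omega))

/-- Fewer vertices and edges only make elimination easier: preimages of non-adjacent parts are
non-adjacent, and by injectivity a deleted vertex has at most one preimage in X. -/
theorem comap {Y : Finset W} {t : ℕ} (h : ElimDepth H Y t) (f : V → W) (X : Finset V)
    (hf : ∀ a ∈ X, ∀ b ∈ X, G.Adj a b → H.Adj (f a) (f b)) (hi : Set.InjOn f X)
    (hX : ∀ x ∈ X, f x ∈ Y) : ElimDepth G X t := by
  classical
  induction h generalizing X with
  | empty t =>
    have : X = ∅ := Finset.eq_empty_of_forall_notMem fun x hx => by simpa using hX x hx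
    subst this
    exact .empty _
  | @split Y Z t hn _ _ h1 h2 =>
    have : X = X.filter (fun x => f x ∈ Y) ∪ X.filter (fun x => f x ∈ Z) := by
      ext x
      have := hX x
      simp only [Finset.mem_union, Finset.mem_filter] at *
      tauto
    have hsub : ∀ (U : Finset W), ∀ x ∈ X.filter (fun x => f x ∈ U), x ∈ X :=
      fun U x hx => (Finset.mem_filter.1 hx).1
    have h1' := h1 (X.filter fun x => f x ∈ Y)
      (fun a ha b hb => hf a (hsub Y a ha) b (hsub Y b hb)) (hi.mono fun a ha => hsub Y a ha)
      fun x hx => (Finset.mem_filter.1 hx).2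
    have h2' := h2 (X.filter fun x => f x ∈ Z)
      (fun a ha b hb => hf a (hsub Z a ha) b (hsub Z b hb)) (hi.mono fun a ha => hsub Z a ha)
      fun x hx => (Finset.mem_filter.1 hx).2
    rw [this]
    refine .split ?_ h1' h2'
    intro y hy z hz hyz
    simp only [Finset.mem_filter] at hy hz
    exact hn _ hy.2 _ hz.2 (hf _ hy.1 _ hz.1 hyz)
  | @branch Y t v _ ih =>
    by_cases hv : ∃ x ∈ X, f x = v
    · obtain ⟨x, hx, rfl⟩ := hv
      have hsub : ∀ y ∈ X.erase x, y ∈ X := fun y hy => Finset.mem_of_mem_erase hy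
      refine .branch x (ih _ (fun a ha b hb => hf a (hsub a ha) b (hsub b hb)) (hi.mono fun a ha => hsub a ha)
        fun y hy => ?_)
      rw [Finset.mem_erase] at hy ⊢
      exact ⟨fun h => hy.1 (hi hy.2 hx h), hX y hy.2⟩
    · refine (ih X hf hi fun y hy => ?_).mono (Nat.le_succ _)
      exact Finset.mem_erase.2 ⟨fun h => hv ⟨y, hy, h⟩, hX y hy⟩

theorem subset {X Y : Finset V} {t : ℕ} (h : ElimDepth G Y t) (hXY : X ⊆ Y) :
    ElimDepth G X t :=
  h.comap id X (fun _ _ _ _ h => h) (Set.injOn_id _) hXY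

theorem of_sdiff {X : Finset V} {t : ℕ} (S : Finset V) (h : ElimDepth G (X \ S) t) :
    ElimDepth G X (S.card + t) := by
  induction S using Finset.induction_on generalizing X with
  | empty => simpa using h
  | insert v S hv ih =>
    rw [Finset.card_insert_of_notMem hv]
    refine (ElimDepth.branch v (ih (X := X.erase v) (h.subset ?_))).mono (by omega)
    intro x hx
    simp only [Finset.mem_sdiff, Finset.mem_erase, Finset.mem_insert] at *
    tauto

/-- Reduction along a separator. -/
theorem of_separator {X Y Z S : Finset V} {s t : ℕ} (hS : S.card ≤ s) (hX : X \ S ⊆ Y ∪ Z)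
    (hn : ∀ y ∈ Y \ S, ∀ z ∈ Z \ S, ¬ G.Adj y z)
    (hY : ElimDepth G Y t) (hZ : ElimDepth G Z t) : ElimDepth G X (s + t) := by
  have h := ElimDepth.split hn (hY.subset Finset.sdiff_subset) (hZ.subset Finset.sdiff_subset)
  refine (of_sdiff S (h.subset ?_)).mono (by omega)
  intro x hx
  have := hX hx
  simp only [Finset.mem_sdiff, Finset.mem_union] at *
  tauto

theorem of_card_le_one {X : Finset V} (h : X.card ≤ 1) : ElimDepth G X 1 := by
  obtain rfl | ⟨x, hx⟩ := X.eq_empty_or_nonempty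
  · exact .empty _
  · have : X.erase x = ∅ := by
      rw [← Finset.card_eq_zero, Finset.card_erase_of_mem hx]; omega
    exact .branch x (this ▸ .empty 0)

/-- In a connected set, the first step of the reduction deletes a vertex. -/
theorem exists_erase {X : Finset V} {t : ℕ} (h : ElimDepth G X t) {u : V} (hu : u ∈ X)
    (hc : ∀ Y ⊆ X, (∀ y ∈ Y, ∀ x ∈ X, G.Adj y x → x ∈ Y) → u ∈ Y → X ⊆ Y) :
    ∃ v ∈ X, ∃ t', t = t' + 1 ∧ ElimDepth G (X.erase v) t' := by
  induction h with
  | empty t => simp at hu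
  | @split Y Z t hn hY hZ h1 h2 =>
    rcases Finset.mem_union.1 hu with hu' | hu'
    -- Both sides of a split are closed under adjacency, so the side that contains u is everything.
    · have := hc Y Finset.subset_union_left (fun y hy x hx hyx => by
        rcases Finset.mem_union.1 hx with h | h
        · exact h
        · exact absurd hyx (hn y hy x h)) hu'
      have e : Y ∪ Z = Y := Finset.Subset.antisymm this Finset.subset_union_left
      rw [e] at hc ⊢
      exact h1 hu' hc
    · have := hc Z Finset.subset_union_right (fun y hy x hx hyx => by
        rcases Finset.mem_union.1 hx with h | h
        · exact absurd hyx.symm (hn x h y hy)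
        · exact h) hu'
      have e : Y ∪ Z = Z := Finset.Subset.antisymm this Finset.subset_union_right
      rw [e] at hc ⊢
      exact h2 hu' hc
  | @branch X t v h ih =>
    by_cases hv : v ∈ X
    · exact ⟨v, hv, t, rfl, h⟩
    -- Deleting a vertex outside of X does nothing; the first effective deletion comes later.
    · rw [Finset.erase_eq_of_notMem hv] at h ih
      obtain ⟨v', hv', t', rfl, h'⟩ := ih hu hc
      exact ⟨v', hv', _, rfl, h'.mono (by omega)⟩

end ElimDepth

/-! ### Sweeping cuts -/

section Sweep

variable (f : ℕ → ℕ) (m : ℕ)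

/-- The boundaries of the levels `0, f 0, f (f 0), …`. -/
def levelStart (i : ℕ) : ℕ := f^[i] 0

/-- A cut: a position in each level, compatible with `f`. -/
structure IsCut (b : ℕ → ℕ) : Prop where
  zero_le : b 0 ≤ levelStart f 1
  le_succ : ∀ i, f (b i) ≤ b (i + 1)
  succ_le : ∀ i, b (i + 1) ≤ levelStart f (i + 2)
  succ_le_of_lt : ∀ i, b i < levelStart f (i + 1) → b (i + 1) ≤ f (b i + 1)

open Classical in
/-- The positions below a cut. -/
noncomputable def lowSide (b : ℕ → ℕ) : Finset ℕ :=
  (Finset.range m).filter fun x => ∃ i, levelStart f i ≤ x ∧ x < b i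

variable {f m}

set_option linter.unusedSectionVars false

theorem levelStart_succ (i : ℕ) : levelStart f (i + 1) = f (levelStart f i) := by
  simp [levelStart, Function.iterate_succ_apply']

variable (hmono : Monotone f) (hle : ∀ z, f z ≤ m) (hlt : ∀ z, z < f z ∨ f z = m)

include hmono hle hlt

theorem levelStart_le (i : ℕ) : levelStart f i ≤ m := by
  cases i with
  | zero => simp [levelStart]
  | succ i => rw [levelStart_succ]; exact hle _

theorem levelStart_mono : Monotone (levelStart f) := by
  refine monotone_nat_of_le_succ fun i => ?_
  rw [levelStart_succ]
  rcases hlt (levelStart f i) with h | h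
  · exact h.le
  · rw [h]; exact levelStart_le hmono hle hlt i

theorem le_levelStart (i : ℕ) : min i m ≤ levelStart f i := by
  induction i with
  | zero => simp
  | succ i ih =>
    rw [levelStart_succ]
    rcases hlt (levelStart f i) with h | h <;> omega

theorem exists_level {x : ℕ} (hx : x < m) : ∃ i, levelStart f i ≤ x ∧ x < levelStart f (i + 1) := by
  by_contra! h
  have : ∀ i, levelStart f i ≤ x := by
    intro i
    induction i with
    | zero => simp [levelStart]
    | succ i ih => exact h i ih
  have := this m
  have := le_levelStart hmono hle hlt m
  omega

theorem IsCut.start : IsCut f (levelStart f) where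
  zero_le := levelStart_mono hmono hle hlt (by omega)
  le_succ i := (levelStart_succ i).ge
  succ_le i := levelStart_mono hmono hle hlt (by omega)
  succ_le_of_lt i h := by
    rw [levelStart_succ]; exact hmono (by omega)

theorem IsCut.le_start {b : ℕ → ℕ} (hb : IsCut f b) (i : ℕ) : b i ≤ levelStart f (i + 1) := by
  cases i with
  | zero => exact hb.zero_le
  | succ i => exact hb.succ_le i

theorem IsCut.start_le {b : ℕ → ℕ} (hb : IsCut f b) (i : ℕ) : levelStart f i ≤ b i := by
  induction i with
  | zero => simp [levelStart]
  | succ i ih =>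
    rw [levelStart_succ]; exact (hmono ih).trans (hb.le_succ i)

theorem IsCut.mem_lowSide {b : ℕ → ℕ} (hb : IsCut f b) {x i : ℕ} (h1 : levelStart f i ≤ x)
    (h2 : x < levelStart f (i + 1)) : x ∈ lowSide f m b ↔ x < b i := by
  have hm := levelStart_mono hmono hle hlt
  simp only [lowSide, Finset.mem_filter, Finset.mem_range]
  constructor
  · rintro ⟨-, j, hj1, hj2⟩
    rcases lt_trichotomy i j with h | h | h
    · have := hm (show i + 1 ≤ j by omega)
      omega
    · exact h ▸ hj2
    · have := hm (show j + 1 ≤ i by omega)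
      have := hb.le_start hmono hle hlt j
      omega
  · intro h
    have := levelStart_le hmono hle hlt (i + 1)
    exact ⟨by omega, i, h1, h⟩

/-- The coordinate to advance is the last movable one, that is, the last b_i that has reached
neither the end of its level nor its upper bound f(b_{i-1} + 1). As b_{i+1} is not movable, f(b_i +
1) ≤ b_{i+1}, which is what the advanced cut must satisfy towards the next level. -/
theorem IsCut.exists_insert {b : ℕ → ℕ} (hb : IsCut f b) (hne : lowSide f m b ≠ Finset.range m) :
    ∃ b' x, IsCut f b' ∧ x ∉ lowSide f m b ∧ x < m ∧ lowSide f m b' = insert x (lowSide f m b) := by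
  classical
  have hm := levelStart_mono hmono hle hlt
  let P : ℕ → Prop := fun i => b i < levelStart f (i + 1) ∧ (i = 0 ∨ b i < f (b (i - 1) + 1))
  -- If a coordinate is not at the end of its level but blocked by the preceding one, then that one
  -- is not at the end of its level either, so the descent reaches a movable coordinate, at the
  -- latest in level 0.
  have hdesc : ∀ i, b i < levelStart f (i + 1) → ∃ j, P j := by
    intro i
    induction i with
    | zero => exact fun h => ⟨0, h, Or.inl rfl⟩
    | succ i ih =>
      intro h
      by_cases h1 : b (i + 1) < f (b i + 1)
      · exact ⟨i + 1, h, Or.inr (by simpa using h1)⟩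
      · refine ih ?_
        by_contra! h2
        have := hb.le_succ i
        have := hmono h2
        rw [← levelStart_succ (f := f)] at this
        simp only [Nat.add_assoc, Nat.reduceAdd] at *
        omega
  have hex : ∃ j, P j := by
    obtain ⟨x, hx, hxb⟩ : ∃ x < m, x ∉ lowSide f m b := by
      by_contra! h
      refine hne (Finset.Subset.antisymm (by simp [lowSide]) fun x hx => h x (by simpa using hx))
    obtain ⟨i, h1, h2⟩ := exists_level hmono hle hlt hx
    rw [hb.mem_lowSide hmono hle hlt h1 h2] at hxb
    exact hdesc i (by omega)
  -- The level boundaries reach m after at most m steps, so no later coordinate can move and a last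
  -- movable one exists.
  have hbd : ∀ j, P j → j ≤ m := by
    intro j hj
    have := hb.start_le hmono hle hlt j
    have := le_levelStart hmono hle hlt j
    have := levelStart_le hmono hle hlt (j + 1)
    have := hj.1
    omega
  obtain ⟨j, hj⟩ := hex
  let i := Nat.findGreatest P m
  have hi : P i := Nat.findGreatest_spec (hbd j hj) hj
  have hi' : ¬ P (i + 1) := fun h => by
    have := Nat.le_findGreatest (hbd _ h) h
    change i + 1 ≤ i at this
    omega
  have hilt := hi.1
  have hsucc : f (b i + 1) ≤ b (i + 1) := by
    by_contra! h
    refine hi' ⟨?_, Or.inr (by simpa using h)⟩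
    have := hmono (show b i + 1 ≤ levelStart f (i + 1) from hilt)
    rw [← levelStart_succ (f := f)] at this
    exact h.trans_le this
  have hcut : IsCut f (Function.update b i (b i + 1)) := by
    constructor
    · by_cases h : i = 0
      · rw [← h, Function.update_self, h]; rw [h] at hilt; exact hilt
      · rw [Function.update_of_ne (Ne.symm h)]; exact hb.zero_le
    · intro l
      by_cases h : l = i
      · subst h; simpa using hsucc
      · rw [Function.update_of_ne h]
        by_cases h' : l + 1 = i
        · have := hb.le_succ l
          rw [← h', Function.update_self]; omega
        · rw [Function.update_of_ne h']; exact hb.le_succ l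
    · intro l
      by_cases h' : l + 1 = i
      · rw [← h', Function.update_self]
        rw [← h'] at hilt; exact hilt
      · rw [Function.update_of_ne h']; exact hb.succ_le l
    · intro l hl
      by_cases h : l = i
      · subst h
        rw [Function.update_self] at hl ⊢
        rw [Function.update_of_ne (by omega)]
        exact (hb.succ_le_of_lt _ (by omega)).trans (hmono (by omega))
      · rw [Function.update_of_ne h] at hl ⊢
        by_cases h' : l + 1 = i
        · rw [← h', Function.update_self]
          rcases hi.2 with h0 | h0
          · omega
          · rw [← h'] at h0; simpa using h0
        · rw [Function.update_of_ne h']; exact hb.succ_le_of_lt l hl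
  have h1 := hb.start_le hmono hle hlt i
  have him := levelStart_le hmono hle hlt (i + 1)
  refine ⟨_, b i, hcut, ?_, by omega, ?_⟩
  · rw [hb.mem_lowSide hmono hle hlt h1 hilt]; omega
  · ext x
    rw [Finset.mem_insert]
    by_cases hx : x < m
    · obtain ⟨l, hl1, hl2⟩ := exists_level hmono hle hlt hx
      rw [hb.mem_lowSide hmono hle hlt hl1 hl2, hcut.mem_lowSide hmono hle hlt hl1 hl2]
      by_cases h : l = i
      · subst h; rw [Function.update_self]; omega
      · rw [Function.update_of_ne h]
        have : x ≠ b i := by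
          rintro rfl
          rcases lt_or_gt_of_ne h with h | h
          · have := hm (show l + 1 ≤ i by omega); omega
          · have := hm (show i + 1 ≤ l by omega); omega
        tauto
    · have h2 : ∀ b, x ∉ lowSide f m b := fun b => by simp [lowSide, hx]
      have : x ≠ b i := by omega
      simp [h2, this]

/-- The cuts sweep over the positions one at a time, so some cut bisects a given set. -/
theorem exists_cut_card (X : Finset ℕ) (hX : X ⊆ Finset.range m) {τ : ℕ} (hτ : τ ≤ X.card) :
    ∃ b, IsCut f b ∧ (X ∩ lowSide f m b).card = τ := by
  classical
  -- Here e is the number of positions that are still above the cut. An advance adds at most one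
  -- element of X, so the value τ cannot be skipped.
  have key : ∀ e b, IsCut f b → (X ∩ lowSide f m b).card ≤ τ → m - (lowSide f m b).card = e →
      ∃ b, IsCut f b ∧ (X ∩ lowSide f m b).card = τ := by
    intro e
    induction e with
    | zero =>
      intro b hb hc he
      have : lowSide f m b = Finset.range m := by
        refine Finset.eq_of_subset_of_card_le (by simp [lowSide]) ?_
        rw [Finset.card_range]; omega
      refine ⟨b, hb, ?_⟩
      rw [this, Finset.inter_eq_left.2 hX] at hc ⊢
      omega
    | succ e ih =>
      intro b hb hc he
      rcases hc.lt_or_eq with hc | hc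
      · obtain ⟨b', x, hb', hx, hxm, hl⟩ := hb.exists_insert hmono hle hlt (fun h => by
          rw [h, Finset.card_range] at he; omega)
        refine ih b' hb' ?_ ?_
        · rw [hl]
          have : X ∩ insert x (lowSide f m b) ⊆ insert x (X ∩ lowSide f m b) := by
            intro y; simp only [Finset.mem_inter, Finset.mem_insert]; tauto
          have := Finset.card_le_card this
          have := Finset.card_insert_le x (X ∩ lowSide f m b)
          omega
        · rw [hl, Finset.card_insert_of_notMem hx]; omega
      · exact ⟨b, hb, hc⟩
  refine key _ _ (IsCut.start hmono hle hlt) ?_ rfl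
  have : lowSide f m (levelStart f) = ∅ := by
    refine Finset.eq_empty_of_forall_notMem fun x hx => ?_
    obtain ⟨-, i, h1, h2⟩ := Finset.mem_filter.1 hx
    omega
  simp [this]

end Sweep

/-! ### Separators in graphs without widely nested edges -/

/-- Two edges that are nested with gaps larger than `g` on both sides have adjacent ends. -/
def NoWideNest (G : SimpleGraph ℕ) (g : ℕ) : Prop :=
  ∀ u x y v, u + g < x → x < y → y + g < v → G.Adj u v → G.Adj x y →
    G.Adj x u ∨ G.Adj y u ∨ G.Adj x v ∨ G.Adj y v

/-- The smallest right end of an edge of `G[X]` with left end at least `z`, or `m` if there is no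
such edge. -/
noncomputable def nextEnd (G : SimpleGraph ℕ) (X : Finset ℕ) (m z : ℕ) : ℕ :=
  sInf {y | y = m ∨ ∃ x ∈ X, y ∈ X ∧ z ≤ x ∧ x < y ∧ G.Adj x y}

section NextEnd

variable {G : SimpleGraph ℕ} {X : Finset ℕ} {m : ℕ}

theorem nextEnd_mem (z : ℕ) : nextEnd G X m z = m ∨
    ∃ x ∈ X, nextEnd G X m z ∈ X ∧ z ≤ x ∧ x < nextEnd G X m z ∧ G.Adj x (nextEnd G X m z) :=
  Nat.sInf_mem (s := {y | y = m ∨ ∃ x ∈ X, y ∈ X ∧ z ≤ x ∧ x < y ∧ G.Adj x y}) ⟨m, Or.inl rfl⟩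

theorem nextEnd_le (z : ℕ) : nextEnd G X m z ≤ m :=
  Nat.sInf_le (Or.inl rfl)

theorem nextEnd_le_of_adj {z x y : ℕ} (hx : x ∈ X) (hy : y ∈ X) (hz : z ≤ x) (hxy : x < y)
    (h : G.Adj x y) : nextEnd G X m z ≤ y :=
  Nat.sInf_le (Or.inr ⟨x, hx, hy, hz, hxy, h⟩)

theorem nextEnd_mono : Monotone (nextEnd G X m) := by
  intro z z' hz
  rcases nextEnd_mem (G := G) (X := X) (m := m) z' with h | ⟨x, hx, hy, h1, h2, h3⟩
  · rw [h]; exact nextEnd_le z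
  · exact nextEnd_le_of_adj hx hy (hz.trans h1) h2 h3

end NextEnd

section Separator

open Classical in
/-- The neighbours of `v` among the first `m` positions. -/
noncomputable def neighborsBelow (G : SimpleGraph ℕ) (m v : ℕ) : Finset ℕ :=
  (Finset.range m).filter (G.Adj v)

open Classical in
/-- The neighbours of the ends of an edge realizing `nextEnd`. -/
noncomputable def nextEdgeNeighbors (G : SimpleGraph ℕ) (X : Finset ℕ) (m z : ℕ) : Finset ℕ :=
  if h : ∃ x ∈ X, nextEnd G X m z ∈ X ∧ z ≤ x ∧ x < nextEnd G X m z ∧ G.Adj x (nextEnd G X m z)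
  then neighborsBelow G m h.choose ∪ neighborsBelow G m (nextEnd G X m z) else ∅

/-- The vertices that are removed around the position `z` of a cut. -/
noncomputable def cutZone (G : SimpleGraph ℕ) (X : Finset ℕ) (m g z : ℕ) : Finset ℕ :=
  Finset.Icc (z - g) (z + g) ∪ nextEdgeNeighbors G X m z

variable {G : SimpleGraph ℕ} {X : Finset ℕ} {m g d : ℕ}

theorem card_cutZone_le (hd : ∀ v, (neighborsBelow G m v).card ≤ d) (z : ℕ) :
    (cutZone G X m g z).card ≤ 2 * g + 1 + 2 * d := by
  have h1 : (nextEdgeNeighbors G X m z).card ≤ 2 * d := by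
    unfold nextEdgeNeighbors
    split_ifs with h
    · refine (Finset.card_union_le _ _).trans ?_
      have := hd h.choose
      have := hd (nextEnd G X m z)
      omega
    · simp
  have h2 : (Finset.Icc (z - g) (z + g)).card ≤ 2 * g + 1 := by
    rw [Nat.card_Icc]; omega
  exact (Finset.card_union_le _ _).trans (by omega)

/-- No edge jumps over an edge realizing `nextEnd` outside of the cut zones. -/
theorem false_of_crossing (hg : NoWideNest G g) (hX : X ⊆ Finset.range m) {z e x y : ℕ}
    (hx : x ∈ X) (hy : y ∈ X) (hxy : G.Adj x y) (hxz : x < z) (hze : nextEnd G X m z ≤ e)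
    (hey : e ≤ y) (h1 : x ∉ cutZone G X m g z) (h2 : y ∉ cutZone G X m g z)
    (h3 : y ∉ cutZone G X m g e) : False := by
  have hym := Finset.mem_range.1 (hX hy)
  have hxm := Finset.mem_range.1 (hX hx)
  have h : ∃ x ∈ X, nextEnd G X m z ∈ X ∧ z ≤ x ∧ x < nextEnd G X m z ∧
      G.Adj x (nextEnd G X m z) := by
    rcases nextEnd_mem (G := G) (X := X) (m := m) z with h | h
    · omega
    · exact h
  obtain ⟨hc1, hc2, hc3, hc4, hc5⟩ := h.choose_spec
  simp only [cutZone, nextEdgeNeighbors, dif_pos h, neighborsBelow, Finset.mem_union,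
    Finset.mem_Icc, Finset.mem_filter, Finset.mem_range, not_or, not_and, hxm, hym,
    true_imp_iff] at h1 h2 h3
  -- Avoiding the windows around z and e puts x more than g to the left, and y more than g to the
  -- right, of the realizing edge. The nesting is wide, so x or y is in a neighbourhood that belongs
  -- to the zone of z.
  have := hg x h.choose (nextEnd G X m z) y (by omega) hc4 (by omega) hxy hc5
  tauto

open Classical in
/-- All vertices removed at a cut. -/
noncomputable def cutSeparator (G : SimpleGraph ℕ) (X : Finset ℕ) (m g c : ℕ) (b : ℕ → ℕ) :
    Finset ℕ :=
  (Finset.range (c + 2)).biUnion fun i =>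
    cutZone G X m g (b i) ∪ cutZone G X m g (levelStart (nextEnd G X m) i)

theorem card_cutSeparator_le (hd : ∀ v, (neighborsBelow G m v).card ≤ d) (c : ℕ) (b : ℕ → ℕ) :
    (cutSeparator G X m g c b).card ≤ (c + 2) * (2 * (2 * g + 1 + 2 * d)) := by
  refine Finset.card_biUnion_le.trans ?_
  refine (Finset.sum_le_card_nsmul _ _ (2 * (2 * g + 1 + 2 * d)) fun i _ => ?_).trans (by simp)
  refine (Finset.card_union_le _ _).trans ?_
  have := card_cutZone_le (X := X) (g := g) hd (b i)
  have := card_cutZone_le (X := X) (g := g) hd (levelStart (nextEnd G X m) i)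
  omega

variable {c ℓ : ℕ} (hg : NoWideNest G g) (hX : X ⊆ Finset.range m)
  (hlong : ∀ x ∈ X, ∀ y ∈ X, x < y → G.Adj x y → x + ℓ < y) (hcl : m ≤ c * ℓ)

include hlong in
theorem add_lt_nextEnd (z : ℕ) : z + ℓ < nextEnd G X m z ∨ nextEnd G X m z = m := by
  rcases nextEnd_mem (G := G) (X := X) (m := m) z with h | ⟨x, hx, hy, h1, h2, h3⟩
  · exact Or.inr h
  · have := hlong x hx _ hy h2 h3
    omega

include hlong in
theorem lt_nextEnd (z : ℕ) : z < nextEnd G X m z ∨ nextEnd G X m z = m :=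
  (add_lt_nextEnd hlong z).imp_left fun h => by omega

include hlong in
theorem mul_le_levelStart (i : ℕ) : i * ℓ ≤ levelStart (nextEnd G X m) i ∨
    levelStart (nextEnd G X m) i = m := by
  induction i with
  | zero => simp
  | succ i ih =>
    rw [levelStart_succ]
    rcases add_lt_nextEnd (m := m) hlong (levelStart (nextEnd G X m) i) with h | h
    · rcases ih with h' | h'
      · left; rw [Nat.add_mul]; omega
      · have := nextEnd_le (G := G) (X := X) (m := m) (levelStart (nextEnd G X m) i)
        omega
    · exact Or.inr h

include hg hX hlong hcl in
-- An edge that starts in level i ends at or after the start of level i + 1, by definition of f. It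
-- ends before level i + 2, since otherwise it would jump over the edge that realizes f at the start
-- of level i + 1. An edge from below the cut to above it would jump over the edge that realizes f
-- at b_i; in the opposite direction it would contradict b_{i+1} ≤ f(b_i + 1).
theorem mem_lowSide_iff_of_adj {b : ℕ → ℕ} (hb : IsCut (nextEnd G X m) b) {x y : ℕ}
    (hx : x ∈ X) (hy : y ∈ X) (hxy : G.Adj x y) (hlt : x < y)
    (hxS : x ∉ cutSeparator G X m g c b) (hyS : y ∉ cutSeparator G X m g c b) :
    x ∈ lowSide (nextEnd G X m) m b ↔ y ∈ lowSide (nextEnd G X m) m b := by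
  set f := nextEnd G X m with hf
  have hmono : Monotone f := nextEnd_mono
  have hle : ∀ z, f z ≤ m := nextEnd_le
  have hlt' : ∀ z, z < f z ∨ f z = m := lt_nextEnd hlong
  obtain ⟨i, hi1, hi2⟩ := exists_level hmono hle hlt' (Finset.mem_range.1 (hX hx))
  -- Until m is reached, each level is longer than ℓ, and m ≤ cℓ. The c + 2 indices of the separator
  -- therefore include i + 2, which is needed below.
  have hic : i < c := by
    have hxm := Finset.mem_range.1 (hX hx)
    rcases mul_le_levelStart (m := m) hlong i with h | h <;> rw [← hf] at h
    · by_contra! hc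
      have := Nat.mul_le_mul_right ℓ hc
      omega
    · omega
  have hS : ∀ v, v ∉ cutSeparator G X m g c b → ∀ j ≤ i + 2,
      v ∉ cutZone G X m g (b j) ∧ v ∉ cutZone G X m g (levelStart f j) := by
    intro v hv j hj
    simp only [cutSeparator, Finset.mem_biUnion, Finset.mem_range, Finset.mem_union, not_exists,
      not_and, not_or] at hv
    rcases Nat.lt_or_ge j (c + 2) with h | h
    · exact hv j h
    · omega
  have hy1 : levelStart f (i + 1) ≤ y := by
    rw [levelStart_succ]; exact nextEnd_le_of_adj hx hy hi1 hlt hxy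
  have hy2 : y < levelStart f (i + 2) := by
    by_contra! h
    exact false_of_crossing hg hX hx hy hxy hi2 (levelStart_succ (f := f) (i + 1)).ge h
      (hS x hxS (i + 1) (by omega)).2 (hS y hyS (i + 1) (by omega)).2
      (hS y hyS (i + 2) (by omega)).2
  rw [hb.mem_lowSide hmono hle hlt' hi1 hi2, hb.mem_lowSide hmono hle hlt' hy1 hy2]
  constructor
  · intro h
    by_contra! h'
    exact false_of_crossing hg hX hx hy hxy h (hb.le_succ i) h'
      (hS x hxS i (by omega)).1 (hS y hyS i (by omega)).1 (hS y hyS (i + 1) (by omega)).1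
  · intro h
    by_contra! h'
    -- The bound f(b_i + 1) concerns left ends beyond b_i only; the position b_i itself lies in its
    -- own zone.
    have hne : x ≠ b i := by
      rintro rfl
      refine (hS _ hxS i (by omega)).1 ?_
      simp [cutZone]
    have h1 := hb.succ_le_of_lt i (by omega)
    have h2 : f (b i + 1) ≤ y := nextEnd_le_of_adj hx hy (by omega) hlt hxy
    omega

include hg hcl in
/-- Reduction of a set without short edges. -/
theorem elimDepth_of_long (hd : ∀ v, (neighborsBelow G m v).card ≤ d) (e : ℕ) :
    ∀ X ⊆ Finset.range m, (∀ x ∈ X, ∀ y ∈ X, x < y → G.Adj x y → x + ℓ < y) → X.card ≤ 2 ^ e →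
      ElimDepth G X (e * ((c + 2) * (2 * (2 * g + 1 + 2 * d))) + 1) := by
  induction e with
  | zero =>
    intro X _ _ h
    simpa using ElimDepth.of_card_le_one h
  | succ e ih =>
    intro X hX hlong hc
    -- A cut that halves X gives a balanced separator, so e rounds lead down to single vertices.
    obtain ⟨b, hb, hbc⟩ := exists_cut_card (nextEnd_mono (G := G) (X := X) (m := m)) nextEnd_le
      (lt_nextEnd hlong) X hX (τ := X.card / 2) (Nat.div_le_self _ _)
    set A := lowSide (nextEnd G X m) m b
    rw [pow_succ] at hc
    have h1 := ih (X ∩ A) (Finset.inter_subset_left.trans hX)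
      (fun x hx y hy => hlong x (Finset.mem_of_mem_inter_left hx) y
        (Finset.mem_of_mem_inter_left hy)) (by omega)
    have h2 := ih (X \ A) (Finset.sdiff_subset.trans hX)
      (fun x hx y hy => hlong x (Finset.sdiff_subset hx) y (Finset.sdiff_subset hy)) (by
        have := Finset.card_inter_add_card_sdiff X A
        omega)
    have := ElimDepth.of_separator (X := X) (card_cutSeparator_le (X := X) (g := g) hd c b)
      (Y := X ∩ A) (Z := X \ A) ?_ ?_ h1 h2
    · refine this.mono (le_of_eq (by ring))
    · intro x hx
      simp only [Finset.mem_union, Finset.mem_inter, Finset.mem_sdiff] at *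
      tauto
    · intro y hy z hz hyz
      simp only [Finset.mem_inter, Finset.mem_sdiff] at hy hz
      rcases lt_trichotomy y z with h | h | h
      · exact hz.1.2 ((mem_lowSide_iff_of_adj hg hX hlong hcl hb hy.1.1 hz.1.1 hyz h hy.2 hz.2).1
          hy.1.2)
      · exact G.ne_of_adj hyz h
      · exact hz.1.2 ((mem_lowSide_iff_of_adj hg hX hlong hcl hb hz.1.1 hy.1.1 hyz.symm h hz.2
          hy.2).2 hy.1.2)

include hg in
/-- A short edge yields a separator of its left side from its right side. -/
theorem elimDepth_of_short (hd : ∀ v, (neighborsBelow G m v).card ≤ d) {X : Finset ℕ}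
    (hX : X ⊆ Finset.range m) {u v t : ℕ} (huv : u < v) (hadj : G.Adj u v) (hs : v ≤ u + ℓ)
    (h1 : ElimDepth G (X.filter (· < u)) t) (h2 : ElimDepth G (X.filter (v < ·)) t) :
    ElimDepth G X (ℓ + 2 * g + 1 + 2 * d + t) := by
  classical
  refine ElimDepth.of_separator (S := Finset.Icc (u - g) (v + g) ∪ neighborsBelow G m u ∪
    neighborsBelow G m v) ?_ ?_ ?_ h1 h2
  · have := hd u
    have := hd v
    have h3 : (Finset.Icc (u - g) (v + g)).card ≤ ℓ + 2 * g + 1 := by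
      rw [Nat.card_Icc]; omega
    refine (Finset.card_union_le _ _).trans ?_
    have := Finset.card_union_le (Finset.Icc (u - g) (v + g)) (neighborsBelow G m u)
    omega
  · intro x hx
    simp only [Finset.mem_sdiff, Finset.mem_union, Finset.mem_Icc, not_or, not_and,
      Finset.mem_filter] at *
    have := hx.2.1.1
    rcases lt_or_ge x u with h | h
    · exact Or.inl ⟨hx.1, h⟩
    · exact Or.inr ⟨hx.1, by omega⟩
  · intro y hy z hz hyz
    simp only [Finset.mem_sdiff, Finset.mem_union, Finset.mem_Icc, not_or, not_and,
      Finset.mem_filter, neighborsBelow, Finset.mem_range] at hy hz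
    obtain ⟨⟨hyX, hyu⟩, ⟨hyw, hyNu⟩, hyNv⟩ := hy
    obtain ⟨⟨hzX, hzv⟩, ⟨hzw, hzNu⟩, hzNv⟩ := hz
    have h3 := Finset.mem_range.1 (hX hyX)
    have h4 := Finset.mem_range.1 (hX hzX)
    -- An edge from y to z would nest widely around uv, because both ends are outside of the
    -- margins.
    rcases hg y u v z (by omega) huv (by omega) hyz hadj with h | h | h | h
    · exact hyNu h3 h
    · exact hyNv h3 h
    · exact hzNu h4 h
    · exact hzNv h4 h

include hg in
/-- Removing all short edges whose left end is below a given bound. -/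
theorem elimDepth_interval (hd : ∀ v, (neighborsBelow G m v).card ≤ d) {t : ℕ}
    (hlong : ∀ X ⊆ Finset.range m, (∀ x ∈ X, ∀ y ∈ X, x < y → G.Adj x y → x + ℓ < y) →
      ElimDepth G X t) (e : ℕ) : ∀ a, ∀ X ⊆ Finset.range m, (∀ x ∈ X, a ≤ x ∧ x < a + 2 ^ e) →
      ElimDepth G X (e * (2 * (ℓ + 2 * g + 1 + 2 * d)) + t) := by
  classical
  induction e with
  | zero =>
    intro a X hX ha
    refine (hlong X hX fun x hx y hy hxy _ => ?_).mono (by omega)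
    have := ha x hx
    have := ha y hy
    omega
  | succ e ih =>
    intro a X hX ha
    set w := ℓ + 2 * g + 1 + 2 * d
    set t' := e * (2 * w) + t
    -- Each halving uses two separators of size at most w: one at the last short edge that starts
    -- before the midpoint q, one at the first that starts at q or later. The left piece lies in the
    -- lower half, the right piece in the upper half, and the piece between them has no short edge.
    have ht : (e + 1) * (2 * w) + t = w + (w + t') := by simp only [t']; ring
    have hmid : a + 2 ^ (e + 1) = (a + 2 ^ e) + 2 ^ e := by ring
    rw [ht]
    set q := a + 2 ^ e
    -- the part to the right of all short edges that start before `q`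
    have hright : ∀ Y ⊆ X, (∀ x ∈ Y, ∀ y ∈ Y, x < y → G.Adj x y → y ≤ x + ℓ → q ≤ x) →
        ElimDepth G Y (w + t') := by
      intro Y hY hYq
      let E := Y.filter fun u => ∃ v ∈ Y, u < v ∧ G.Adj u v ∧ v ≤ u + ℓ
      by_cases hE : E.Nonempty
      · obtain ⟨v, hv, huv, hadj, hs⟩ := (Finset.mem_filter.1 (E.min'_mem hE)).2
        have huY := (Finset.mem_filter.1 (E.min'_mem hE)).1
        have hqu := hYq _ huY v hv huv hadj hs
        refine elimDepth_of_short hg hd (hY.trans hX) huv hadj hs ?_ ?_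
        · refine (hlong _ ((Finset.filter_subset _ _).trans (hY.trans hX))
            fun x hx y hy hxy hxy' => ?_).mono (by simp only [t']; omega)
          rw [Finset.mem_filter] at hx hy
          by_contra! hle
          have := E.min'_le x (Finset.mem_filter.2 ⟨hx.1, y, hy.1, hxy, hxy', hle⟩)
          omega
        · refine ih q _ ((Finset.filter_subset _ _).trans (hY.trans hX)) fun x hx => ?_
          rw [Finset.mem_filter] at hx
          have := ha x (hY hx.1)
          omega
      · refine (hlong Y (hY.trans hX) fun x hx y hy hxy hxy' => ?_).mono
          (by simp only [t']; omega)
        by_contra! hle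
        exact hE ⟨x, Finset.mem_filter.2 ⟨hx, y, hy, hxy, hxy', hle⟩⟩
    let E := X.filter fun u => u < q ∧ ∃ v ∈ X, u < v ∧ G.Adj u v ∧ v ≤ u + ℓ
    by_cases hE : E.Nonempty
    · obtain ⟨huX, huq, v, hv, huv, hadj, hs⟩ := Finset.mem_filter.1 (E.max'_mem hE)
      refine elimDepth_of_short hg hd hX huv hadj hs ?_ ?_
      · refine (ih a _ ((Finset.filter_subset _ _).trans hX) fun x hx => ?_).mono (by omega)
        rw [Finset.mem_filter] at hx
        have := ha x hx.1
        omega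
      · refine hright _ (Finset.filter_subset _ _) fun x hx y hy hxy hxy' hle => ?_
        rw [Finset.mem_filter] at hx hy
        by_contra! hxq
        have := E.le_max' x (Finset.mem_filter.2 ⟨hx.1, hxq, y, hy.1, hxy, hxy', hle⟩)
        omega
    · refine (hright X subset_rfl fun x hx y hy hxy hxy' hle => ?_).mono (by omega)
      by_contra! hxq
      exact hE ⟨x, Finset.mem_filter.2 ⟨hx, hxq, y, hy, hxy, hxy', hle⟩⟩

end Separator

/-- The elimination depth of a graph of small degrees without widely nested edges. -/
theorem elimDepth_range {G : SimpleGraph ℕ} {m g d c e : ℕ} (hg : NoWideNest G g)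
    (hd : ∀ v, (neighborsBelow G m v).card ≤ d) (hm : m ≤ c * (c * c)) (he : m ≤ 2 ^ e) :
    ElimDepth G (Finset.range m) (e * (2 * (c * c + 2 * g + 1 + 2 * d)) +
      (e * ((c + 2) * (2 * (2 * g + 1 + 2 * d))) + 1)) := by
  -- An edge is short if its length is at most ℓ = c². The sweep then has at most c levels, because
  -- m ≤ c · c².
  refine elimDepth_interval hg hd (fun X hX hl => elimDepth_of_long hg hm hd e X hX hl ?_) e 0 _
    subset_rfl fun x hx => ?_
  · have := Finset.card_le_card hX
    rw [Finset.card_range] at this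
    omega
  · have := Finset.mem_range.1 hx
    omega

/-! ### Low-degree sets in `abba(k)`-free graphs -/

/-- Greedy choice: each vertex of W and each vertex chosen before excludes only itself and at most d
neighbours. -/
theorem exists_indep_subset {G : SimpleGraph ℕ} {m d : ℕ}
    (hd : ∀ v, (neighborsBelow G m v).card ≤ d) {P : Finset ℕ} (hP : P ⊆ Finset.range m) (k : ℕ) :
    ∀ W : Finset ℕ, (W.card + k) * (d + 1) ≤ P.card → ∃ T ⊆ P, T.card = k ∧ Disjoint T W ∧
      (∀ a ∈ T, ∀ b ∈ T, ¬ G.Adj a b) ∧ ∀ a ∈ T, ∀ b ∈ W, ¬ G.Adj b a := by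
  classical
  induction k with
  | zero => exact fun W _ => ⟨∅, by simp⟩
  | succ k ih =>
    intro W hW
    obtain ⟨a, haP, ha⟩ : ∃ a ∈ P, a ∉ W.biUnion fun b => insert b (neighborsBelow G m b) := by
      refine Finset.exists_mem_notMem_of_card_lt_card ?_
      refine (Finset.card_biUnion_le_card_mul W _ (d + 1) fun b _ =>
        (Finset.card_insert_le _ _).trans (Nat.succ_le_succ (hd b))).trans_lt ?_
      refine lt_of_lt_of_le ?_ hW
      exact Nat.mul_lt_mul_of_pos_right (by omega) (by omega)
    simp only [Finset.mem_biUnion, Finset.mem_insert, neighborsBelow, Finset.mem_filter,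
      not_exists, not_and, not_or] at ha
    have haW : a ∉ W := fun h => (ha a h).1 rfl
    obtain ⟨T, hTP, hTk, hTW, hT1, hT2⟩ := ih (insert a W) (by
      rw [Finset.card_insert_of_notMem haW]
      exact le_trans (le_of_eq (by ring)) hW)
    rw [Finset.disjoint_insert_right] at hTW
    refine ⟨insert a T, Finset.insert_subset haP hTP, ?_, ?_, ?_, ?_⟩
    · rw [Finset.card_insert_of_notMem hTW.1, hTk]
    · exact Finset.disjoint_insert_left.2 ⟨haW, hTW.2⟩
    · intro x hx y hy
      rcases Finset.mem_insert.1 hx with rfl | hx <;> rcases Finset.mem_insert.1 hy with rfl | hy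
      · exact G.irrefl
      · exact hT2 y hy x (Finset.mem_insert_self _ _)
      · exact fun h => hT2 x ‹x ∈ T› _ (Finset.mem_insert_self _ _) h.symm
      · exact hT1 x hx y hy
    · intro x hx b hb
      rcases Finset.mem_insert.1 hx with rfl | hx
      · exact (ha b hb).2 (hP haP)
      · exact hT2 x hx b (Finset.mem_insert_of_mem hb)

/-- The vertices of a copy of `abba(k)` in natural order. -/
def abbaPlacement {k : ℕ} (u x y v : ℕ) (s t : Fin k → ℕ) (i : Fin (2 * k + 4)) : ℕ :=
  if i.val = 0 then u
  else if h : i.val - 1 < k then s ⟨i.val - 1, h⟩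
  else if i.val = k + 1 then x
  else if i.val = k + 2 then y
  else if h : i.val - (k + 3) < k then t ⟨i.val - (k + 3), h⟩
  else v

theorem abbaPlacement_strictMono {k u x y v : ℕ} {s t : Fin k → ℕ} (hs : StrictMono s)
    (ht : StrictMono t) (h1 : ∀ i, u < s i ∧ s i < x) (h2 : ∀ i, y < t i ∧ t i < v)
    (hux : u < x) (hxy : x < y) (hyv : y < v) : StrictMono (abbaPlacement u x y v s t) := by
  intro i j hij
  have hij' : i.val < j.val := hij
  have hi := i.isLt
  have hj := j.isLt
  have hs' : ∀ (a b : ℕ) (ha : a < k) (hb : b < k), a < b → s ⟨a, ha⟩ < s ⟨b, hb⟩ :=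
    fun a b ha hb h => hs h
  have ht' : ∀ (a b : ℕ) (ha : a < k) (hb : b < k), a < b → t ⟨a, ha⟩ < t ⟨b, hb⟩ :=
    fun a b ha hb h => ht h
  have h1' : ∀ (a : ℕ) (ha : a < k), u < s ⟨a, ha⟩ ∧ s ⟨a, ha⟩ < x := fun a ha => h1 _
  have h2' : ∀ (a : ℕ) (ha : a < k), y < t ⟨a, ha⟩ ∧ t ⟨a, ha⟩ < v := fun a ha => h2 _
  unfold abbaPlacement
  split_ifs <;> first
    | omega
    | exact hs' _ _ _ _ (by omega)
    | exact ht' _ _ _ _ (by omega)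
    | (have := h1' _ ‹i.val - 1 < k›; have := h2' _ ‹j.val - (k + 3) < k›; omega)
    | (have := h1' _ ‹i.val - 1 < k›; omega)
    | (have := h1' _ ‹j.val - 1 < k›; omega)
    | (have := h2' _ ‹i.val - (k + 3) < k›; omega)
    | (have := h2' _ ‹j.val - (k + 3) < k›; omega)

/-- The graph induced on `X`, relabelled by positions. -/
def relabel {n : ℕ} (G : SimpleGraph (Fin n)) (X : Finset (Fin n)) : SimpleGraph ℕ where
  Adj a b := ∃ (ha : a < X.card) (hb : b < X.card),
    G.Adj (X.orderEmbOfFin rfl ⟨a, ha⟩) (X.orderEmbOfFin rfl ⟨b, hb⟩)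
  symm := ⟨fun _ _ ⟨ha, hb, h⟩ => ⟨hb, ha, h.symm⟩⟩
  loopless := ⟨fun _ ⟨_, _, h⟩ => G.irrefl h⟩

/-- Otherwise the two edges extend to an induced abba(k). Positions are ranks within X, so a gap
really contains that many vertices of X. First k vertices are chosen in the left gap, away from the
four ends, then k in the right gap, away from the four ends and from the first k. This second choice
is the reason for 2k + 4 = (4 + k) + k. -/
theorem noWideNest_relabel {n k d : ℕ} {G : SimpleGraph (Fin n)}
    (hG : OrderedFree (abbaGraph k) G) (X : Finset (Fin n))
    (hd : ∀ v, (neighborsBelow (relabel G X) X.card v).card ≤ d) :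
    NoWideNest (relabel G X) ((2 * k + 4) * (d + 1)) := by
  classical
  intro u x y v hux hxy hyv huv hxy'
  by_contra! hno
  obtain ⟨n1, n2, n3, n4⟩ := hno
  have hvm : v < X.card := huv.2.1
  set H := relabel G X with hH
  have hW : ({u, x, y, v} : Finset ℕ).card ≤ 4 := Finset.card_le_four
  obtain ⟨S, hSP, hSk, -, hS1, hS2⟩ := exists_indep_subset hd (P := Finset.Ioo u x)
    (fun z hz => by rw [Finset.mem_Ioo] at hz; rw [Finset.mem_range]; omega) k {u, x, y, v} (by
      rw [Nat.card_Ioo]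
      have := Nat.mul_le_mul_right (d + 1)
        (show ({u, x, y, v} : Finset ℕ).card + k ≤ 2 * k + 4 by omega)
      omega)
  obtain ⟨T, hTP, hTk, -, hT1, hT2⟩ := exists_indep_subset hd (P := Finset.Ioo y v)
    (fun z hz => by rw [Finset.mem_Ioo] at hz; rw [Finset.mem_range]; omega) k
    ({u, x, y, v} ∪ S) (by
      rw [Nat.card_Ioo]
      have := Finset.card_union_le {u, x, y, v} S
      have := Nat.mul_le_mul_right (d + 1)
        (show (({u, x, y, v} : Finset ℕ) ∪ S).card + k ≤ 2 * k + 4 by omega)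
      omega)
  have hs : ∀ i, S.orderEmbOfFin hSk i ∈ S := fun i => S.orderEmbOfFin_mem hSk i
  have ht : ∀ i, T.orderEmbOfFin hTk i ∈ T := fun i => T.orderEmbOfFin_mem hTk i
  have hmono := abbaPlacement_strictMono (S.orderEmbOfFin hSk).strictMono
    (T.orderEmbOfFin hTk).strictMono (fun i => Finset.mem_Ioo.1 (hSP (hs i)))
    (fun i => Finset.mem_Ioo.1 (hTP (ht i))) (by omega) hxy (by omega)
  set p := abbaPlacement u x y v (S.orderEmbOfFin hSk) (T.orderEmbOfFin hTk) with hp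
  have hpm : ∀ i, p i < X.card := by
    intro i
    have h1 : p i ≤ p (Fin.last (2 * k + 3)) := hmono.monotone (Fin.le_last i)
    have h2 : p (Fin.last (2 * k + 3)) = v := by
      simp only [hp, abbaPlacement, Fin.val_last]
      rw [if_neg (by omega), dif_neg (by omega), if_neg (by omega), if_neg (by omega),
        dif_neg (by omega)]
    omega
  have hadj : ∀ i j, i < j → (H.Adj (p i) (p j) ↔
      (i.val = 0 ∧ j.val = 2 * k + 3) ∨ (i.val = k + 1 ∧ j.val = k + 2)) := by
    intro i j hij
    have hij' : i.val < j.val := hij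
    have hi := i.isLt
    have hj := j.isLt
    have m1 : ∀ a (ha : a < k), ¬ H.Adj u (S.orderEmbOfFin hSk ⟨a, ha⟩) := fun a ha =>
      hS2 _ (hs _) u (by simp)
    have m2 : ∀ a (ha : a < k), ¬ H.Adj (S.orderEmbOfFin hSk ⟨a, ha⟩) x := fun a ha h =>
      hS2 _ (hs _) x (by simp) h.symm
    have m3 : ∀ a (ha : a < k), ¬ H.Adj (S.orderEmbOfFin hSk ⟨a, ha⟩) y := fun a ha h =>
      hS2 _ (hs _) y (by simp) h.symm
    have m4 : ∀ a (ha : a < k), ¬ H.Adj (S.orderEmbOfFin hSk ⟨a, ha⟩) v := fun a ha h =>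
      hS2 _ (hs _) v (by simp) h.symm
    have m5 : ∀ a (ha : a < k) b (hb : b < k),
      ¬ H.Adj (S.orderEmbOfFin hSk ⟨a, ha⟩) (S.orderEmbOfFin hSk ⟨b, hb⟩) := fun a ha b hb =>
      hS1 _ (hs _) _ (hs _)
    have m6 : ∀ a (ha : a < k) b (hb : b < k),
      ¬ H.Adj (S.orderEmbOfFin hSk ⟨a, ha⟩) (T.orderEmbOfFin hTk ⟨b, hb⟩) := fun a ha b hb =>
      hT2 _ (ht _) _ (Finset.mem_union_right _ (hs _))
    have m7 : ∀ a (ha : a < k) b (hb : b < k),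
      ¬ H.Adj (T.orderEmbOfFin hTk ⟨a, ha⟩) (T.orderEmbOfFin hTk ⟨b, hb⟩) := fun a ha b hb =>
      hT1 _ (ht _) _ (ht _)
    have m8 : ∀ a (ha : a < k), ¬ H.Adj u (T.orderEmbOfFin hTk ⟨a, ha⟩) := fun a ha =>
      hT2 _ (ht _) u (by simp)
    have m9 : ∀ a (ha : a < k), ¬ H.Adj x (T.orderEmbOfFin hTk ⟨a, ha⟩) := fun a ha =>
      hT2 _ (ht _) x (by simp)
    have m10 : ∀ a (ha : a < k), ¬ H.Adj y (T.orderEmbOfFin hTk ⟨a, ha⟩) := fun a ha =>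
      hT2 _ (ht _) y (by simp)
    have m11 : ∀ a (ha : a < k), ¬ H.Adj (T.orderEmbOfFin hTk ⟨a, ha⟩) v := fun a ha h =>
      hT2 _ (ht _) v (by simp) h.symm
    have e1 : ¬ H.Adj u x := fun h => n1 h.symm
    have e2 : ¬ H.Adj u y := fun h => n2 h.symm
    simp only [hp, abbaPlacement]
    split_ifs <;> first
      | omega
      | (refine iff_of_true ?_ ?_ <;> first | assumption | omega)
      | (refine iff_of_false ?_ ?_
         · first
            | assumption
            | apply m1
            | apply m2
            | apply m3
            | apply m4
            | apply m5
            | apply m6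
            | apply m7
            | apply m8
            | apply m9
            | apply m10
            | apply m11
         · omega)
  refine hG ⟨OrderEmbedding.ofStrictMono (fun i => X.orderEmbOfFin rfl ⟨p i, hpm i⟩)
    fun i j hij => (X.orderEmbOfFin rfl).strictMono (hmono hij), fun i j => ?_⟩
  have key : G.Adj (X.orderEmbOfFin rfl ⟨p i, hpm i⟩) (X.orderEmbOfFin rfl ⟨p j, hpm j⟩) ↔
      H.Adj (p i) (p j) := ⟨fun h => ⟨hpm i, hpm j, h⟩, fun ⟨_, _, h⟩ => h⟩
  change G.Adj (X.orderEmbOfFin rfl ⟨p i, hpm i⟩) (X.orderEmbOfFin rfl ⟨p j, hpm j⟩) ↔ _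
  rw [key, abbaGraph, SimpleGraph.fromRel_adj]
  rcases lt_trichotomy i j with h | h | h
  · have h' : i.val < j.val := h
    rw [hadj i j h]
    constructor
    · exact fun h1 => ⟨h.ne, Or.inl h1⟩
    · rintro ⟨-, h1 | h1⟩
      · exact h1
      · omega
  · subst h; simp
  · have h' : j.val < i.val := h
    rw [H.adj_comm, hadj j i h]
    constructor
    · exact fun h1 => ⟨h.ne', Or.inr h1⟩
    · rintro ⟨-, h1 | h1⟩
      · omega
      · exact h1

/-- In an `abba(k)`-free graph, sets of small degree have small elimination depth. -/
theorem elimDepth_of_abbaFree {n k j : ℕ} {G : SimpleGraph (Fin n)}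
    (hG : OrderedFree (abbaGraph k) G) (hn : n ≤ 8 ^ j) {X : Finset (Fin n)}
    (hX : ∀ v ∈ X, ∀ N ⊆ X, (∀ z ∈ N, G.Adj v z) → N.card < 2 ^ j) :
    ElimDepth G X ((200 * k + 500) * (4 ^ j * (j + 1))) := by
  classical
  set c := 2 ^ j with hc
  have hc1 : 1 ≤ c := Nat.one_le_two_pow
  have h4 : 4 ^ j = c * c := by rw [hc, ← mul_pow]; norm_num
  have h8 : 8 ^ j = c * (c * c) := by rw [hc, ← mul_pow, ← mul_pow]; norm_num
  have hXn : X.card ≤ n := by simpa using X.card_le_univ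
  have hd : ∀ v, (neighborsBelow (relabel G X) X.card v).card ≤ c := by
    intro v
    by_cases hv : v < X.card
    · have hsub : ∀ z ∈ neighborsBelow (relabel G X) X.card v, z < X.card := fun z hz => by
        simpa using (Finset.mem_filter.1 hz).1
      let N := (neighborsBelow (relabel G X) X.card v).attach.map
        ⟨fun z => X.orderEmbOfFin rfl ⟨z.1, hsub z.1 z.2⟩, fun a b h => by
          have := (X.orderEmbOfFin rfl).injective h
          exact Subtype.ext (by simpa using this)⟩
      have hN := hX (X.orderEmbOfFin rfl ⟨v, hv⟩) (X.orderEmbOfFin_mem rfl _) N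
        (fun z hz => by
          obtain ⟨a, -, rfl⟩ := Finset.mem_map.1 hz
          exact X.orderEmbOfFin_mem rfl _)
        (fun z hz => by
          obtain ⟨a, -, rfl⟩ := Finset.mem_map.1 hz
          obtain ⟨_, _, h⟩ := (Finset.mem_filter.1 a.2).2
          exact h)
      rw [Finset.card_map, Finset.card_attach] at hN
      exact hN.le
    · have : neighborsBelow (relabel G X) X.card v = ∅ := by
        refine Finset.eq_empty_of_forall_notMem fun z hz => hv ?_
        exact (Finset.mem_filter.1 hz).2.1
      simp [this]
  -- The degree bound and the number of levels are both c = 2^j, and |X| ≤ 8^j = c³ = 2^(3j).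
  have h := elimDepth_range (noWideNest_relabel hG X hd) hd (c := c) (e := 3 * j)
    (by omega) (by rw [pow_mul]; norm_num; omega)
  have hb : 3 * j * (2 * (c * c + 2 * ((2 * k + 4) * (c + 1)) + 1 + 2 * c)) +
      (3 * j * ((c + 2) * (2 * (2 * ((2 * k + 4) * (c + 1)) + 1 + 2 * c))) + 1) ≤
      (200 * k + 500) * (4 ^ j * (j + 1)) := by
    rw [h4]
    obtain ⟨b, hb⟩ : ∃ b, c = b + 1 := ⟨c - 1, by omega⟩
    rw [hb]
    have : 2 * (2 * ((2 * k + 4) * (b + 1 + 1)) + 1 + 2 * (b + 1)) ≤ (16 * k + 38) * (b + 1) := by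
      nlinarith [Nat.zero_le (k * b)]
    have h2 : (b + 1 + 2) * (2 * (2 * ((2 * k + 4) * (b + 1 + 1)) + 1 + 2 * (b + 1))) ≤
        (3 * (b + 1)) * ((16 * k + 38) * (b + 1)) := Nat.mul_le_mul (by omega) this
    have h3 : 2 * ((b + 1) * (b + 1) + 2 * ((2 * k + 4) * (b + 1 + 1)) + 1 + 2 * (b + 1)) ≤
        (16 * k + 40) * ((b + 1) * (b + 1)) := by
      nlinarith [Nat.zero_le (k * b), Nat.zero_le (k * (b * b)), Nat.zero_le (b * b)]
    have h5 := Nat.mul_le_mul_left (3 * j) h2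
    have h6 := Nat.mul_le_mul_left (3 * j) h3
    refine (Nat.add_le_add h6 (Nat.add_le_add_right h5 1)).trans ?_
    have h7 : 1 ≤ (b + 1) * (b + 1) := Nat.mul_pos (by omega) (by omega)
    have h9 : 0 ≤ k * j * ((b + 1) * (b + 1)) := Nat.zero_le _
    have h10 : 0 ≤ j * ((b + 1) * (b + 1)) := Nat.zero_le _
    have h11 : 3 * j * (3 * (b + 1) * ((16 * k + 38) * (b + 1))) =
      3 * j * (3 * (16 * k + 38)) * ((b + 1) * (b + 1)) := by ring
    rw [h11]
    generalize (b + 1) * (b + 1) = q at *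
    nlinarith [Nat.zero_le (k * q)]
  -- The rank within X; the value 0 outside of X plays no role.
  let φ : Fin n → ℕ := fun x => if h : x ∈ X then ((X.orderIsoOfFin rfl).symm ⟨x, h⟩).val else 0
  have hφ : ∀ x ∈ X, ∃ h : φ x < X.card, X.orderEmbOfFin rfl ⟨φ x, h⟩ = x := by
    intro x hx
    have e : φ x = ((X.orderIsoOfFin rfl).symm ⟨x, hx⟩).val := dif_pos hx
    refine ⟨e ▸ Fin.isLt _, ?_⟩
    simp only [e, Fin.eta, ← Finset.coe_orderIsoOfFin_apply, OrderIso.apply_symm_apply]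
  refine (h.mono hb).comap φ X ?_ ?_ ?_
  · intro a ha b hb hab
    obtain ⟨h1, e1⟩ := hφ a ha
    obtain ⟨h2, e2⟩ := hφ b hb
    exact ⟨h1, h2, by rwa [e1, e2]⟩
  · intro a ha b hb hab
    obtain ⟨h1, e1⟩ := hφ a ha
    obtain ⟨h2, e2⟩ := hφ b hb
    rw [← e1, ← e2]
    simp only [hab]
  · intro x hx
    exact Finset.mem_range.2 (hφ x hx).1

/-! ### The algorithm on the random access machine -/

namespace RAM

set_option linter.unusedSimpArgs false

/-! ### Reasoning about programs -/

/-- Started in `s`, the program `p` halts within `T` steps in a state satisfying `Q`. -/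
def RunsTo (p : Program) (s : State) (T : ℕ) (Q : State → Prop) : Prop :=
  ∃ s' t, Exec p s s' t ∧ t ≤ T ∧ Q s'

theorem RunsTo.mono {p : Program} {s : State} {T T' : ℕ} {Q Q' : State → Prop}
    (h : RunsTo p s T Q) (hT : T ≤ T') (hQ : ∀ s', Q s' → Q' s') : RunsTo p s T' Q' := by
  obtain ⟨s', t, h1, h2, h3⟩ := h
  exact ⟨s', t, h1, h2.trans hT, hQ _ h3⟩

theorem RunsTo.instr {i : Instr} {s : State} {T : ℕ} {Q : State → Prop} (hT : 1 ≤ T)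
    (h : Q (i.run s)) : RunsTo (.instr i) s T Q :=
  ⟨_, _, .instr i s, hT, h⟩

theorem RunsTo.seq {p q : Program} {s : State} {T T1 : ℕ} {Q R : State → Prop}
    (h1 : RunsTo p s T1 R) (hT : T1 ≤ T) (h2 : ∀ s', R s' → RunsTo q s' (T - T1) Q) :
    RunsTo (.seq p q) s T Q := by
  obtain ⟨s', t, e1, h3, h4⟩ := h1
  obtain ⟨s'', t', e2, h5, h6⟩ := h2 s' h4
  exact ⟨s'', _, .seq e1 e2, by omega, h6⟩

/-- A list of elementary instructions followed by a program. -/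
def block (l : List Instr) (p : Program) : Program := l.foldr (fun i q => .seq (.instr i) q) p

theorem RunsTo.block {l : List Instr} {p : Program} {s : State} {T : ℕ} {Q : State → Prop}
    (hT : l.length ≤ T) (h : RunsTo p (l.foldl (fun s i => i.run s) s) (T - l.length) Q) :
    RunsTo (block l p) s T Q := by
  induction l generalizing s T with
  | nil => simpa [RAM.block] using h
  | cons i l ih =>
    simp only [List.length_cons] at hT
    refine RunsTo.seq (T1 := 1) (R := fun s' => s' = i.run s) (RunsTo.instr le_rfl rfl) (by omega) ?_
    rintro s' rfl
    refine ih (by omega) ?_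
    rwa [Nat.sub_sub, Nat.add_comm 1]

theorem RunsTo.cond {b : Test} {p q : Program} {s : State} {T : ℕ} {Q : State → Prop}
    (hT : 1 ≤ T) (h1 : b.Holds s → RunsTo p s (T - 1) Q) (h2 : ¬ b.Holds s → RunsTo q s (T - 1) Q) :
    RunsTo (.cond b p q) s T Q := by
  by_cases hb : b.Holds s
  · obtain ⟨s', t, e, h3, h4⟩ := h1 hb
    exact ⟨s', _, .cond_true hb e, by omega, h4⟩
  · obtain ⟨s', t, e, h3, h4⟩ := h2 hb
    exact ⟨s', _, .cond_false hb e, by omega, h4⟩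

/-- The natural number in the invariant is a variant: it decreases in every round, so its initial
value bounds the number of rounds. -/
theorem RunsTo.loop {b : Test} {p : Program} {T : ℕ} (Inv : ℕ → State → Prop)
    (hs : ∀ k s, Inv k s → b.Holds s → RunsTo p s T fun s' => ∃ k' < k, Inv k' s') {k : ℕ}
    {s : State} (h0 : Inv k s) :
    RunsTo (.loop b p) s (k * (T + 1) + 1) fun s' => (∃ k, Inv k s') ∧ ¬ b.Holds s' := by
  induction k using Nat.strong_induction_on generalizing s with
  | _ k ih =>
    by_cases hb : b.Holds s
    · obtain ⟨s', t, e, h3, k', hk', h4⟩ := hs k s h0 hb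
      obtain ⟨s'', t', e', h6, h7⟩ := ih k' hk' h4
      refine ⟨s'', _, .loop_true hb e e', ?_, h7⟩
      have := Nat.mul_le_mul_right (T + 1) (Nat.succ_le_of_lt hk')
      rw [Nat.succ_mul] at this
      omega
    · exact ⟨s, _, .loop_false hb, by omega, ⟨k, h0⟩, hb⟩

/-- The loop over `reg i = 0, …, n - 1`, where register `0` holds `n` and register `1` holds `1`. -/
def forLoop (i : ℕ) (p : Program) : Program :=
  .seq (.instr (.const i 0)) (.loop (.lt i 0) (.seq p (.instr (.add i i 1))))

theorem RunsTo.forLoop {i n : ℕ} {p : Program} {s : State} {T : ℕ} {Q : State → Prop} {T' : ℕ}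
    (Inv : ℕ → State → Prop) (hI : ∀ v s, Inv v s → s.reg i = v ∧ s.reg 0 = n)
    (h0 : Inv 0 ((Instr.const i 0).run s))
    (hs : ∀ v s, v < n → Inv v s → RunsTo p s T fun s' => Inv (v + 1) ((Instr.add i i 1).run s'))
    (hQ : ∀ s, Inv n s → Q s) (hT : n * (T + 2) + 2 ≤ T') : RunsTo (forLoop i p) s T' Q := by
  refine RunsTo.seq (T1 := 1) (R := fun s' => s' = (Instr.const i 0).run s)
    (RunsTo.instr le_rfl rfl) (by omega) ?_
  rintro s' rfl
  have h := RunsTo.loop (b := .lt i 0) (p := .seq p (.instr (.add i i 1))) (T := T + 1)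
    (fun k s => ∃ v ≤ n, k = n - v ∧ Inv v s) ?_ (s := (Instr.const i 0).run s)
    ⟨0, by omega, rfl, h0⟩
  · refine h.mono ?_ ?_
    · have : (n - 0) * (T + 1 + 1) = n * (T + 2) := by simp
      omega
    · rintro s ⟨⟨k, v, hv, -, hiv⟩, hb⟩
      obtain ⟨e1, e2⟩ := hI _ _ hiv
      simp only [Test.Holds, e1, e2] at hb
      obtain rfl : v = n := by omega
      exact hQ _ hiv
  · rintro k s ⟨v, hv, rfl, hiv⟩ hb
    obtain ⟨e1, e2⟩ := hI _ _ hiv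
    simp only [Test.Holds, e1, e2] at hb
    refine RunsTo.seq (hs v s hb hiv) (by omega) fun s' hs' => RunsTo.instr (by omega) ?_
    exact ⟨n - (v + 1), by omega, v + 1, hb, rfl, hs'⟩

/-! ### Sets of vertices in memory -/

/-- The cells `a, …, a + n - 1` hold the characteristic function of `S`. -/
def Holds {n : ℕ} (mem : ℕ → ℕ) (a : ℕ) (S : Finset (Fin n)) : Prop :=
  ∀ v : Fin n, mem (a + v) = if v ∈ S then 1 else 0

theorem Holds.congr {n : ℕ} {mem mem' : ℕ → ℕ} {a : ℕ} {S : Finset (Fin n)}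
    (h : Holds mem a S) (hm : ∀ x, a ≤ x → x < a + n → mem' x = mem x) : Holds mem' a S :=
  fun v => by rw [hm _ (by omega) (by omega), h v]

/-- `mem[reg b + z] := 0` if `mem[reg c + z] = 1`, and `mem[reg a + z]` otherwise, for `z < n`. -/
def diffProg (a b c : ℕ) : Program :=
  forLoop 23 <| block [.add 24 c 23, .load 24 24, .add 25 b 23] <|
    .cond (.eq 24 1) (block [.const 24 0] (.instr (.store 25 24)))
      (block [.add 24 a 23, .load 24 24] (.instr (.store 25 24)))

/-- Difference is the basic operation on sets: A \ ∅ copies, ∅ \ ∅ clears, and unions arise from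
complements. The target may coincide with A, because a cell is read before it is overwritten, but it
must not meet B. -/
theorem runsTo_diffProg {n a b c : ℕ} {s : State} {A B : Finset (Fin n)} (ha : a < 20)
    (hb : b < 20) (hc : c < 20) (h0 : s.reg 0 = n) (h1 : s.reg 1 = 1)
    (hA : Holds s.mem (s.reg a) A) (hB : Holds s.mem (s.reg c) B)
    (hab : s.reg a = s.reg b ∨ s.reg a + n ≤ s.reg b ∨ s.reg b + n ≤ s.reg a)
    (hcb : s.reg c + n ≤ s.reg b ∨ s.reg b + n ≤ s.reg c) :
    RunsTo (diffProg a b c) s (9 * n + 2) fun s' => Holds s'.mem (s.reg b) (A \ B) ∧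
      (∀ x, x < s.reg b ∨ s.reg b + n ≤ x → s'.mem x = s.mem x) ∧ s'.wt = s.wt ∧
      ∀ r < 20, s'.reg r = s.reg r := by
  refine RunsTo.forLoop (n := n) (T := 7) (fun v t => t.reg 23 = v ∧ (∀ r < 20, t.reg r = s.reg r) ∧
    t.wt = s.wt ∧ (∀ z : Fin n, z.val < v → t.mem (s.reg b + z) = if z ∈ A \ B then 1 else 0) ∧
    ∀ x, x < s.reg b ∨ s.reg b + v ≤ x → t.mem x = s.mem x) ?_ ?_ ?_ ?_ (by omega)
  · rintro v t ⟨h2, h3, -⟩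
    exact ⟨h2, by rw [h3 0 (by omega), h0]⟩
  · refine ⟨by simp [Instr.run], fun r hr => ?_, rfl, by simp, fun x _ => rfl⟩
    simp [Instr.run, show r ≠ 23 by omega]
  · rintro v t hv ⟨h2, h3, h4, h5, h6⟩
    have e1 : t.mem (s.reg c + v) = if (⟨v, hv⟩ : Fin n) ∈ B then 1 else 0 := by
      rw [h6 _ (by omega)]; exact hB ⟨v, hv⟩
    have e2 : t.mem (s.reg a + v) = if (⟨v, hv⟩ : Fin n) ∈ A then 1 else 0 := by
      rw [h6 _ (by omega)]; exact hA ⟨v, hv⟩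
    have hfin : ∀ y : ℕ, (y = if (⟨v, hv⟩ : Fin n) ∈ A \ B then 1 else 0) → ∀ t' : State,
        t'.reg 23 = v → (∀ r < 20, t'.reg r = s.reg r) → t'.wt = s.wt →
        t'.mem = Function.update t.mem (s.reg b + v) y →
        (fun v t => t.reg 23 = v ∧ (∀ r < 20, t.reg r = s.reg r) ∧
    t.wt = s.wt ∧ (∀ z : Fin n, z.val < v → t.mem (s.reg b + z) = if z ∈ A \ B then 1 else 0) ∧
    ∀ x, x < s.reg b ∨ s.reg b + v ≤ x → t.mem x = s.mem x) (v + 1)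
          ((Instr.add 23 23 1).run t') := by
      intro y hy t' k1 k2 k3 k4
      refine ⟨by simp [Instr.run, k1, k2, h1], fun r hr => ?_, k3, fun z hz => ?_, fun x hx => ?_⟩
      · simp [Instr.run, show r ≠ 23 by omega, k2 r hr]
      · simp only [Instr.run, k4]
        rcases Nat.lt_succ_iff_lt_or_eq.1 hz with hz | hz
        · rw [Function.update_of_ne (by omega), h5 z hz]
        · obtain rfl : z = ⟨v, hv⟩ := Fin.ext hz
          rw [Function.update_self, hy]
      · simp only [Instr.run, k4]
        rw [Function.update_of_ne (by omega), h6 x (by omega)]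
    refine RunsTo.block (by simp) (RunsTo.cond (by simp) ?_ ?_)
    · intro hcond
      simp only [List.foldl_cons, List.foldl_nil, Instr.run, Test.Holds] at hcond
      simp [Function.update_apply, h2, h3, hc, e1, h1, show c ≠ 23 by omega] at hcond
      refine RunsTo.block (by simp) (RunsTo.instr (by simp) (hfin 0 ?_ _ ?_ ?_ ?_ ?_))
      · simp [hcond]
      · simp [Instr.run, Function.update_apply, h2]
      · intro r hr
        simp [Instr.run, Function.update_apply, h3 r hr, show r ≠ 24 by omega,
          show r ≠ 25 by omega]
      · simpa [Instr.run] using h4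
      · simp [Instr.run, Function.update_apply, h2, h3, hb, show b ≠ 24 by omega]
    · intro hcond
      simp only [List.foldl_cons, List.foldl_nil, Instr.run, Test.Holds] at hcond
      simp [Function.update_apply, h2, h3, hc, e1, h1, show c ≠ 23 by omega] at hcond
      refine RunsTo.block (by simp) (RunsTo.instr (by simp) (hfin _ rfl _ ?_ ?_ ?_ ?_))
      · simp [Instr.run, Function.update_apply, h2]
      · intro r hr
        simp [Instr.run, Function.update_apply, h3 r hr, show r ≠ 24 by omega,
          show r ≠ 25 by omega]
      · simpa [Instr.run] using h4
      · simp [Instr.run, Function.update_apply, h2, h3, hb, ha, show b ≠ 24 by omega,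
          show a ≠ 24 by omega, show a ≠ 25 by omega, e2, hcond]
  · rintro t ⟨h2, h3, h4, h5, h6⟩
    exact ⟨fun v => h5 v v.isLt, h6, h4, h3⟩

/-- Counts the elements of the set at `reg a` in register `20` and puts one of them (or `n`) into
register `21`. -/
def scanProg (a : ℕ) : Program :=
  block [.const 20 0, .add 21 0 20] <| forLoop 22 <| block [.add 23 a 22, .load 23 23] <|
    .cond (.eq 23 1) (block [.add 20 20 1, .const 24 0] (.instr (.add 21 22 24)))
      (.instr (.const 24 0))

theorem runsTo_scanProg {n a : ℕ} {s : State} {A : Finset (Fin n)} (ha : a < 20)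
    (h0 : s.reg 0 = n) (h1 : s.reg 1 = 1) (hA : Holds s.mem (s.reg a) A) :
    RunsTo (scanProg a) s (8 * n + 4) fun s' => s'.reg 20 = A.card ∧
      ((A = ∅ ∧ s'.reg 21 = n) ∨ ∃ u ∈ A, s'.reg 21 = u.val) ∧
      s'.mem = s.mem ∧ s'.wt = s.wt ∧ ∀ r < 20, s'.reg r = s.reg r := by
  refine RunsTo.block (by simp) ?_
  refine RunsTo.forLoop (n := n) (T := 6) (fun v t => t.reg 22 = v ∧ (∀ r < 20, t.reg r = s.reg r) ∧
    t.wt = s.wt ∧ t.mem = s.mem ∧ t.reg 20 = (A.filter fun z => z.val < v).card ∧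
    ((A.filter (fun z => z.val < v) = ∅ ∧ t.reg 21 = n) ∨ ∃ u ∈ A, t.reg 21 = u.val))
    ?_ ?_ ?_ ?_ (by simp; omega)
  · rintro v t ⟨h2, h3, -⟩
    exact ⟨h2, by rw [h3 0 (by omega), h0]⟩
  · refine ⟨by simp [Instr.run], fun r hr => ?_, rfl, rfl, by simp [Instr.run, Function.update_apply],
      Or.inl ⟨by simp, by simp [Instr.run, h0, Function.update_apply]⟩⟩
    simp [Instr.run, Function.update_apply, show r ≠ 22 by omega, show r ≠ 21 by omega,
      show r ≠ 20 by omega]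
  · rintro v t hv ⟨h2, h3, h4, h5, h6, h7⟩
    have e1 := hA ⟨v, hv⟩
    simp only at e1
    refine RunsTo.block (by simp) (RunsTo.cond (by simp) ?_ ?_)
    · intro hcond
      simp [Instr.run, Test.Holds, Function.update_apply, h2, h3, h5, ha, e1, h1,
        show a ≠ 22 by omega] at hcond
      refine RunsTo.block (by simp) (RunsTo.instr (by simp) ⟨?_, fun r hr => ?_, ?_, ?_, ?_, ?_⟩)
      · simp [Instr.run, Function.update_apply, h2, h3, h1]
      · simp [Instr.run, Function.update_apply, h3 r hr, show r ≠ 20 by omega,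
          show r ≠ 21 by omega, show r ≠ 22 by omega, show r ≠ 23 by omega, show r ≠ 24 by omega]
      · simpa [Instr.run] using h4
      · simpa [Instr.run] using h5
      · have : (A.filter fun z => z.val < v + 1) =
            insert ⟨v, hv⟩ (A.filter fun z => z.val < v) := by
          ext z
          simp only [Finset.mem_filter, Finset.mem_insert, Fin.ext_iff]
          constructor
          · rintro ⟨k1, k2⟩
            by_cases k : z.val = v
            · exact Or.inl k
            · exact Or.inr ⟨k1, by omega⟩
          · rintro (k | ⟨k1, k2⟩)
            · rw [show z = ⟨v, hv⟩ from Fin.ext k]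
              exact ⟨hcond, by simp⟩
            · exact ⟨k1, by omega⟩
        rw [this, Finset.card_insert_of_notMem (by simp)]
        simp [Instr.run, Function.update_apply, h6, h3, h1]
      · right
        exact ⟨⟨v, hv⟩, hcond, by simp [Instr.run, Function.update_apply, h2]⟩
    · intro hcond
      simp [Instr.run, Test.Holds, Function.update_apply, h2, h3, h5, ha, e1, h1,
        show a ≠ 22 by omega] at hcond
      have : (A.filter fun z => z.val < v + 1) = A.filter fun z => z.val < v := by
        ext z
        simp only [Finset.mem_filter]
        refine and_congr_right fun hz => ⟨fun h => ?_, fun h => by omega⟩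
        have : z.val ≠ v := by
          rintro h'
          rw [show z = ⟨v, hv⟩ from Fin.ext h'] at hz
          exact hcond hz
        omega
      refine RunsTo.instr (by simp) ⟨?_, fun r hr => ?_, ?_, ?_, ?_, ?_⟩
      · simp [Instr.run, Function.update_apply, h2, h3, h1]
      · simp [Instr.run, Function.update_apply, h3 r hr, show r ≠ 22 by omega,
          show r ≠ 23 by omega, show r ≠ 24 by omega]
      · simpa [Instr.run] using h4
      · simpa [Instr.run] using h5
      · rw [this]; simp [Instr.run, h6]
      · rw [this]
        simpa [Instr.run, Function.update_apply] using h7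
  · rintro t ⟨h2, h3, h4, h5, h6, h7⟩
    have : (A.filter fun z => z.val < n) = A := Finset.filter_true_of_mem fun z _ => z.isLt
    rw [this] at h6 h7
    exact ⟨h6, h7, h5, h4, h3⟩

/-! ### The queue of subproblems -/

/-- A subproblem: solve the problem on `X` with budget `r`; its solution will be passed on to the
subproblem with index `par`, in the way that is described by `tag`. -/
structure Node (n : ℕ) where
  X : Finset (Fin n)
  r : ℕ
  par : ℕ
  tag : ℕ

/-- The address of the record of the subproblem with index `j`. -/
def addr (n j : ℕ) : ℕ := n * n + 2 * n + j * (2 * n + 3)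

theorem addr_succ (n j : ℕ) : addr n (j + 1) = addr n j + (2 * n + 3) := by
  unfold addr; ring

theorem addr_mono {n i j : ℕ} (h : i ≤ j) : addr n i ≤ addr n j := by
  unfold addr
  have := Nat.mul_le_mul_right (2 * n + 3) h
  omega

theorem addr_add_le {n i j : ℕ} (h : i < j) : addr n i + (2 * n + 3) ≤ addr n j := by
  rw [← addr_succ]; exact addr_mono h

theorem le_addr (n j : ℕ) : n * n + 2 * n ≤ addr n j := by
  unfold addr; omega

/-- The record at address `a` describes the subproblem `nd` with the partial solution `R`. -/
structure Record {n : ℕ} (mem : ℕ → ℕ) (a : ℕ) (nd : Node n) (R : Finset (Fin n)) : Prop where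
  X : Holds mem a nd.X
  sol : Holds mem (a + n) R
  r : mem (a + 2 * n) = nd.r
  par : mem (a + 2 * n + 1) = addr n nd.par
  tag : mem (a + 2 * n + 2) = nd.tag

theorem Record.congr {n : ℕ} {mem mem' : ℕ → ℕ} {a : ℕ} {nd : Node n} {R : Finset (Fin n)}
    (h : Record mem a nd R) (hm : ∀ x, a ≤ x → x < a + (2 * n + 3) → mem' x = mem x) :
    Record mem' a nd R where
  X := h.X.congr fun x h1 h2 => hm x h1 (by omega)
  sol := h.sol.congr fun x h1 h2 => hm x (by omega) (by omega)
  r := by rw [hm _ (by omega) (by omega), h.r]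
  par := by rw [hm _ (by omega) (by omega), h.par]
  tag := by rw [hm _ (by omega) (by omega), h.tag]

open Classical in
/-- The neighbourhood of a vertex. -/
noncomputable def nbhd {n : ℕ} (G : SimpleGraph (Fin n)) (v : Fin n) : Finset (Fin n) :=
  Finset.univ.filter (G.Adj v)

theorem mem_nbhd {n : ℕ} {G : SimpleGraph (Fin n)} {u v : Fin n} :
    u ∈ nbhd G v ↔ G.Adj v u := by
  simp [nbhd]

theorem row_le {n : ℕ} (v : Fin n) : v.val * n + n ≤ n * n := by
  have := Nat.mul_le_mul_right n (Nat.succ_le_of_lt v.isLt)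
  rw [Nat.succ_mul] at this
  exact this

/-- The state of the machine while the queue `L` is being built, and the subproblem with index `i`
is being expanded. -/
structure Queue {n : ℕ} (G : SimpleGraph (Fin n)) (w : Fin n → ℚ) (L : List (Node n)) (i : ℕ)
    (s : State) : Prop where
  r0 : s.reg 0 = n
  r1 : s.reg 1 = 1
  r2 : s.reg 2 = 0
  r3 : s.reg 3 = n * n
  r4 : s.reg 4 = n * n + n
  r5 : s.reg 5 = 2 * n + 3
  r6 : s.reg 6 = addr n i
  r7 : s.reg 7 = addr n L.length
  adj : ∀ v : Fin n, Holds s.mem (v * n) (nbhd G v)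
  zero : Holds (n := n) s.mem (n * n) ∅
  recs : ∀ j (h : j < L.length), Record s.mem (addr n j) L[j] ∅
  weights : ∀ v : Fin n, s.wt v = w v
  wzero : ∀ j < L.length, s.wt (addr n j) = 0

/-- The cells n² + n, …, n² + 2n - 1 are scratch space between the empty set kept at n² and the
records, and the invariant says nothing about them or about registers from 8 on. -/
theorem Queue.frame {n : ℕ} {G : SimpleGraph (Fin n)} {w : Fin n → ℚ} {L : List (Node n)} {i : ℕ}
    {s s' : State} (h : Queue G w L i s) (hr : ∀ r < 8, s'.reg r = s.reg r)
    (hm : ∀ x, x < n * n + n ∨ n * n + 2 * n ≤ x → s'.mem x = s.mem x) (hw : s'.wt = s.wt) :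
    Queue G w L i s' where
  r0 := by rw [hr _ (by omega), h.r0]
  r1 := by rw [hr _ (by omega), h.r1]
  r2 := by rw [hr _ (by omega), h.r2]
  r3 := by rw [hr _ (by omega), h.r3]
  r4 := by rw [hr _ (by omega), h.r4]
  r5 := by rw [hr _ (by omega), h.r5]
  r6 := by rw [hr _ (by omega), h.r6]
  r7 := by rw [hr _ (by omega), h.r7]
  adj v := (h.adj v).congr fun x h1 h2 => hm x (by have := row_le v; omega)
  zero := h.zero.congr fun x h1 h2 => hm x (by omega)
  recs j hj := (h.recs j hj).congr fun x h1 h2 => hm x (by have := le_addr n j; omega)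
  weights v := by rw [hw, h.weights]
  wzero j hj := by rw [hw, h.wzero j hj]

/-- Appends a child of the current subproblem to the queue. Its set consists of the vertices that
are neither in the set at `reg c` nor equal to `reg k`, its budget is `reg q` and its tag `reg t`. -/
def childProg (c k q t : ℕ) : Program :=
  .seq (diffProg 6 7 c) <| block [.add 20 7 k, .store 20 2, .add 9 7 0] <|
    .seq (diffProg 3 9 3) <| block [.add 20 9 0, .store 20 q, .add 20 20 1, .store 20 6,
      .add 20 20 1, .store 20 t, .wzero 7] (.instr (.add 7 7 5))

/-- If register k holds n, no vertex is deleted: the zero lands just behind the set, in a cell that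
is overwritten afterwards. -/
theorem runsTo_childProg {n : ℕ} {G : SimpleGraph (Fin n)} {w : Fin n → ℚ} {L : List (Node n)}
    {i : ℕ} {s : State} (hs : Queue G w L i s) (hi : i < L.length) {c k q t : ℕ}
    (hc : c < 20) (hk : k < 20) (hq : q < 20) (ht : t < 20)
    (hq7 : q ≠ 9) (ht7 : t ≠ 9) {B : Finset (Fin n)} (hB : Holds s.mem (s.reg c) B)
    (hcB : s.reg c + n ≤ addr n L.length) (hkn : s.reg k ≤ n) :
    RunsTo (childProg c k q t) s (18 * n + 15) fun s' =>
      Queue G w (L ++ [⟨(L[i].X \ B).filter (fun v => v.val ≠ s.reg k), s.reg q, i, s.reg t⟩]) i s' ∧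
      (∀ x < addr n L.length, s'.mem x = s.mem x) ∧
      ∀ r < 20, r ≠ 7 → r ≠ 9 → s'.reg r = s.reg r := by
  have hle := le_addr n L.length
  have hadd := addr_add_le (n := n) hi
  have hX := (hs.recs i hi).X
  refine RunsTo.seq (runsTo_diffProg (by omega) (by omega) hc hs.r0 hs.r1 (hs.r6 ▸ hX) hB
    (Or.inr (Or.inl (by rw [hs.r6, hs.r7]; omega))) (Or.inl (by rw [hs.r7]; omega))) (by omega) ?_
  rintro s1 ⟨h1, h2, h3, h4⟩
  rw [hs.r7] at h1 h2
  refine RunsTo.block (by simp; omega) ?_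
  simp only [List.foldl_cons, List.foldl_nil, List.length_cons, List.length_nil]
  set s2 := (Instr.add 9 7 0).run ((Instr.store 20 2).run ((Instr.add 20 7 k).run s1)) with hs2
  have e0 : ∀ r < 20, r ≠ 9 → s2.reg r = s.reg r := by
    intro r hr hr9
    simp [hs2, Instr.run, hr9, show r ≠ 20 by omega, h4 r hr]
  have e9 : s2.reg 9 = addr n L.length + n := by
    simp [hs2, Instr.run, h4, hs.r7, hs.r0]
  have em : s2.mem = Function.update s1.mem (addr n L.length + s.reg k) 0 := by
    simp [hs2, Instr.run, h4, hs.r7, hs.r2, hk]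
  have ew : s2.wt = s.wt := by simp [hs2, Instr.run, h3]
  have e3 : s2.reg 3 = n * n := by rw [e0 3 (by omega) (by omega), hs.r3]
  have hZ : Holds (n := n) s2.mem (n * n) ∅ := hs.zero.congr fun x k1 k2 => by
    rw [em, Function.update_of_ne (by omega), h2 x (by omega)]
  refine RunsTo.seq (runsTo_diffProg (n := n) (A := ∅) (B := ∅) (by omega) (by omega) (by omega)
    (by rw [e0 0 (by omega) (by omega), hs.r0]) (by rw [e0 1 (by omega) (by omega), hs.r1])
    (by rwa [e3]) (by rwa [e3]) (Or.inr (Or.inl (by rw [e3, e9]; omega)))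
    (Or.inl (by rw [e3, e9]; omega))) (by omega) ?_
  rintro s3 ⟨k1, k2, k3, k4⟩
  rw [e9] at k1 k2
  rw [Finset.sdiff_self] at k1
  have f : ∀ r < 20, r ≠ 9 → s3.reg r = s.reg r := fun r hr hr9 => by
    rw [k4 r hr, e0 r hr hr9]
  have f9 : s3.reg 9 = addr n L.length + n := by rw [k4 9 (by omega), e9]
  have f7 : s3.reg 7 = addr n L.length := by rw [f 7 (by omega) (by omega), hs.r7]
  refine RunsTo.block (by simp; omega) (RunsTo.instr (by simp; omega) ?_)
  simp only [List.foldl_cons, List.foldl_nil]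
  generalize hs4 : (Instr.add 7 7 5).run _ = s4
  have g : ∀ r < 20, r ≠ 7 → r ≠ 9 → s4.reg r = s.reg r := by
    intro r hr hr7 hr9
    simp [← hs4, Instr.run, hr7, show r ≠ 20 by omega, f r hr hr9]
  have g7 : s4.reg 7 = addr n (L.length + 1) := by
    simp [← hs4, Instr.run, f7, f 5, hs.r5, addr_succ]
  have gm : s4.mem = Function.update (Function.update (Function.update s3.mem
      (addr n L.length + 2 * n) (s.reg q)) (addr n L.length + 2 * n + 1) (addr n i))
      (addr n L.length + 2 * n + 2) (s.reg t) := by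
    have e : addr n L.length + n + n = addr n L.length + 2 * n := by ring
    simp [← hs4, Instr.run, f9, f 0, f 1, f 6, f q hq hq7, f t ht ht7, hs.r0, hs.r1, hs.r6, e,
      show q ≠ 20 by omega, show t ≠ 20 by omega]
  have gw : s4.wt = Function.update s.wt (addr n L.length) 0 := by
    simp [← hs4, Instr.run, k3, ew, f7]
  clear hs4
  have gold : ∀ x < addr n L.length, s4.mem x = s.mem x := by
    intro x hx
    rw [gm, Function.update_of_ne (by omega), Function.update_of_ne (by omega),
      Function.update_of_ne (by omega), k2 x (by omega), em, Function.update_of_ne (by omega),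
      h2 x (by omega)]
  refine ⟨⟨?_, ?_, ?_, ?_, ?_, ?_, ?_, ?_, ?_, ?_, ?_, ?_, ?_⟩, gold, g⟩
  · rw [g 0 (by omega) (by omega) (by omega), hs.r0]
  · rw [g 1 (by omega) (by omega) (by omega), hs.r1]
  · rw [g 2 (by omega) (by omega) (by omega), hs.r2]
  · rw [g 3 (by omega) (by omega) (by omega), hs.r3]
  · rw [g 4 (by omega) (by omega) (by omega), hs.r4]
  · rw [g 5 (by omega) (by omega) (by omega), hs.r5]
  · rw [g 6 (by omega) (by omega) (by omega), hs.r6]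
  · rw [g7, List.length_append, List.length_singleton]
  · exact fun v => (hs.adj v).congr fun x q1 q2 => gold x (by have := row_le v; omega)
  · exact hs.zero.congr fun x q1 q2 => gold x (by omega)
  · intro j hj
    rw [List.length_append, List.length_singleton] at hj
    rcases Nat.lt_succ_iff_lt_or_eq.1 hj with hj' | rfl
    · rw [List.getElem_append_left hj']
      exact (hs.recs j hj').congr fun x q1 q2 => gold x (by
        have := addr_add_le (n := n) hj'; omega)
    · rw [List.getElem_concat_length rfl]
      refine ⟨?_, ?_, ?_, ?_, ?_⟩
      · intro v
        rw [gm, Function.update_of_ne (by omega), Function.update_of_ne (by omega),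
          Function.update_of_ne (by omega), k2 _ (by omega), em]
        by_cases hvk : v.val = s.reg k
        · rw [← hvk, Function.update_self]; simp [hvk]
        · rw [Function.update_of_ne (by omega), h1 v]; simp [hvk]
      · exact k1.congr fun x q1 q2 => by
          rw [gm, Function.update_of_ne (by omega), Function.update_of_ne (by omega),
            Function.update_of_ne (by omega)]
      · rw [gm, Function.update_of_ne (by omega), Function.update_of_ne (by omega),
          Function.update_self]
      · rw [gm, Function.update_of_ne (by omega), Function.update_self]
      · rw [gm, Function.update_self]
  · intro v
    rw [gw, Function.update_of_ne (by omega), hs.weights]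
  · intro j hj
    rw [List.length_append, List.length_singleton] at hj
    rw [gw]
    rcases Nat.lt_succ_iff_lt_or_eq.1 hj with hj' | rfl
    · have := addr_add_le (n := n) hj'
      rw [Function.update_of_ne (by omega), hs.wzero j hj']
    · rw [Function.update_self]

theorem Queue.getX {n : ℕ} {G : SimpleGraph (Fin n)} {w : Fin n → ℚ} {L : List (Node n)} {i : ℕ}
    {s : State} (h : Queue G w L i s) (hi : i < L.length) (v : Fin n) :
    s.mem (s.reg 6 + v) = if v ∈ L[i].X then 1 else 0 := by
  rw [h.r6]; exact (h.recs i hi).X v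

/-- Changes of the scratch set and of the local registers do not affect the queue. -/
theorem Queue.runsTo_diff {n : ℕ} {G : SimpleGraph (Fin n)} {w : Fin n → ℚ} {L : List (Node n)}
    {i : ℕ} {s : State} (h : Queue G w L i s) {a c : ℕ} (ha : a < 20) (hc : c < 20)
    {A B : Finset (Fin n)} (hA : Holds s.mem (s.reg a) A) (hB : Holds s.mem (s.reg c) B)
    (hab : s.reg a = n * n + n ∨ s.reg a + n ≤ n * n + n ∨ n * n + 2 * n ≤ s.reg a)
    (hcb : s.reg c + n ≤ n * n + n ∨ n * n + 2 * n ≤ s.reg c) :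
    RunsTo (diffProg a 4 c) s (9 * n + 2) fun s' => Queue G w L i s' ∧
      Holds s'.mem (n * n + n) (A \ B) ∧ ∀ r < 20, s'.reg r = s.reg r := by
  refine (runsTo_diffProg ha (by omega) hc h.r0 h.r1 hA hB (by rw [h.r4]; omega)
    (by rw [h.r4]; omega)).mono le_rfl ?_
  rintro s' ⟨h1, h2, h3, h4⟩
  rw [h.r4] at h1 h2
  exact ⟨h.frame (fun r hr => h4 r (by omega)) (fun x hx => h2 x (by omega)) h3, h1, h4⟩

theorem Queue.runsTo_scan {n : ℕ} {G : SimpleGraph (Fin n)} {w : Fin n → ℚ} {L : List (Node n)}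
    {i : ℕ} {s : State} (h : Queue G w L i s) {a : ℕ} (ha : a < 20) {A : Finset (Fin n)}
    (hA : Holds s.mem (s.reg a) A) : RunsTo (scanProg a) s (8 * n + 4) fun s' =>
      Queue G w L i s' ∧ s'.reg 20 = A.card ∧
      ((A = ∅ ∧ s'.reg 21 = n) ∨ ∃ u ∈ A, s'.reg 21 = u.val) ∧
      s'.mem = s.mem ∧ ∀ r < 20, s'.reg r = s.reg r := by
  refine (runsTo_scanProg ha h.r0 h.r1 hA).mono le_rfl ?_
  rintro s' ⟨h1, h2, h3, h4, h5⟩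
  exact ⟨h.frame (fun r hr => h5 r (by omega)) (fun x hx => by rw [h3]) h4, h1, h2, h3, h5⟩

/-! ### Searching a connected component -/

/-- Given a set `D ⊆ X`, repeatedly removes from `D` the neighbours of `X \ D`. -/
def componentProg : Program :=
  forLoop 14 <| block [.add 15 2 2] <| forLoop 16 <|
    .seq (block [.add 17 4 16, .load 17 17, .add 18 6 16, .load 18 18] <|
      .cond (.lt 17 18) (diffProg 4 4 15) (.instr (.const 20 0))) (.instr (.add 15 15 0))

/-- `Y` is closed under adjacency within `X`. -/
def AdjClosed {n : ℕ} (G : SimpleGraph (Fin n)) (X Y : Finset (Fin n)) : Prop :=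
  Y ⊆ X ∧ ∀ y ∈ Y, ∀ x ∈ X, G.Adj y x → x ∈ Y

/-- The complement of `D` in `X` contains `u` and is contained in its component. -/
def ReachedFrom {n : ℕ} (G : SimpleGraph (Fin n)) (X : Finset (Fin n)) (u : Fin n)
    (D : Finset (Fin n)) : Prop :=
  D ⊆ X ∧ u ∉ D ∧ ∀ Y, AdjClosed G X Y → u ∈ Y → X \ D ⊆ Y

/-- A round removes from D at least the neighbours of all vertices that were outside of D when it
began. So either nothing joins D to its complement in X, or that complement has grown in every round
so far; after n rounds the latter would give it more than n vertices. -/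
theorem runsTo_componentProg {n : ℕ} {G : SimpleGraph (Fin n)} {w : Fin n → ℚ}
    {L : List (Node n)} {i : ℕ} {s : State} (hs : Queue G w L i s) (hi : i < L.length)
    {u : Fin n} (hu : u ∈ L[i].X) (hD : Holds s.mem (n * n + n) (L[i].X.erase u)) :
    RunsTo componentProg s (26 * (n + 1) ^ 3) fun s' => Queue G w L i s' ∧ s'.reg 10 = s.reg 10 ∧
      ∃ D, Holds s'.mem (n * n + n) D ∧ ReachedFrom G L[i].X u D ∧
        ∀ a ∈ L[i].X \ D, ∀ b ∈ D, ¬ G.Adj a b := by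
  set X := L[i].X with hX
  refine RunsTo.forLoop (n := n) (T := n * (9 * n + 10) + 3) (fun v t => t.reg 14 = v ∧
    Queue G w L i t ∧ t.reg 10 = s.reg 10 ∧ ∃ D, Holds t.mem (n * n + n) D ∧
    ReachedFrom G X u D ∧ ((∀ a ∈ X \ D, ∀ b ∈ D, ¬ G.Adj a b) ∨ v + 1 ≤ (X \ D).card))
    ?_ ?_ ?_ ?_ (by nlinarith [Nat.zero_le (n ^ 3), Nat.zero_le (n ^ 2)])
  · rintro v t ⟨h1, h2, -⟩
    exact ⟨h1, h2.r0⟩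
  · refine ⟨by simp [Instr.run], hs.frame (fun r hr => ?_) (fun x _ => rfl) rfl, by simp [Instr.run],
      X.erase u, hD, ⟨Finset.erase_subset _ _, by simp, fun Y hY huY x hx => ?_⟩, Or.inr ?_⟩
    · simp [Instr.run, show r ≠ 14 by omega]
    · simp only [Finset.mem_sdiff, Finset.mem_erase, not_and, not_not] at hx
      have : x = u := by
        by_contra h
        exact hx.2 h hx.1
      rwa [this]
    · exact Finset.card_pos.2 ⟨u, by simp [hu]⟩
  · rintro v t hv ⟨h1, h2, h3, D0, h4, ⟨h5, h6, h7⟩, h8⟩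
    refine RunsTo.block (by simp) ?_
    simp only [List.foldl_cons, List.foldl_nil, List.length_cons, List.length_nil]
    refine RunsTo.forLoop (n := n) (T := 9 * n + 8) (fun z t' => t'.reg 16 = z ∧ t'.reg 14 = v ∧
      t'.reg 15 = z * n ∧ Queue G w L i t' ∧ t'.reg 10 = s.reg 10 ∧
      ∃ D, Holds t'.mem (n * n + n) D ∧ D ⊆ D0 ∧ ReachedFrom G X u D ∧
      ∀ a ∈ X \ D0, a.val < z → ∀ b ∈ D, ¬ G.Adj a b) ?_ ?_ ?_ ?_ (by simp)
    · rintro z t' ⟨q1, -, -, q2, -⟩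
      exact ⟨q1, q2.r0⟩
    · refine ⟨by simp [Instr.run], by simpa [Instr.run] using h1, by simp [Instr.run, h2.r2],
        h2.frame (fun r hr => ?_) (fun x _ => rfl) rfl, by simpa [Instr.run] using h3, D0, h4,
        subset_rfl, ⟨h5, h6, h7⟩, by simp⟩
      simp [Instr.run, show r ≠ 15 by omega, show r ≠ 16 by omega]
    · rintro z t' hz ⟨q1, q2, q3, q4, q5, D, q6, q7, ⟨q8, q9, q10⟩, q11⟩
      have e1 : t'.mem (n * n + n + z) = if (⟨z, hz⟩ : Fin n) ∈ D then 1 else 0 := q6 ⟨z, hz⟩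
      have e2 : t'.mem (t'.reg 6 + z) = if (⟨z, hz⟩ : Fin n) ∈ X then 1 else 0 :=
        q4.getX hi ⟨z, hz⟩
      -- after the test
      refine RunsTo.seq (T1 := 9 * n + 7) (R := fun t'' => t''.reg 16 = z ∧ t''.reg 14 = v ∧
        t''.reg 15 = z * n ∧ Queue G w L i t'' ∧ t''.reg 10 = s.reg 10 ∧
        ∃ D, Holds t''.mem (n * n + n) D ∧ D ⊆ D0 ∧ ReachedFrom G X u D ∧
        ∀ a ∈ X \ D0, a.val < z + 1 → ∀ b ∈ D, ¬ G.Adj a b) ?_ (by omega) ?_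
      · refine RunsTo.block (by simp) ?_
        simp only [List.foldl_cons, List.foldl_nil]
        generalize hr : (Instr.load 18 18).run _ = t1
        have p1 : ∀ r < 17, t1.reg r = t'.reg r := by
          intro r hr'
          simp [← hr, Instr.run, show r ≠ 17 by omega, show r ≠ 18 by omega]
        have p2 : t1.mem = t'.mem := by simp [← hr, Instr.run]
        have p3 : t1.wt = t'.wt := by simp [← hr, Instr.run]
        have p4 : t1.reg 17 = if (⟨z, hz⟩ : Fin n) ∈ D then 1 else 0 := by
          simp [← hr, Instr.run, q4.r4, q1, e1]
        have p5 : t1.reg 18 = if (⟨z, hz⟩ : Fin n) ∈ X then 1 else 0 := by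
          simp [← hr, Instr.run, q1, e2]
        clear hr
        have hq : Queue G w L i t1 := q4.frame (fun r hr => p1 r (by omega)) (fun x _ => by rw [p2]) p3
        refine RunsTo.cond (by simp) ?_ ?_
        · intro hb
          -- Comparing the two membership bits tests whether z is in X \ D.
          simp only [Test.Holds, p4, p5] at hb
          have hzD : (⟨z, hz⟩ : Fin n) ∉ D := fun h => by
            rw [if_pos h] at hb
            split_ifs at hb <;> omega
          have hzX : (⟨z, hz⟩ : Fin n) ∈ X := by
            by_contra h
            rw [if_neg h] at hb
            omega
          refine (hq.runsTo_diff (a := 4) (c := 15) (by omega) (by omega)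
            (by rw [hq.r4, p2]; exact q6) (B := nbhd G ⟨z, hz⟩)
            (by rw [p1 15 (by omega), q3]; exact hq.adj ⟨z, hz⟩) (Or.inl hq.r4) (Or.inl ?_)).mono
            (by simp) ?_
          · rw [p1 15 (by omega), q3]
            have := row_le (⟨z, hz⟩ : Fin n)
            simp only at this
            omega
          · rintro t2 ⟨m1, m2, m3⟩
            refine ⟨by rw [m3 _ (by omega), p1 _ (by omega), q1],
              by rw [m3 _ (by omega), p1 _ (by omega), q2],
              by rw [m3 _ (by omega), p1 _ (by omega), q3], m1,
              by rw [m3 _ (by omega), p1 _ (by omega), q5], _, m2,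
              Finset.sdiff_subset.trans q7,
              ⟨Finset.sdiff_subset.trans q8, fun h => q9 (Finset.sdiff_subset h), ?_⟩, ?_⟩
            · intro Y hY huY x hx
              have hYx := q10 Y hY huY
              simp only [Finset.mem_sdiff, not_and, not_not] at hx
              by_cases hxD : x ∈ D
              · exact hY.2 ⟨z, hz⟩ (hYx (Finset.mem_sdiff.2 ⟨hzX, hzD⟩)) x hx.1
                  (mem_nbhd.1 (hx.2 hxD))
              · exact hYx (Finset.mem_sdiff.2 ⟨hx.1, hxD⟩)
            · intro a ha haz b hb hab
              rw [Finset.mem_sdiff] at hb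
              rcases Nat.lt_succ_iff_lt_or_eq.1 haz with h | h
              · exact q11 a ha h b hb.1 hab
              · obtain rfl : a = ⟨z, hz⟩ := Fin.ext h
                exact hb.2 (mem_nbhd.2 hab)
        · intro hb
          simp only [Test.Holds, p4, p5] at hb
          refine RunsTo.instr (by simp) ⟨?_, ?_, ?_, ?_, ?_, D, ?_, q7, ⟨q8, q9, q10⟩, ?_⟩
          · simp [Instr.run, p1, q1]
          · simp [Instr.run, p1, q2]
          · simp [Instr.run, p1, q3]
          · refine hq.frame (fun r hr => ?_) (fun x _ => rfl) rfl
            simp [Instr.run, show r ≠ 20 by omega]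
          · simp [Instr.run, p1, q5]
          · change Holds t1.mem _ _
            rwa [p2]
          · intro a ha haz b hbD hab
            rcases Nat.lt_succ_iff_lt_or_eq.1 haz with h | h
            · exact q11 a ha h b hbD hab
            · obtain rfl : a = ⟨z, hz⟩ := Fin.ext h
              rw [Finset.mem_sdiff] at ha
              refine hb ?_
              rw [if_neg fun h => ha.2 (q7 h), if_pos ha.1]
              omega
      · rintro t'' ⟨k1, k2, k3, k4, k5, D', k6⟩
        refine RunsTo.instr (by omega) ⟨?_, ?_, ?_, ?_, ?_, D', k6⟩
        · simp [Instr.run, k1, k4.r1]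
        · simp [Instr.run, k2]
        · simp [Instr.run, k3, k4.r0, Nat.succ_mul]
        · refine k4.frame (fun r hr => ?_) (fun x _ => rfl) rfl
          simp [Instr.run, show r ≠ 15 by omega, show r ≠ 16 by omega]
        · simp [Instr.run, k5]
    · rintro t' ⟨q1, q2, q3, q4, q5, D, q6, q7, q8, q9⟩
      refine ⟨by simp [Instr.run, q2, q4.r1], ?_, by simp [Instr.run, q5], D, q6, q8, ?_⟩
      · refine q4.frame (fun r hr => ?_) (fun x _ => rfl) rfl
        simp [Instr.run, show r ≠ 14 by omega]
      · have q10 : ∀ a ∈ X \ D0, ∀ b ∈ D, ¬ G.Adj a b := fun a ha => q9 a ha a.isLt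
        by_cases hDD : D = D0
        · rw [hDD] at q10 ⊢
          exact Or.inl q10
        · rcases h8 with h8 | h8
          -- If no edge left X \ D0, that set was closed under adjacency and the reached set could
          -- not have outgrown it.
          · exfalso
            refine hDD (Finset.Subset.antisymm q7 fun x hx => ?_)
            have := q8.2.2 (X \ D0) ⟨Finset.sdiff_subset, fun y hy x hx hyx => by
              rw [Finset.mem_sdiff]
              exact ⟨hx, fun h => h8 y hy x h hyx⟩⟩ (Finset.mem_sdiff.2 ⟨hu, h6⟩)
            by_contra hxD
            have := this (Finset.mem_sdiff.2 ⟨h5 hx, hxD⟩)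
            exact (Finset.mem_sdiff.1 this).2 hx
          · right
            have hlt : D.card < D0.card := Finset.card_lt_card (q7.ssubset_of_ne hDD)
            have e1 := Finset.card_sdiff_of_subset h5
            have e2 := Finset.card_sdiff_of_subset q8.1
            have := Finset.card_le_card h5
            omega
  · rintro t ⟨h1, h2, h3, D, h4, h5, h6⟩
    refine ⟨h2, h3, D, h4, h5, ?_⟩
    rcases h6 with h6 | h6
    · exact h6
    · have := (X \ D).card_le_univ
      rw [Fintype.card_fin] at this
      omega

/-! ### The children of a subproblem and the number of subproblems -/

/-- A bound for the number of subproblems below one with `m` vertices and budget `r`. -/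
def treeSize (n m r : ℕ) : ℕ := if m = 0 then 1 else (3 * m - 1) * (6 * (n + 1) ^ 2) ^ r

theorem treeSize_mono {n m m' : ℕ} (h : m ≤ m') (r : ℕ) : treeSize n m r ≤ treeSize n m' r := by
  unfold treeSize
  have h1 : 1 ≤ (6 * (n + 1) ^ 2) ^ r := Nat.one_le_pow _ _ (by positivity)
  split_ifs with h2 h3 h3
  · exact le_rfl
  · exact Nat.one_le_iff_ne_zero.2 (Nat.mul_ne_zero (by omega) (by omega))
  · omega
  · exact Nat.mul_le_mul_right _ (by omega)

theorem one_le_treeSize (n m r : ℕ) : 1 ≤ treeSize n m r :=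
  (by simp [treeSize] : 1 ≤ treeSize n 0 r).trans (treeSize_mono (Nat.zero_le m) r)

/-- The -1 in the factor 3m - 1 is there for this: (3a - 1) + (3b - 1) is one less than 3(a + b) -
1, and this unit pays for the split node itself. -/
theorem treeSize_split {n a b : ℕ} (ha : a ≠ 0) (hb : b ≠ 0) (r : ℕ) :
    1 + (treeSize n a r + treeSize n b r) ≤ treeSize n (a + b) r := by
  have h1 : 1 ≤ (6 * (n + 1) ^ 2) ^ r := Nat.one_le_pow _ _ (by positivity)
  simp only [treeSize, ha, hb, if_false, show a + b ≠ 0 by omega]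
  obtain ⟨a, rfl⟩ := Nat.exists_eq_succ_of_ne_zero ha
  obtain ⟨b, rfl⟩ := Nat.exists_eq_succ_of_ne_zero hb
  generalize (6 * (n + 1) ^ 2) ^ r = q at *
  simp only [Nat.succ_eq_add_one, show 3 * (a + 1) - 1 = 3 * a + 2 by omega,
    show 3 * (b + 1) - 1 = 3 * b + 2 by omega,
    show 3 * (a + 1 + (b + 1)) - 1 = 3 * a + 3 * b + 5 by omega]
  nlinarith

/-- For m ≥ 2, the vertex lost by the child with full budget frees three units of the power with
exponent r + 1. One of them equals 6(n+1)² units with exponent r, while the 2m other children need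
fewer than 6m² such units together. -/
theorem treeSize_branch {n m : ℕ} (hm : m ≤ n) (r : ℕ) (hm0 : m ≠ 0) :
    1 + (treeSize n (m - 1) (r + 1) + m * (2 * treeSize n (m - 1) r)) ≤ treeSize n m (r + 1) := by
  have h1 : 1 ≤ (6 * (n + 1) ^ 2) ^ r := Nat.one_le_pow _ _ (by positivity)
  obtain ⟨m, rfl⟩ := Nat.exists_eq_succ_of_ne_zero hm0
  simp only [treeSize, Nat.succ_eq_add_one, Nat.add_sub_cancel, pow_succ _ r]
  generalize (6 * (n + 1) ^ 2) ^ r = q at *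
  have h2 : (m + 2) ^ 2 ≤ (n + 1) ^ 2 := Nat.pow_le_pow_left (by omega) 2
  have h3 : q * (6 * (m + 2) ^ 2) ≤ q * (6 * (n + 1) ^ 2) :=
    Nat.mul_le_mul_left _ (Nat.mul_le_mul_left _ h2)
  generalize q * (6 * (n + 1) ^ 2) = p at *
  by_cases hm : m = 0
  · subst hm
    simp
    omega
  · obtain ⟨m, rfl⟩ := Nat.exists_eq_succ_of_ne_zero hm
    simp only [Nat.succ_eq_add_one, show 3 * (m + 1) - 1 = 3 * m + 2 by omega,
      show 3 * (m + 1 + 1) - 1 = 3 * m + 5 by omega]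
    simp
    nlinarith [Nat.zero_le (m * q), Nat.zero_le (m * m * q)]

/-- The children of the subproblem `(X, r)` with index `i`. -/
inductive Expands {n : ℕ} (G : SimpleGraph (Fin n)) (i : ℕ) (X : Finset (Fin n)) (r : ℕ) :
    List (Node n) → Prop
  | leaf : X = ∅ ∨ r = 0 → Expands G i X r []
  | split (C : Finset (Fin n)) : C ⊆ X → C.Nonempty → (X \ C).Nonempty →
      (∀ a ∈ C, ∀ b ∈ X \ C, ¬ G.Adj a b) →
      Expands G i X r [⟨C, r, i, n + 1⟩, ⟨X \ C, r, i, n + 1⟩]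
  | branch (cs : List (Node n)) (u v : Fin n) : u ∈ X → v ∈ X → r ≠ 0 →
      (∀ Y, AdjClosed G X Y → u ∈ Y → X ⊆ Y) →
      (∀ z ∈ X, (X \ nbhd G v).card ≤ (X \ nbhd G z).card) →
      ⟨X.erase v, r, i, n⟩ ∈ cs →
      (∀ z ∈ X, ⟨X.erase z, r - 1, i, n⟩ ∈ cs ∧ ⟨(X \ nbhd G z).erase z, r - 1, i, z⟩ ∈ cs) →
      (∀ c ∈ cs, c.par = i ∧ ((c.tag = n ∧ c.X ⊆ X) ∨
        ∃ z ∈ X, c.tag = z ∧ c.X ⊆ (X \ nbhd G z).erase z)) →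
      1 + (cs.map fun c => treeSize n c.X.card c.r).sum ≤ treeSize n X.card r →
      Expands G i X r cs

theorem Expands.par_eq {n : ℕ} {G : SimpleGraph (Fin n)} {i r : ℕ} {X : Finset (Fin n)}
    {cs : List (Node n)} (h : Expands G i X r cs) : ∀ c ∈ cs, c.par = i := by
  cases h with
  | leaf _ => simp
  | split C _ _ _ _ => simp
  | branch _ _ _ _ _ _ _ _ _ _ h _ => exact fun c hc => (h c hc).1

theorem Expands.sum_le {n : ℕ} {G : SimpleGraph (Fin n)} {i r : ℕ} {X : Finset (Fin n)}
    {cs : List (Node n)} (h : Expands G i X r cs) :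
    1 + (cs.map fun c => treeSize n c.X.card c.r).sum ≤ treeSize n X.card r := by
  cases h with
  | leaf _ => simpa using one_le_treeSize n _ _
  | split C h1 h2 h3 _ =>
    have := treeSize_split (n := n) (Finset.card_ne_zero.2 h2) (Finset.card_ne_zero.2 h3) r
    rw [Finset.card_sdiff_of_subset h1, Nat.add_sub_cancel' (Finset.card_le_card h1)] at this
    simpa [Finset.card_sdiff_of_subset h1] using this
  | branch _ _ _ _ _ _ _ _ _ _ _ h => exact h

/-- Puts a vertex of maximum degree in the current set into register `12`. -/
def maxDegreeProg : Program :=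
  block [.add 11 0 1, .add 12 0 2, .add 15 2 2] <| forLoop 16 <|
    .seq (block [.add 17 6 16, .load 17 17] <| .cond (.eq 17 1)
      (.seq (diffProg 6 4 15) (.seq (scanProg 4)
        (.cond (.lt 20 11) (block [.add 11 20 2] (.instr (.add 12 16 2)))
          (.instr (.const 20 0))))) (.instr (.const 20 0))) (.instr (.add 15 15 0))

/-- The degree within X is largest where |X \ N(v)| is smallest. The initial record n + 1 exceeds
every such value, so the first vertex of X always beats it. -/
theorem runsTo_maxDegreeProg {n : ℕ} {G : SimpleGraph (Fin n)} {w : Fin n → ℚ}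
    {L : List (Node n)} {i : ℕ} {s : State} (hs : Queue G w L i s) (hi : i < L.length)
    (hne : L[i].X.Nonempty) :
    RunsTo maxDegreeProg s (17 * (n * n) + 15 * n + 5) fun s' => Queue G w L i s' ∧
      s'.reg 10 = s.reg 10 ∧ ∃ v ∈ L[i].X, s'.reg 12 = v.val ∧
        ∀ z ∈ L[i].X, (L[i].X \ nbhd G v).card ≤ (L[i].X \ nbhd G z).card := by
  set X := L[i].X with hX
  have hXn : X.card ≤ n := by simpa using X.card_le_univ
  refine RunsTo.block (by simp) ?_
  simp only [List.foldl_cons, List.foldl_nil, List.length_cons, List.length_nil]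
  refine RunsTo.forLoop (n := n) (T := 17 * n + 13) (fun z t => t.reg 16 = z ∧ t.reg 15 = z * n ∧
    Queue G w L i t ∧ t.reg 10 = s.reg 10 ∧
    ((t.reg 11 = n + 1 ∧ ∀ u ∈ X, z ≤ u.val) ∨
      ∃ v ∈ X, t.reg 12 = v.val ∧ t.reg 11 = (X \ nbhd G v).card ∧
        ∀ u ∈ X, u.val < z → (X \ nbhd G v).card ≤ (X \ nbhd G u).card)) ?_ ?_ ?_ ?_
      (le_of_eq (by simp; ring))
  · rintro z t ⟨q1, -, q2, -⟩
    exact ⟨q1, q2.r0⟩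
  · refine ⟨by simp [Instr.run], by simp [Instr.run, hs.r2],
      hs.frame (fun r hr => ?_) (fun x _ => rfl) rfl, by simp [Instr.run],
      Or.inl ⟨by simp [Instr.run, hs.r0, hs.r1], by simp⟩⟩
    simp [Instr.run, show r ≠ 16 by omega, show r ≠ 15 by omega, show r ≠ 12 by omega,
      show r ≠ 11 by omega]
  · rintro z t hz ⟨q1, q2, q3, q4, q5⟩
    have e2 : t.mem (t.reg 6 + z) = if (⟨z, hz⟩ : Fin n) ∈ X then 1 else 0 := q3.getX hi ⟨z, hz⟩
    refine RunsTo.seq (T1 := 17 * n + 12) (R := fun t => t.reg 16 = z ∧ t.reg 15 = z * n ∧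
      Queue G w L i t ∧ t.reg 10 = s.reg 10 ∧
      ((t.reg 11 = n + 1 ∧ ∀ u ∈ X, z + 1 ≤ u.val) ∨
      ∃ v ∈ X, t.reg 12 = v.val ∧ t.reg 11 = (X \ nbhd G v).card ∧
        ∀ u ∈ X, u.val < z + 1 → (X \ nbhd G v).card ≤ (X \ nbhd G u).card)) ?_ (by omega) ?_
    · refine RunsTo.block (by simp) ?_
      simp only [List.foldl_cons, List.foldl_nil]
      generalize hr : (Instr.load 17 17).run _ = t1
      have p1 : ∀ r < 17, t1.reg r = t.reg r := by
        intro r hr'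
        simp [← hr, Instr.run, show r ≠ 17 by omega]
      have p2 : t1.mem = t.mem := by simp [← hr, Instr.run]
      have p3 : t1.wt = t.wt := by simp [← hr, Instr.run]
      have p4 : t1.reg 17 = if (⟨z, hz⟩ : Fin n) ∈ X then 1 else 0 := by
        simp [← hr, Instr.run, q1, e2]
      clear hr
      have hq : Queue G w L i t1 := q3.frame (fun r hr => p1 r (by omega)) (fun x _ => by rw [p2]) p3
      refine RunsTo.cond (by simp) ?_ ?_
      · intro hb
        have hzX : (⟨z, hz⟩ : Fin n) ∈ X := by
          simp only [Test.Holds, p4, hq.r1] at hb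
          by_contra h
          rw [if_neg h] at hb
          omega
        have hrow := row_le (⟨z, hz⟩ : Fin n)
        simp only at hrow
        refine RunsTo.seq (hq.runsTo_diff (a := 6) (c := 15) (A := X) (B := nbhd G ⟨z, hz⟩)
          (by omega) (by omega) (by rw [hq.r6]; exact (hq.recs i hi).X)
          (by rw [p1 15 (by omega), q2]; exact hq.adj ⟨z, hz⟩)
          (Or.inr (Or.inr (by rw [hq.r6]; exact le_addr _ _)))
          (Or.inl (by rw [p1 15 (by omega), q2]; omega))) (by simp; omega) ?_
        rintro t2 ⟨m1, m2, m3⟩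
        refine RunsTo.seq (m1.runsTo_scan (a := 4) (by omega) (by rw [m1.r4]; exact m2))
          (by simp; omega) ?_
        rintro t3 ⟨k1, k2, -, k3, k4⟩
        have f : ∀ r < 17, t3.reg r = t.reg r := fun r hr => by
          rw [k4 r (by omega), m3 r (by omega), p1 r hr]
        refine RunsTo.cond (by simp; omega) ?_ ?_
        · intro hb
          simp only [Test.Holds, k2, f 11 (by omega)] at hb
          refine RunsTo.block (by simp; omega) (RunsTo.instr (by simp; omega)
            ⟨?_, ?_, ?_, ?_, Or.inr ⟨⟨z, hz⟩, hzX, ?_, ?_, ?_⟩⟩)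
          · simp [Instr.run, f, q1]
          · simp [Instr.run, f, q2]
          · refine k1.frame (fun r hr => ?_) (fun x _ => rfl) rfl
            simp [Instr.run, show r ≠ 11 by omega, show r ≠ 12 by omega]
          · simp [Instr.run, f, q4]
          · simp [Instr.run, f, q1, q3.r2]
          · simp [Instr.run, f, k2, q3.r2]
          · intro u hu huz
            rcases Nat.lt_succ_iff_lt_or_eq.1 huz with h | h
            · rcases q5 with ⟨-, q5⟩ | ⟨v, -, -, q6, q7⟩
              · have := q5 u hu
                omega
              · have := q7 u hu h
                omega
            · rw [show u = ⟨z, hz⟩ from Fin.ext h]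
        · intro hb
          simp only [Test.Holds, k2, f 11 (by omega)] at hb
          refine RunsTo.instr (by simp; omega) ⟨?_, ?_, ?_, ?_, Or.inr ?_⟩
          · simp [Instr.run, f, q1]
          · simp [Instr.run, f, q2]
          · refine k1.frame (fun r hr => ?_) (fun x _ => rfl) rfl
            simp [Instr.run, show r ≠ 20 by omega]
          · simp [Instr.run, f, q4]
          · rcases q5 with ⟨q5, -⟩ | ⟨v, q5, q6, q7, q8⟩
            · have := Finset.card_le_card (Finset.sdiff_subset : X \ nbhd G ⟨z, hz⟩ ⊆ X)
              omega
            · refine ⟨v, q5, by simp [Instr.run, f, q6], by simp [Instr.run, f, q7], ?_⟩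
              intro u hu huz
              rcases Nat.lt_succ_iff_lt_or_eq.1 huz with h | h
              · exact q8 u hu h
              · rw [show u = ⟨z, hz⟩ from Fin.ext h]
                omega
      · intro hb
        have hzX : (⟨z, hz⟩ : Fin n) ∉ X := by
          intro h
          simp only [Test.Holds, p4, hq.r1, if_pos h] at hb
          exact hb trivial
        have hne : ∀ u ∈ X, u.val ≠ z := by
          intro u hu h
          rw [show u = ⟨z, hz⟩ from Fin.ext h] at hu
          exact hzX hu
        refine RunsTo.instr (by simp) ⟨?_, ?_, ?_, ?_, ?_⟩
        · simp [Instr.run, p1, q1]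
        · simp [Instr.run, p1, q2]
        · refine hq.frame (fun r hr => ?_) (fun x _ => rfl) rfl
          simp [Instr.run, show r ≠ 20 by omega]
        · simp [Instr.run, p1, q4]
        · rcases q5 with ⟨q5, q6⟩ | ⟨v, q5, q6, q7, q8⟩
          · refine Or.inl ⟨by simp [Instr.run, p1, q5], fun u hu => ?_⟩
            have := hne u hu
            have := q6 u hu
            omega
          · refine Or.inr ⟨v, q5, by simp [Instr.run, p1, q6], by simp [Instr.run, p1, q7], ?_⟩
            intro u hu huz
            have := hne u hu
            exact q8 u hu (by omega)
    · rintro t'' ⟨k1, k2, k3, k4, k5⟩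
      refine RunsTo.instr (by omega) ⟨?_, ?_, ?_, ?_, ?_⟩
      · simp [Instr.run, k1, k3.r1]
      · simp [Instr.run, k2, k3.r0, Nat.succ_mul]
      · refine k3.frame (fun r hr => ?_) (fun x _ => rfl) rfl
        simp [Instr.run, show r ≠ 15 by omega, show r ≠ 16 by omega]
      · simp [Instr.run, k4]
      · simpa [Instr.run] using k5
  · rintro t ⟨q1, q2, q3, q4, q5⟩
    refine ⟨q3, q4, ?_⟩
    rcases q5 with ⟨-, q5⟩ | ⟨v, q5, q6, -, q7⟩
    · obtain ⟨u, hu⟩ := hne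
      have := q5 u hu
      omega
    · exact ⟨v, q5, q6, fun z hz => q7 z hz z.isLt⟩

/-- Appends the children of a connected subproblem. -/
def branchProg : Program :=
  .seq (childProg 3 12 10 0) <| block [.sub 11 10 1, .add 15 2 2] <| forLoop 16 <|
    .seq (block [.add 17 6 16, .load 17 17] <| .cond (.eq 17 1)
      (.seq (childProg 3 16 11 0) (childProg 15 16 11 16)) (.instr (.const 20 0)))
      (.instr (.add 15 15 0))

theorem filter_val_ne {n : ℕ} (X : Finset (Fin n)) (v : Fin n) :
    X.filter (fun u => u.val ≠ v.val) = X.erase v := by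
  ext u
  simp [Finset.mem_erase, Fin.ext_iff, and_comm]

theorem filter_val_ne_self {n : ℕ} (X : Finset (Fin n)) :
    X.filter (fun u => u.val ≠ n) = X :=
  Finset.filter_true_of_mem fun u _ => u.isLt.ne

/-- Each z in X adds two children with at most |X| - 1 vertices and budget r - 1. The invariant
bounds the cost by the number of vertices of X visited so far, and `treeSize_branch` concludes. -/
theorem runsTo_branchProg {n : ℕ} {G : SimpleGraph (Fin n)} {w : Fin n → ℚ}
    {L : List (Node n)} {i : ℕ} {s : State} (hs : Queue G w L i s) (hi : i < L.length)
    {u v : Fin n} (hu : u ∈ L[i].X) (hv : v ∈ L[i].X) (hr : s.reg 10 = L[i].r)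
    (hr0 : L[i].r ≠ 0) (h12 : s.reg 12 = v.val)
    (hconn : ∀ Y, AdjClosed G L[i].X Y → u ∈ Y → L[i].X ⊆ Y)
    (hdeg : ∀ z ∈ L[i].X, (L[i].X \ nbhd G v).card ≤ (L[i].X \ nbhd G z).card) :
    RunsTo branchProg s (36 * (n * n) + 54 * n + 19) fun s' => ∃ cs,
      Expands G i L[i].X L[i].r cs ∧ Queue G w (L ++ cs) i s' := by
  have hXn : L[i].X.card ≤ n := by simpa using L[i].X.card_le_univ
  have hget : ∀ cs, ∃ h : i < (L ++ cs).length, (L ++ cs)[i] = L[i] := fun cs =>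
    ⟨by rw [List.length_append]; omega, List.getElem_append_left hi⟩
  have hlen : ∀ cs : List (Node n), n * n + 2 * n ≤ addr n (L ++ cs).length := fun cs => le_addr _ _
  generalize hX : L[i].X = X at *
  generalize hrr : L[i].r = r at *
  refine RunsTo.seq (runsTo_childProg hs hi (by omega) (by omega) (by omega) (by omega) (by omega)
    (by omega) (by rw [hs.r3]; exact hs.zero) (by rw [hs.r3]; have := le_addr n L.length; omega)
    (by rw [h12]; omega)) (by nlinarith [Nat.zero_le (n * n)]) ?_
  rintro s1 ⟨h1, -, h2⟩
  rw [hX, hr, hs.r0, h12, Finset.sdiff_empty, filter_val_ne] at h1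
  refine RunsTo.block (by simp; omega) ?_
  simp only [List.foldl_cons, List.foldl_nil, List.length_cons, List.length_nil]
  refine RunsTo.forLoop (n := n) (T := 36 * n + 34) (fun z t => t.reg 16 = z ∧ t.reg 15 = z * n ∧
    t.reg 11 = r - 1 ∧ ∃ cs, Queue G w (L ++ cs) i t ∧ ⟨X.erase v, r, i, n⟩ ∈ cs ∧
    (∀ z' ∈ X, z'.val < z → ⟨X.erase z', r - 1, i, n⟩ ∈ cs ∧
      ⟨(X \ nbhd G z').erase z', r - 1, i, z'⟩ ∈ cs) ∧
    (∀ c ∈ cs, c.par = i ∧ ((c.tag = n ∧ c.X ⊆ X) ∨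
        ∃ z ∈ X, c.tag = z ∧ c.X ⊆ (X \ nbhd G z).erase z)) ∧
    (cs.map fun c => treeSize n c.X.card c.r).sum ≤ treeSize n (X.card - 1) r +
      (X.filter fun x => x.val < z).card * (2 * treeSize n (X.card - 1) (r - 1)))
    ?_ ?_ ?_ ?_ ?_
  · rintro z t ⟨q1, -, -, cs, q2, -⟩
    exact ⟨q1, q2.r0⟩
  · refine ⟨by simp [Instr.run], by simp [Instr.run, h1.r2],
      by simp [Instr.run, h1.r1, h2, hr], _, h1.frame (fun r hr => ?_) (fun x _ => rfl) rfl,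
      by simp, by simp, ?_, ?_⟩
    · simp [Instr.run, show r ≠ 16 by omega, show r ≠ 15 by omega, show r ≠ 11 by omega]
    · simp [Finset.erase_subset]
    · simp [Finset.card_erase_of_mem hv]
  · rintro z t hz ⟨q1, q2, q3, cs, q4, q5, q6, q7, q8⟩
    obtain ⟨hi', hget'⟩ := hget cs
    have e2 : t.mem (t.reg 6 + z) = if (⟨z, hz⟩ : Fin n) ∈ X then 1 else 0 := by
      have := q4.getX hi' ⟨z, hz⟩
      rwa [hget', hX] at this
    refine RunsTo.seq (T1 := 36 * n + 33) (R := fun t => t.reg 16 = z ∧ t.reg 15 = z * n ∧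
      t.reg 11 = r - 1 ∧ ∃ cs, Queue G w (L ++ cs) i t ∧ ⟨X.erase v, r, i, n⟩ ∈ cs ∧
      (∀ z' ∈ X, z'.val < z + 1 → ⟨X.erase z', r - 1, i, n⟩ ∈ cs ∧
        ⟨(X \ nbhd G z').erase z', r - 1, i, z'⟩ ∈ cs) ∧
      (∀ c ∈ cs, c.par = i ∧ ((c.tag = n ∧ c.X ⊆ X) ∨
          ∃ z ∈ X, c.tag = z ∧ c.X ⊆ (X \ nbhd G z).erase z)) ∧
      (cs.map fun c => treeSize n c.X.card c.r).sum ≤ treeSize n (X.card - 1) r +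
        (X.filter fun x => x.val < z + 1).card * (2 * treeSize n (X.card - 1) (r - 1)))
      ?_ (by omega) ?_
    · refine RunsTo.block (by simp) ?_
      simp only [List.foldl_cons, List.foldl_nil]
      generalize hr : (Instr.load 17 17).run _ = t1
      have p1 : ∀ r < 17, t1.reg r = t.reg r := by
        intro r hr'
        simp [← hr, Instr.run, show r ≠ 17 by omega]
      have p2 : t1.mem = t.mem := by simp [← hr, Instr.run]
      have p3 : t1.wt = t.wt := by simp [← hr, Instr.run]
      have p4 : t1.reg 17 = if (⟨z, hz⟩ : Fin n) ∈ X then 1 else 0 := by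
        simp [← hr, Instr.run, q1, e2]
      clear hr
      have hq := q4.frame (s' := t1) (fun r hr => p1 r (by omega)) (fun x _ => by rw [p2]) p3
      have r16 : t1.reg 16 = z := by rw [p1 16 (by omega), q1]
      have r11 : t1.reg 11 = r - 1 := by rw [p1 11 (by omega), q3]
      have r15 : t1.reg 15 = z * n := by rw [p1 15 (by omega), q2]
      refine RunsTo.cond (by simp) ?_ ?_
      · intro hb
        have hzX : (⟨z, hz⟩ : Fin n) ∈ X := by
          simp only [Test.Holds, p4, hq.r1] at hb
          by_contra h
          rw [if_neg h] at hb
          omega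
        have hrow := row_le (⟨z, hz⟩ : Fin n)
        simp only at hrow
        refine RunsTo.seq (runsTo_childProg hq hi' (c := 3) (k := 16) (q := 11) (t := 0)
          (by omega) (by omega) (by omega) (by omega)
          (by omega) (by omega) (by rw [hq.r3]; exact hq.zero)
          (by rw [hq.r3]; have := hlen cs; omega)
          (by rw [r16]; omega)) (by simp; omega) ?_
        rintro s2 ⟨m1, -, m2⟩
        rw [hget', hX, r11, r16, hq.r0, Finset.sdiff_empty] at m1
        rw [show X.filter (fun u => u.val ≠ z) = X.erase ⟨z, hz⟩ from filter_val_ne X ⟨z, hz⟩,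
          List.append_assoc] at m1
        obtain ⟨hi2, hget2⟩ := hget (cs ++ [⟨X.erase ⟨z, hz⟩, r - 1, i, n⟩])
        have t16 : s2.reg 16 = z := by rw [m2 16 (by omega) (by omega) (by omega), r16]
        have t11 : s2.reg 11 = r - 1 := by rw [m2 11 (by omega) (by omega) (by omega), r11]
        have t15 : s2.reg 15 = z * n := by rw [m2 15 (by omega) (by omega) (by omega), r15]
        refine (runsTo_childProg m1 hi2 (c := 15) (k := 16) (q := 11) (t := 16)
          (by omega) (by omega) (by omega) (by omega)
          (by omega) (by omega) (by rw [t15]; exact m1.adj ⟨z, hz⟩)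
          (by rw [t15]; have := hlen (cs ++ [⟨X.erase ⟨z, hz⟩, r - 1, i, n⟩]); omega)
          (by rw [t16]; omega)).mono (by simp; omega) ?_
        rintro s3 ⟨k1, -, k2⟩
        rw [hget2, hX, t11, t16] at k1
        rw [show (X \ nbhd G ⟨z, hz⟩).filter (fun u => u.val ≠ z) =
          (X \ nbhd G ⟨z, hz⟩).erase ⟨z, hz⟩ from filter_val_ne _ ⟨z, hz⟩, List.append_assoc] at k1
        refine ⟨by rw [k2 16 (by omega) (by omega) (by omega), t16],
          by rw [k2 15 (by omega) (by omega) (by omega), t15],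
          by rw [k2 11 (by omega) (by omega) (by omega), t11], _, k1, ?_, ?_, ?_, ?_⟩
        · exact List.mem_append_left _ (List.mem_append_left _ q5)
        · intro z' hz' hlt
          rcases Nat.lt_succ_iff_lt_or_eq.1 hlt with h | h
          · have := q6 z' hz' h
            exact ⟨List.mem_append_left _ (List.mem_append_left _ this.1),
              List.mem_append_left _ (List.mem_append_left _ this.2)⟩
          · obtain rfl : z' = ⟨z, hz⟩ := Fin.ext h
            simp
        · intro c hc
          rw [List.mem_append, List.mem_append, List.mem_singleton, List.mem_singleton] at hc
          rcases hc with (hc | rfl) | rfl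
          · exact q7 c hc
          · exact ⟨rfl, Or.inl ⟨rfl, Finset.erase_subset _ _⟩⟩
          · exact ⟨rfl, Or.inr ⟨⟨z, hz⟩, hzX, rfl, subset_rfl⟩⟩
        · have hf : (X.filter fun x => x.val < z + 1) =
              insert ⟨z, hz⟩ (X.filter fun x => x.val < z) := by
            ext y
            simp only [Finset.mem_filter, Finset.mem_insert, Fin.ext_iff]
            constructor
            · rintro ⟨k1, k2⟩
              by_cases k : y.val = z
              · exact Or.inl k
              · exact Or.inr ⟨k1, by omega⟩
            · rintro (k | ⟨k1, k2⟩)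
              · rw [show y = ⟨z, hz⟩ from Fin.ext k]
                exact ⟨hzX, by simp⟩
              · exact ⟨k1, by omega⟩
          have h3 : (X.erase ⟨z, hz⟩).card = X.card - 1 := Finset.card_erase_of_mem hzX
          have h4 : ((X \ nbhd G ⟨z, hz⟩).erase ⟨z, hz⟩).card ≤ X.card - 1 := by
            rw [← h3]
            exact Finset.card_le_card (Finset.erase_subset_erase _ Finset.sdiff_subset)
          have h5 := treeSize_mono (n := n) h4 (r - 1)
          rw [hf, Finset.card_insert_of_notMem (by simp), Nat.add_mul]
          simp only [List.map_append, List.sum_append, List.map_cons, List.map_nil,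
            List.sum_cons, List.sum_nil, h3]
          omega
      · intro hb
        have hzX : (⟨z, hz⟩ : Fin n) ∉ X := by
          intro h
          simp only [Test.Holds, p4, hq.r1, if_pos h] at hb
          exact hb trivial
        have hne : ∀ u ∈ X, u.val ≠ z := by
          intro u hu h
          rw [show u = ⟨z, hz⟩ from Fin.ext h] at hu
          exact hzX hu
        have hf : (X.filter fun x => x.val < z + 1) = X.filter fun x => x.val < z := by
          refine Finset.filter_congr fun y hy => ?_
          have := hne y hy
          omega
        refine RunsTo.instr (by simp) ⟨?_, ?_, ?_, cs, ?_, q5, ?_, q7, ?_⟩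
        · simp [Instr.run, r16]
        · simp [Instr.run, r15]
        · simp [Instr.run, r11]
        · refine hq.frame (fun r hr => ?_) (fun x _ => rfl) rfl
          simp [Instr.run, show r ≠ 20 by omega]
        · intro z' hz' hlt
          have := hne z' hz'
          exact q6 z' hz' (by omega)
        · rw [hf]; exact q8
    · rintro t'' ⟨k1, k2, k3, cs', k4, k5⟩
      refine RunsTo.instr (by omega) ⟨?_, ?_, ?_, cs', ?_, k5⟩
      · simp [Instr.run, k1, k4.r1]
      · simp [Instr.run, k2, k4.r0, Nat.succ_mul]
      · simp [Instr.run, k3]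
      · refine k4.frame (fun r hr => ?_) (fun x _ => rfl) rfl
        simp [Instr.run, show r ≠ 15 by omega, show r ≠ 16 by omega]
  · rintro t ⟨q1, q2, q3, cs, q4, q5, q6, q7, q8⟩
    refine ⟨cs, .branch cs u v hu hv hr0 hconn hdeg q5 (fun z hz => q6 z hz z.isLt) q7 ?_, q4⟩
    rw [Finset.filter_true_of_mem fun x _ => x.isLt] at q8
    have := treeSize_branch hXn (r - 1) (Finset.card_ne_zero.2 ⟨u, hu⟩)
    rw [Nat.sub_add_cancel (Nat.pos_of_ne_zero hr0)] at this
    omega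
  · have : n * (36 * n + 34 + 2) = 36 * (n * n) + 36 * n := by ring
    omega

/-- Appends the two children of a disconnected subproblem. -/
def splitProg : Program :=
  block [.add 11 0 1, .add 12 7 2] <| .seq (childProg 4 0 10 11) (childProg 12 0 10 11)

/-- Children arise only by subtracting from X. The first one is X \ D, and the second one, D, is X
minus the set of the first child, whose address is saved in register 12. Naming n as the deleted
vertex deletes nothing. -/
theorem runsTo_splitProg {n : ℕ} {G : SimpleGraph (Fin n)} {w : Fin n → ℚ}
    {L : List (Node n)} {i : ℕ} {s : State} (hs : Queue G w L i s) (hi : i < L.length)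
    {u : Fin n} (hu : u ∈ L[i].X) (hr : s.reg 10 = L[i].r) {D : Finset (Fin n)}
    (hD : Holds s.mem (n * n + n) D) (hDr : ReachedFrom G L[i].X u D) (hDne : D.Nonempty)
    (hcl : ∀ a ∈ L[i].X \ D, ∀ b ∈ D, ¬ G.Adj a b) :
    RunsTo splitProg s (36 * n + 32) fun s' => ∃ cs,
      Expands G i L[i].X L[i].r cs ∧ Queue G w (L ++ cs) i s' := by
  have hsub := hDr.1
  have huD := hDr.2.1
  refine RunsTo.block (by simp) ?_
  simp only [List.foldl_cons, List.foldl_nil, List.length_cons, List.length_nil]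
  generalize h1 : (Instr.add 12 7 2).run _ = s1
  have p0 : ∀ r < 11, s1.reg r = s.reg r := fun r hr => by
    simp [← h1, Instr.run, show r ≠ 11 by omega, show r ≠ 12 by omega]
  have p1 : s1.mem = s.mem := by simp [← h1, Instr.run]
  have p2 : s1.wt = s.wt := by simp [← h1, Instr.run]
  have p3 : s1.reg 11 = n + 1 := by simp [← h1, Instr.run, hs.r0, hs.r1]
  have p4 : s1.reg 12 = addr n L.length := by simp [← h1, Instr.run, hs.r7, hs.r2]
  clear h1
  have hq := hs.frame (s' := s1) (fun r hr => p0 r (by omega)) (fun x _ => by rw [p1]) p2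
  have hlen := le_addr n L.length
  refine RunsTo.seq (runsTo_childProg hq hi (c := 4) (k := 0) (q := 10) (t := 11) (by omega)
    (by omega) (by omega) (by omega) (by omega) (by omega) (by rw [hq.r4, p1]; exact hD)
    (by rw [hq.r4]; omega) (by rw [hq.r0])) (by omega) ?_
  rintro s2 ⟨m1, -, m2⟩
  rw [hq.r0, p0 10 (by omega), hr, p3, filter_val_ne_self] at m1
  have e : (L ++ [(⟨L[i].X \ D, L[i].r, i, n + 1⟩ : Node n)]).length = L.length + 1 := by simp
  have hi2 : i < (L ++ [(⟨L[i].X \ D, L[i].r, i, n + 1⟩ : Node n)]).length := by omega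
  have hB := (m1.recs L.length (by omega)).X
  rw [List.getElem_concat_length rfl] at hB
  have t12 : s2.reg 12 = addr n L.length := by rw [m2 12 (by omega) (by omega) (by omega), p4]
  refine (runsTo_childProg m1 hi2 (c := 12) (k := 0) (q := 10) (t := 11) (by omega)
    (by omega) (by omega) (by omega) (by omega) (by omega) (by rw [t12]; exact hB)
    (by rw [t12, e, addr_succ]; omega) (by rw [m1.r0])).mono (by omega) ?_
  rintro s3 ⟨k1, -, -⟩
  rw [m1.r0, m2 10 (by omega) (by omega) (by omega), p0 10 (by omega), hr,
    m2 11 (by omega) (by omega) (by omega), p3, filter_val_ne_self, List.append_assoc] at k1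
  rw [List.getElem_append_left hi] at k1
  refine ⟨_, Expands.split (G := G) (i := i) (X := L[i].X) (r := L[i].r) (L[i].X \ D)
    Finset.sdiff_subset ⟨u, Finset.mem_sdiff.2 ⟨hu, huD⟩⟩ ?_ ?_, k1⟩
  · rwa [Finset.sdiff_sdiff_eq_self hsub]
  · rwa [Finset.sdiff_sdiff_eq_self hsub]

/-- Appends the children of the current subproblem. -/
def expandProg : Program :=
  .seq (scanProg 6) <| .cond (.eq 20 2) (.instr (.const 20 0)) <|
    block [.add 10 0 0, .add 10 10 6, .load 10 10] <| .cond (.eq 10 2) (.instr (.const 20 0)) <|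
      block [.add 12 21 2] <| .seq (diffProg 6 4 3) <| block [.add 13 4 12, .store 13 2] <|
        .seq componentProg <| .seq (scanProg 4) <|
          .cond (.eq 20 2) (.seq maxDegreeProg branchProg) splitProg

theorem runsTo_expandProg {n : ℕ} {G : SimpleGraph (Fin n)} {w : Fin n → ℚ}
    {L : List (Node n)} {i : ℕ} {s : State} (hs : Queue G w L i s) (hi : i < L.length) :
    RunsTo expandProg s (130 * (n + 1) ^ 3) fun s' => ∃ cs,
      Expands G i L[i].X L[i].r cs ∧ Queue G w (L ++ cs) i s' := by
  have hN : 26 * (n + 1) ^ 3 + 53 * (n * n) + 115 * n + 100 ≤ 130 * (n + 1) ^ 3 := by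
    nlinarith [Nat.zero_le (n ^ 3), Nat.zero_le (n ^ 2)]
  generalize 130 * (n + 1) ^ 3 = T at *
  have hN3 : 26 * (n + 1) ^ 3 ≤ T - 0 := by omega
  generalize hN4 : 26 * (n + 1) ^ 3 = N at *
  have hrec := hs.recs i hi
  refine RunsTo.seq (hs.runsTo_scan (a := 6) (by omega) (by rw [hs.r6]; exact hrec.X)) (by omega) ?_
  rintro s1 ⟨h1, h2, h3, h4, h5⟩
  refine RunsTo.cond (by omega) ?_ ?_
  · intro hb
    simp only [Test.Holds, h2, h1.r2, Finset.card_eq_zero] at hb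
    refine RunsTo.instr (by omega) ⟨[], .leaf (Or.inl hb), ?_⟩
    rw [List.append_nil]
    refine h1.frame (fun r hr => ?_) (fun x _ => rfl) rfl
    simp [Instr.run, show r ≠ 20 by omega]
  · intro hb
    simp only [Test.Holds, h2, h1.r2, Finset.card_eq_zero] at hb
    obtain ⟨u, hu, hu21⟩ : ∃ u ∈ L[i].X, s1.reg 21 = u.val := by
      rcases h3 with h3 | h3
      · exact absurd h3.1 hb
      · exact h3
    refine RunsTo.block (by simp; omega) ?_
    simp only [List.foldl_cons, List.foldl_nil, List.length_cons, List.length_nil]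
    generalize hr : (Instr.load 10 10).run _ = t
    have p1 : ∀ r, r ≠ 10 → t.reg r = s1.reg r := fun r hr' => by simp [← hr, Instr.run, hr']
    have p2 : t.mem = s1.mem := by simp [← hr, Instr.run]
    have p3 : t.wt = s1.wt := by simp [← hr, Instr.run]
    have p4 : t.reg 10 = L[i].r := by
      have e : n + n + addr n i = addr n i + 2 * n := by ring
      simp [← hr, Instr.run, h1.r0, h1.r6, e, (h1.recs i hi).r]
    clear hr
    have hq := h1.frame (s' := t) (fun r hr => p1 r (by omega)) (fun x _ => by rw [p2]) p3
    refine RunsTo.cond (by omega) ?_ ?_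
    · intro hb
      simp only [Test.Holds, p4, hq.r2] at hb
      refine RunsTo.instr (by omega) ⟨[], .leaf (Or.inr hb), ?_⟩
      rw [List.append_nil]
      refine hq.frame (fun r hr => ?_) (fun x _ => rfl) rfl
      simp [Instr.run, show r ≠ 20 by omega]
    · intro hb
      simp only [Test.Holds, p4, hq.r2] at hb
      refine RunsTo.block (by simp; omega) ?_
      simp only [List.foldl_cons, List.foldl_nil, List.length_cons, List.length_nil]
      generalize hr : (Instr.add 12 21 2).run _ = t2
      have k1 : ∀ r, r ≠ 12 → t2.reg r = t.reg r := fun r hr' => by simp [← hr, Instr.run, hr']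
      have k2 : t2.mem = t.mem := by simp [← hr, Instr.run]
      have k3 : t2.wt = t.wt := by simp [← hr, Instr.run]
      have k4 : t2.reg 12 = u.val := by simp [← hr, Instr.run, hq.r2, p1, hu21]
      clear hr
      have hq2 := hq.frame (s' := t2) (fun r hr => k1 r (by omega)) (fun x _ => by rw [k2]) k3
      refine RunsTo.seq (hq2.runsTo_diff (a := 6) (c := 3) (by omega) (by omega)
        (by rw [hq2.r6]; exact (hq2.recs i hi).X) (by rw [hq2.r3]; exact hq2.zero)
        (Or.inr (Or.inr (by rw [hq2.r6]; exact le_addr _ _))) (Or.inl (by rw [hq2.r3])))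
        (by omega) ?_
      rintro t3 ⟨m1, m2, m3⟩
      rw [Finset.sdiff_empty] at m2
      have m12 : t3.reg 12 = u.val := by rw [m3 12 (by omega), k4]
      have m10 : t3.reg 10 = L[i].r := by rw [m3 10 (by omega), k1 10 (by omega), p4]
      refine RunsTo.block (by simp; omega) ?_
      simp only [List.foldl_cons, List.foldl_nil, List.length_cons, List.length_nil]
      generalize hr : (Instr.store 13 2).run _ = t4
      have f1 : ∀ r, r ≠ 13 → t4.reg r = t3.reg r := fun r hr' => by simp [← hr, Instr.run, hr']
      have f2 : t4.mem = Function.update t3.mem (n * n + n + u) 0 := by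
        simp [← hr, Instr.run, m1.r4, m12, m1.r2]
      have f3 : t4.wt = t3.wt := by simp [← hr, Instr.run]
      clear hr
      have hq4 := m1.frame (s' := t4) (fun r hr => f1 r (by omega)) (fun x hx => by
        rw [f2, Function.update_of_ne (by omega)]) f3
      have hD4 : Holds t4.mem (n * n + n) (L[i].X.erase u) := by
        intro z
        rw [f2]
        by_cases hz : z = u
        · subst hz; simp
        · rw [Function.update_of_ne (fun h => hz (Fin.ext (by omega))), m2 z]
          simp [hz]
      refine RunsTo.seq (runsTo_componentProg hq4 hi hu hD4) (by rw [hN4]; omega) ?_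
      rintro t5 ⟨g1, g2, D, g3, g4, g5⟩
      rw [hN4]
      refine RunsTo.seq (g1.runsTo_scan (a := 4) (by omega) (by rw [g1.r4]; exact g3)) (by omega) ?_
      rintro t6 ⟨q1, q2, -, q3, q4⟩
      have q10 : t6.reg 10 = L[i].r := by
        rw [q4 10 (by omega), g2, f1 10 (by omega), m10]
      refine RunsTo.cond (by omega) ?_ ?_
      · intro hb'
        simp only [Test.Holds, q2, q1.r2, Finset.card_eq_zero] at hb'
        refine RunsTo.seq (runsTo_maxDegreeProg q1 hi ⟨u, hu⟩) (by omega) ?_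
        rintro t7 ⟨a1, a2, v, a3, a4, a5⟩
        refine (runsTo_branchProg a1 hi hu a3 (by rw [a2, q10]) hb a4 ?_ a5).mono (by omega)
          fun _ h => h
        -- Here D = ∅, so the part reached from u is all of X: the subproblem is connected.
        intro Y hY huY
        have := g4.2.2 Y hY huY
        rwa [hb', Finset.sdiff_empty] at this
      · intro hb'
        simp only [Test.Holds, q2, q1.r2, Finset.card_eq_zero] at hb'
        exact (runsTo_splitProg q1 hi hu q10 (by rw [q3]; exact g3) g4
          (Finset.nonempty_iff_ne_empty.2 hb') g5).mono (by omega) fun _ h => h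

/-! ### First pass: building the queue -/

/-- The queue `root :: T` is a tree, in which the first `i` subproblems have been expanded. -/
structure IsTree {n : ℕ} (G : SimpleGraph (Fin n)) (root : Node n) (T : List (Node n)) (i : ℕ) :
    Prop where
  par : ∀ l (h : l < T.length), T[l].par ≤ l ∧ T[l].par < i
  expands : ∀ j (h : j < (root :: T).length), j < i →
    Expands G j (root :: T)[j].X (root :: T)[j].r (T.filter fun c => c.par = j)

/-- T omits the root, so T[l] has index l + 1 and its parent has a smaller index. Before this step
no entry has parent i, and all new entries do; hence the child lists of earlier subproblems do not
change. -/
theorem IsTree.append {n : ℕ} {G : SimpleGraph (Fin n)} {root : Node n} {T cs : List (Node n)}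
    {i : ℕ} (h : IsTree G root T i) (hi : i < (root :: T).length)
    (hcs : Expands G i (root :: T)[i].X (root :: T)[i].r cs) : IsTree G root (T ++ cs) (i + 1) := by
  have hpar := hcs.par_eq
  rw [List.length_cons] at hi
  constructor
  · intro l hl
    by_cases hlT : l < T.length
    · rw [List.getElem_append_left hlT]
      have := h.par l hlT
      omega
    · rw [List.getElem_append_right (by omega), hpar _ (List.getElem_mem _)]
      omega
  · intro j hj hji
    have hjT : j < (root :: T).length := by rw [List.length_cons]; omega
    have e : (root :: (T ++ cs))[j] = (root :: T)[j] := by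
      simp only [← List.cons_append]
      exact List.getElem_append_left hjT
    rw [e, List.filter_append]
    rcases Nat.lt_succ_iff_lt_or_eq.1 hji with hji | rfl
    · rw [(List.filter_eq_nil_iff (l := cs)).2 fun c hc => by simp [hpar c hc, hji.ne'], List.append_nil]
      exact h.expands j hjT hji
    · rw [(List.filter_eq_nil_iff (l := T)).2 fun c hc => by
        obtain ⟨l, hl, rfl⟩ := List.mem_iff_getElem.1 hc
        simpa using (h.par l hl).2.ne, List.filter_eq_self.2 fun c hc => by simp [hpar c hc],
        List.nil_append]
      exact hcs

/-- Expands all subproblems. -/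
def queueProg : Program := .loop (.lt 6 7) (.seq expandProg (.instr (.add 6 6 5)))

/-- The number of expanded subproblems plus the sum of `treeSize` over the pending ones never
increases, by `Expands.sum_le`. Its initial value M therefore bounds both the number of rounds and
the final length of the queue. -/
theorem runsTo_queueProg {n : ℕ} {G : SimpleGraph (Fin n)} {w : Fin n → ℚ} {root : Node n}
    {s : State} (hs : Queue G w [root] 0 s) :
    RunsTo queueProg s (treeSize n root.X.card root.r * (130 * (n + 1) ^ 3 + 2) + 1) fun s' =>
      ∃ T, Queue G w (root :: T) (root :: T).length s' ∧
        IsTree G root T (root :: T).length ∧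
        (root :: T).length ≤ treeSize n root.X.card root.r := by
  set M := treeSize n root.X.card root.r
  refine (RunsTo.loop (k := M) (T := 130 * (n + 1) ^ 3 + 1) (fun k t => ∃ i T, Queue G w (root :: T) i t ∧
    IsTree G root T i ∧ i ≤ (root :: T).length ∧
    i + (((root :: T).drop i).map fun c => treeSize n c.X.card c.r).sum ≤ M ∧ k = M - i) ?_
    ⟨0, [], hs, ⟨by simp, by simp⟩, by simp, by simp [M], by simp⟩).mono (by simp) ?_
  · rintro k t ⟨i, T, h1, h2, h3, h4, rfl⟩ hb
    simp only [Test.Holds, h1.r6, h1.r7] at hb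
    have hi : i < (root :: T).length := by
      by_contra! h
      have := addr_mono (n := n) h
      omega
    have hd : (root :: T).drop i = (root :: T)[i] :: (root :: T).drop (i + 1) :=
      List.drop_eq_getElem_cons hi
    rw [hd, List.map_cons, List.sum_cons] at h4
    refine RunsTo.seq (runsTo_expandProg h1 hi) (by omega) ?_
    rintro t' ⟨cs, k1, k2⟩
    have k3 := k1.sum_le
    refine RunsTo.instr (by omega) ⟨M - (i + 1), by omega, i + 1, T ++ cs, ?_, h2.append hi k1, ?_,
      ?_, rfl⟩
    · have hr : ∀ r, r ≠ 6 → ((Instr.add 6 6 5).run t').reg r = t'.reg r := fun r hr => by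
        simp [Instr.run, hr]
      rw [List.cons_append] at k2
      refine ⟨?_, ?_, ?_, ?_, ?_, ?_, ?_, ?_, k2.adj, k2.zero, k2.recs, k2.weights, k2.wzero⟩
      · rw [hr 0 (by omega), k2.r0]
      · rw [hr 1 (by omega), k2.r1]
      · rw [hr 2 (by omega), k2.r2]
      · rw [hr 3 (by omega), k2.r3]
      · rw [hr 4 (by omega), k2.r4]
      · rw [hr 5 (by omega), k2.r5]
      · simp [Instr.run, k2.r6, k2.r5, addr_succ]
      · rw [hr 7 (by omega), k2.r7]
    · rw [List.length_cons, List.length_append]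
      rw [List.length_cons] at hi
      omega
    · rw [← List.cons_append, List.drop_append_of_le_length (by omega), List.map_append,
        List.sum_append]
      omega
  · rintro t ⟨⟨k, i, T, h1, h2, h3, h4, -⟩, hb⟩
    simp only [Test.Holds, h1.r6, h1.r7] at hb
    obtain rfl : i = (root :: T).length := by
      by_contra h
      have := addr_add_le (n := n) (lt_of_le_of_ne h3 h)
      omega
    exact ⟨T, h1, h2, by omega⟩

/-! ### Second pass: handing solutions to the parents -/

/-- The state of the machine while solutions are being passed on; `R j` is the partial solution of
the subproblem with index `j`, and the subproblems with an index larger than `i` are done. -/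
structure Push {n : ℕ} (w : Fin n → ℚ) (L : List (Node n)) (i : ℕ) (R : ℕ → Finset (Fin n))
    (s : State) : Prop where
  r0 : s.reg 0 = n
  r1 : s.reg 1 = 1
  r2 : s.reg 2 = 0
  r3 : s.reg 3 = n * n
  r4 : s.reg 4 = n * n + n
  r5 : s.reg 5 = 2 * n + 3
  r6 : s.reg 6 = addr n i
  r8 : s.reg 8 = addr n 0
  zero : Holds (n := n) s.mem (n * n) ∅
  recs : ∀ j ≤ i, ∀ h : j < L.length, Record s.mem (addr n j) L[j] (R j)
  weights : ∀ v : Fin n, s.wt v = w v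
  sums : ∀ j ≤ i, s.wt (addr n j) = ∑ v ∈ R j, w v

/-- Only what lies below the record i + 1 has to survive: that record is not read again and may be
spoiled. -/
theorem Push.update {n : ℕ} {w : Fin n → ℚ} {L : List (Node n)} {i p : ℕ} {R : ℕ → Finset (Fin n)}
    {s s' : State} (h : Push w L (i + 1) R s) {S : Finset (Fin n)} (hp : p ≤ i)
    (hr : ∀ r < 9, s'.reg r = s.reg r)
    (hm : ∀ x < addr n (i + 1), x < n * n + n ∨ n * n + 2 * n ≤ x →
      x < addr n p + n ∨ addr n p + 2 * n ≤ x → s'.mem x = s.mem x)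
    (hS : Holds s'.mem (addr n p + n) S)
    (hw : ∀ x < addr n (i + 1), x ≠ addr n p → s'.wt x = s.wt x)
    (hwS : s'.wt (addr n p) = ∑ v ∈ S, w v) :
    Push w L i (Function.update R p S) ((Instr.sub 6 6 5).run s') := by
  have hr' : ∀ r < 9, r ≠ 6 → ((Instr.sub 6 6 5).run s').reg r = s.reg r := fun r h1 h2 => by
    simp [Instr.run, h2, hr r h1]
  have hpi := addr_add_le (n := n) (show p < i + 1 by omega)
  have hlep := le_addr n p
  refine ⟨?_, ?_, ?_, ?_, ?_, ?_, ?_, ?_, ?_, ?_, ?_, ?_⟩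
  · rw [hr' 0 (by omega) (by omega), h.r0]
  · rw [hr' 1 (by omega) (by omega), h.r1]
  · rw [hr' 2 (by omega) (by omega), h.r2]
  · rw [hr' 3 (by omega) (by omega), h.r3]
  · rw [hr' 4 (by omega) (by omega), h.r4]
  · rw [hr' 5 (by omega) (by omega), h.r5]
  · simp [Instr.run, hr, h.r6, h.r5, addr_succ]
  · rw [hr' 8 (by omega) (by omega), h.r8]
  · exact h.zero.congr fun x h1 h2 => hm x (by omega) (by omega) (by omega)
  · intro j hj hjL
    have hji := addr_add_le (n := n) (show j < i + 1 by omega)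
    have hlej := le_addr n j
    have hrec := h.recs j (by omega) hjL
    by_cases hjp : j = p
    · subst hjp
      rw [Function.update_self]
      exact ⟨hrec.X.congr fun x h1 h2 => hm x (by omega) (by omega) (by omega), hS,
        (hm _ (by omega) (by omega) (by omega)).trans hrec.r,
        (hm _ (by omega) (by omega) (by omega)).trans hrec.par,
        (hm _ (by omega) (by omega) (by omega)).trans hrec.tag⟩
    · rw [Function.update_of_ne hjp]
      refine hrec.congr fun x h1 h2 => hm x (by omega) (by omega) ?_
      rcases lt_or_gt_of_ne hjp with h | h <;> have := addr_add_le (n := n) h <;> omega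
  · intro v
    refine (hw _ (by omega) (by omega)).trans (h.weights v)
  · intro j hj
    have hji := addr_add_le (n := n) (show j < i + 1 by omega)
    by_cases hjp : j = p
    · subst hjp
      rw [Function.update_self]; exact hwS
    · rw [Function.update_of_ne hjp, ← h.sums j (by omega)]
      refine hw _ (by omega) ?_
      rcases lt_or_gt_of_ne hjp with h | h <;> have := addr_add_le (n := n) h <;> omega

/-- The solution that a subproblem with the given tag and solution passes on. -/
def candidate {n : ℕ} (tag : ℕ) (R : Finset (Fin n)) : Finset (Fin n) :=
  if h : tag < n then insert ⟨tag, h⟩ R else R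

/-- Passes on the solution of the current subproblem. -/
def pushStepProg : Program :=
  block [.add 10 0 0, .add 10 10 1, .add 10 10 6, .load 11 10, .add 10 10 1, .load 12 10,
      .add 13 6 0, .add 14 11 0] <|
    .cond (.lt 0 12)
      (.seq (diffProg 8 4 14) <| .seq (diffProg 4 4 13) <| .seq (diffProg 8 14 4) <|
        .instr (.wadd 11 11 6))
      (.seq (.cond (.lt 12 0) (block [.add 15 13 12, .store 15 1] (.instr (.wadd 6 6 12)))
          (.instr (.const 20 0))) <|
        .cond (.wlt 11 6) (.seq (diffProg 13 14 3) (.instr (.wcopy 11 6))) (.instr (.const 20 0)))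

/-- The last two hypotheses make the weights additive: a union is disjoint and the vertex of the tag
is new. The union is formed as univ \ ((univ \ R p) \ R (i+1)), p being the parent, with univ read
from the record of the root. -/
theorem runsTo_pushStepProg {n : ℕ} {w : Fin n → ℚ} {L : List (Node n)} {i : ℕ}
    {R : ℕ → Finset (Fin n)} {s : State} (hs : Push w L (i + 1) R s) (hi : i + 1 < L.length)
    (hroot : ∀ h : 0 < L.length, L[0].X = Finset.univ) (hp : L[i + 1].par ≤ i)
    (hsum : n < L[i + 1].tag → Disjoint (R L[i + 1].par) (R (i + 1)))
    (hmax : ∀ h : L[i + 1].tag < n, (⟨_, h⟩ : Fin n) ∉ R (i + 1)) :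
    RunsTo (.seq pushStepProg (.instr (.sub 6 6 5))) s (27 * n + 20) fun s' => ∃ S,
      Push w L i (Function.update R L[i + 1].par S) s' ∧
      (n < L[i + 1].tag → S = R L[i + 1].par ∪ R (i + 1)) ∧
      (L[i + 1].tag ≤ n →
        (S = candidate L[i + 1].tag (R (i + 1)) ∨ S = R L[i + 1].par) ∧
        ∑ v ∈ candidate L[i + 1].tag (R (i + 1)), w v ≤ ∑ v ∈ S, w v ∧
        ∑ v ∈ R L[i + 1].par, w v ≤ ∑ v ∈ S, w v) := by
  have hrec := hs.recs (i + 1) le_rfl hi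
  obtain ⟨_, hrecp⟩ : ∃ nd, Record s.mem (addr n L[i + 1].par) nd (R L[i + 1].par) :=
    ⟨_, hs.recs L[i + 1].par (by omega) (by omega)⟩
  have hsp := hs.sums L[i + 1].par (by omega)
  have hsi := hs.sums (i + 1) le_rfl
  have hunivX := (hs.recs 0 (by omega) (by omega)).X
  rw [hroot] at hunivX
  generalize hpp : L[i + 1].par = p at *
  generalize htag : L[i + 1].tag = tag at *
  have hpi := addr_add_le (n := n) (show p < i + 1 by omega)
  have hlep := le_addr n p
  have hlei := le_addr n (i + 1)
  have h0p := addr_mono (n := n) (Nat.zero_le p)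
  have hbase : addr n 0 = n * n + 2 * n := by simp [addr]
  refine RunsTo.seq (T1 := 27 * n + 19) (R := fun s' => ∃ S,
      Push w L i (Function.update R p S) ((Instr.sub 6 6 5).run s') ∧
      (n < tag → S = R p ∪ R (i + 1)) ∧
      (tag ≤ n → (S = candidate tag (R (i + 1)) ∨ S = R p) ∧
        ∑ v ∈ candidate tag (R (i + 1)), w v ≤ ∑ v ∈ S, w v ∧
        ∑ v ∈ R p, w v ≤ ∑ v ∈ S, w v)) ?_ (by omega) fun s' h => RunsTo.instr (by omega) h
  refine RunsTo.block (by simp) ?_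
  simp only [List.foldl_cons, List.foldl_nil, List.length_cons, List.length_nil]
  generalize hr : (Instr.add 14 11 0).run _ = t
  have e : n + n + 1 + addr n (i + 1) = addr n (i + 1) + 2 * n + 1 := by ring
  have hpar := hrec.par
  rw [hpp] at hpar
  have htag' : s.mem (addr n (i + 1) + 2 * n + 1 + 1) = tag := by rw [← htag, ← hrec.tag]
  have p1 : ∀ r < 9, t.reg r = s.reg r := fun r hr' => by
    simp [← hr, Instr.run, show r ≠ 10 by omega, show r ≠ 11 by omega, show r ≠ 12 by omega,
      show r ≠ 13 by omega, show r ≠ 14 by omega]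
  have p2 : t.mem = s.mem := by simp [← hr, Instr.run]
  have p3 : t.wt = s.wt := by simp [← hr, Instr.run]
  have p11 : t.reg 11 = addr n p := by
    simp [← hr, Instr.run, hs.r0, hs.r1, hs.r6, e, hpar]
  have p12 : t.reg 12 = tag := by
    simp [← hr, Instr.run, hs.r0, hs.r1, hs.r6, e, htag']
  have p13 : t.reg 13 = addr n (i + 1) + n := by
    simp [← hr, Instr.run, hs.r0, hs.r6]
  have p14 : t.reg 14 = addr n p + n := by
    simp [← hr, Instr.run, hs.r0, hs.r1, hs.r6, e, hpar]
  clear hr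
  have t0 : t.reg 0 = n := by rw [p1 0 (by omega), hs.r0]
  have t1 : t.reg 1 = 1 := by rw [p1 1 (by omega), hs.r1]
  have t3 : t.reg 3 = n * n := by rw [p1 3 (by omega), hs.r3]
  have t4 : t.reg 4 = n * n + n := by rw [p1 4 (by omega), hs.r4]
  have t6 : t.reg 6 = addr n (i + 1) := by rw [p1 6 (by omega), hs.r6]
  have t8 : t.reg 8 = addr n 0 := by rw [p1 8 (by omega), hs.r8]
  refine RunsTo.cond (by omega) ?_ ?_
  · intro hb
    simp only [Test.Holds, t0, p12] at hb
    refine RunsTo.seq (runsTo_diffProg (n := n) (a := 8) (b := 4) (c := 14) (A := Finset.univ)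
      (B := R p) (by omega) (by omega) (by omega) t0 t1 (by rw [t8, p2]; exact hunivX)
      (by rw [p14, p2]; exact hrecp.sol) (by omega) (by omega)) (by omega) ?_
    rintro a ⟨a1, a2, a3, a4⟩
    rw [t4] at a1 a2
    refine RunsTo.seq (runsTo_diffProg (n := n) (a := 4) (b := 4) (c := 13)
      (A := Finset.univ \ R p) (B := R (i + 1)) (by omega) (by omega) (by omega)
      (by rw [a4 0 (by omega), t0]) (by rw [a4 1 (by omega), t1])
      (by rw [a4 4 (by omega), t4]; exact a1)
      (by
        rw [a4 13 (by omega), p13]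
        exact (p2 ▸ hrec.sol : Holds t.mem _ _).congr fun x _ _ => a2 x (by omega))
      (by omega) (by rw [a4 13 (by omega), a4 4 (by omega)]; omega)) (by omega) ?_
    rintro b ⟨b1, b2, b3, b4⟩
    rw [a4 4 (by omega), t4] at b1 b2
    have hb4 : ∀ r < 20, b.reg r = t.reg r := fun r hr => by rw [b4 r hr, a4 r hr]
    have hb2 : ∀ x, x < n * n + n ∨ n * n + n + n ≤ x → b.mem x = s.mem x := fun x hx => by
      rw [b2 x hx, a2 x hx, p2]
    refine RunsTo.seq (runsTo_diffProg (n := n) (a := 8) (b := 14) (c := 4)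
      (A := Finset.univ) (B := (Finset.univ \ R p) \ R (i + 1)) (by omega) (by omega) (by omega)
      (by rw [hb4 0 (by omega), t0]) (by rw [hb4 1 (by omega), t1])
      (by
        rw [hb4 8 (by omega), t8]
        exact hunivX.congr fun x _ _ => hb2 x (by omega))
      (by rw [hb4 4 (by omega), t4]; exact b1)
      (by rw [hb4 8 (by omega), hb4 14 (by omega)]; omega)
      (by rw [hb4 4 (by omega), hb4 14 (by omega)]; omega)) (by omega) ?_
    rintro c ⟨c1, c2, c3, c4⟩
    rw [hb4 14 (by omega), p14] at c1 c2
    have hc4 : ∀ r < 20, c.reg r = t.reg r := fun r hr => by rw [c4 r hr, hb4 r hr]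
    have hset : Finset.univ \ ((Finset.univ \ R p) \ R (i + 1)) = R p ∪ R (i + 1) := by
      ext x
      simp only [Finset.mem_sdiff, Finset.mem_univ, true_and, Finset.mem_union]
      tauto
    rw [hset] at c1
    have hcw : c.wt = s.wt := by rw [c3, b3, a3, p3]
    refine RunsTo.instr (by omega) ⟨R p ∪ R (i + 1), ?_, fun _ => rfl, fun h => by omega⟩
    refine hs.update hp ?_ ?_ ?_ ?_ ?_
    · intro r hr
      simp only [Instr.run]
      rw [hc4 r (by omega), p1 r hr]
    · intro x h1 h2 h3
      simp only [Instr.run]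
      rw [c2 x (by omega), hb2 x (by omega)]
    · exact c1
    · intro x h1 h2
      simp only [Instr.run]
      rw [hc4 11 (by omega), p11, Function.update_of_ne h2, hcw]
    · simp only [Instr.run]
      rw [hc4 11 (by omega), p11, Function.update_self, hc4 6 (by omega), t6, hcw, hsp, hsi,
        Finset.sum_union (hsum hb)]
  · intro hb
    simp only [Test.Holds, t0, p12] at hb
    -- first the vertex described by the tag is added
    refine RunsTo.seq (T1 := 4) (R := fun a => (∀ r < 15, a.reg r = t.reg r) ∧
      (∀ x < addr n (i + 1), a.mem x = s.mem x) ∧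
      Holds a.mem (addr n (i + 1) + n) (candidate tag (R (i + 1))) ∧
      (∀ x < addr n (i + 1), a.wt x = s.wt x) ∧
      a.wt (addr n (i + 1)) = ∑ v ∈ candidate tag (R (i + 1)), w v) ?_ (by omega) ?_
    · refine RunsTo.cond (by omega) ?_ ?_
      · intro hlt
        simp only [Test.Holds, t0, p12] at hlt
        have hcand : candidate tag (R (i + 1)) = insert ⟨tag, hlt⟩ (R (i + 1)) := dif_pos hlt
        refine RunsTo.block (by simp) (RunsTo.instr (by simp) ?_)
        simp only [List.foldl_cons, List.foldl_nil]
        generalize hr : (Instr.wadd 6 6 12).run _ = a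
        have a2 : a.mem = Function.update s.mem (addr n (i + 1) + n + tag) 1 := by
          simp [← hr, Instr.run, p13, p12, t1, p2]
        have a3 : a.wt = Function.update s.wt (addr n (i + 1)) (s.wt (addr n (i + 1)) + s.wt tag) := by
          simp [← hr, Instr.run, t6, p12, p3]
        have a4 : ∀ r, r ≠ 15 → a.reg r = t.reg r := fun r hr' => by simp [← hr, Instr.run, hr']
        clear hr
        have hmax' := hmax hlt
        have hsum' : ∑ v ∈ candidate tag (R (i + 1)), w v =
            s.wt (addr n (i + 1)) + s.wt tag := by
          rw [hcand, Finset.sum_insert hmax', hsi, add_comm, ← hs.weights ⟨tag, hlt⟩]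
        refine ⟨fun r hr => a4 r (by omega), fun x hx => ?_, fun v => ?_, fun x hx => ?_, ?_⟩
        · rw [a2, Function.update_of_ne (by omega)]
        · rw [a2, hcand]
          by_cases hv : v = ⟨tag, hlt⟩
          · subst hv
            simp
          · rw [Function.update_of_ne fun h => hv (Fin.ext (by simp only; omega)), hrec.sol v]
            simp [hv]
        · rw [a3, Function.update_of_ne (by omega)]
        · rw [a3, Function.update_self, hsum']
      · intro hlt
        simp only [Test.Holds, t0, p12] at hlt
        have hcand : candidate tag (R (i + 1)) = R (i + 1) := dif_neg hlt
        rw [hcand]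
        refine RunsTo.instr (by omega) ⟨fun r hr => ?_, fun x _ => ?_, ?_, fun x _ => ?_, ?_⟩
        · simp [Instr.run, show r ≠ 20 by omega]
        · simp [Instr.run, p2]
        · simpa [Instr.run, p2] using hrec.sol
        · simp [Instr.run, p3]
        · simpa [Instr.run, p3] using hsi
    · rintro a ⟨a1, a2, a3, a4, a5⟩
      have hapw : a.wt (addr n p) = ∑ v ∈ R p, w v := by rw [a4 _ (by omega), hsp]
      refine RunsTo.cond (by omega) ?_ ?_
      · intro hlt
        simp only [Test.Holds] at hlt
        rw [a1 11 (by omega), p11, a1 6 (by omega), t6, hapw, a5] at hlt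
        refine RunsTo.seq (runsTo_diffProg (n := n) (a := 13) (b := 14) (c := 3)
          (A := candidate tag (R (i + 1))) (B := ∅) (by omega) (by omega) (by omega)
          (by rw [a1 0 (by omega), t0]) (by rw [a1 1 (by omega), t1])
          (by rw [a1 13 (by omega), p13]; exact a3)
          (by rw [a1 3 (by omega), t3]; exact hs.zero.congr fun x _ _ => a2 x (by omega))
          (by rw [a1 13 (by omega), a1 14 (by omega)]; omega)
          (by rw [a1 3 (by omega), a1 14 (by omega)]; omega)) (by omega) ?_
        rintro c ⟨c1, c2, c3, c4⟩
        rw [a1 14 (by omega), p14] at c1 c2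
        rw [Finset.sdiff_empty] at c1
        have hc4 : ∀ r < 15, c.reg r = t.reg r := fun r hr => by rw [c4 r (by omega), a1 r hr]
        refine RunsTo.instr (by omega) ⟨_, ?_, fun h => by omega, fun _ => ⟨Or.inl rfl, le_rfl, hlt.le⟩⟩
        refine hs.update hp ?_ ?_ ?_ ?_ ?_
        · intro r hr
          simp only [Instr.run]
          rw [hc4 r (by omega), p1 r hr]
        · intro x h1 h2 h3
          simp only [Instr.run]
          rw [c2 x (by omega), a2 x h1]
        · exact c1
        · intro x h1 h2
          simp only [Instr.run]
          rw [hc4 11 (by omega), p11, Function.update_of_ne h2, c3, a4 x h1]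
        · simp only [Instr.run]
          rw [hc4 11 (by omega), p11, Function.update_self, hc4 6 (by omega), t6, c3, a5]
      · intro hlt
        simp only [Test.Holds] at hlt
        rw [a1 11 (by omega), p11, a1 6 (by omega), t6, hapw, a5, not_lt] at hlt
        refine RunsTo.instr (by omega) ⟨R p, ?_, fun h => by omega, fun _ => ⟨Or.inr rfl, hlt, le_rfl⟩⟩
        refine hs.update hp ?_ ?_ ?_ ?_ ?_
        · intro r hr
          simp [Instr.run, show r ≠ 20 by omega, a1 r (by omega), p1 r hr]
        · exact fun x h1 h2 h3 => a2 x h1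
        · exact hrecp.sol.congr fun x h1 h2 => a2 x (by omega)
        · exact fun x h1 h2 => a4 x h1
        · exact hapw

/-! ### Correctness of the solutions -/

/-- A property of subproblems that guarantees that the budget suffices. -/
structure IsBudget {n : ℕ} (G : SimpleGraph (Fin n)) (S : Finset (Fin n) → ℕ → Prop) : Prop where
  zero : ∀ X, S X 0 → X = ∅
  subset : ∀ X Y r, S X r → Y ⊆ X → S Y r
  branch : ∀ X r u v, S X r → r ≠ 0 → u ∈ X → v ∈ X →
    (∀ Y, AdjClosed G X Y → u ∈ Y → X ⊆ Y) →
    (∀ z ∈ X, (X \ nbhd G v).card ≤ (X \ nbhd G z).card) →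
    (S (X.erase v) r ∧ S ((X \ nbhd G v).erase v) (r - 1)) ∨
      ∃ z ∈ X, S (X.erase z) (r - 1) ∧ S ((X \ nbhd G z).erase z) (r - 1)

section

variable {n : ℕ} {G : SimpleGraph (Fin n)} {i r : ℕ} {X : Finset (Fin n)} {cs : List (Node n)}

theorem Expands.pairwise (h : Expands G i X r cs) :
    cs.Pairwise fun a b => n < a.tag → Disjoint a.X b.X := by
  cases h with
  | leaf _ => simp
  | split C _ _ _ _ => simp [Finset.disjoint_sdiff]
  | branch _ _ _ _ _ _ _ _ _ _ h _ =>
    refine List.pairwise_of_forall_mem_list fun a ha b _ hlt => ?_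
    rcases (h a ha).2 with h | ⟨z, -, h, -⟩
    · omega
    · have := z.isLt
      omega

theorem Expands.tag_of_mem (h : Expands G i X r cs) {c c' : Node n} (hc : c ∈ cs) (hc' : c' ∈ cs)
    (ht : n < c.tag) : n < c'.tag := by
  cases h with
  | leaf _ => simp at hc
  | split C _ _ _ _ =>
    simp only [List.mem_cons, List.not_mem_nil, or_false] at hc'
    rcases hc' with rfl | rfl <;> simp
  | branch _ _ _ _ _ _ _ _ _ _ h _ =>
    rcases (h c hc).2 with h | ⟨z, -, h, -⟩
    · omega
    · have := z.isLt
      omega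

theorem Expands.subset (h : Expands G i X r cs) {c : Node n} (hc : c ∈ cs) : c.X ⊆ X := by
  cases h with
  | leaf _ => simp at hc
  | split C hC _ _ _ =>
    simp only [List.mem_cons, List.not_mem_nil, or_false] at hc
    rcases hc with rfl | rfl
    · exact hC
    · exact Finset.sdiff_subset
  | branch _ _ _ _ _ _ _ _ _ _ h _ =>
    rcases (h c hc).2 with h | ⟨z, -, -, h⟩
    · exact h.2
    · exact h.trans ((Finset.erase_subset _ _).trans Finset.sdiff_subset)

theorem Expands.not_adj (h : Expands G i X r cs) {c : Node n} (hc : c ∈ cs) (ht : n < c.tag) :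
    ∀ a ∈ c.X, ∀ b ∈ X, b ∉ c.X → ¬ G.Adj a b := by
  cases h with
  | leaf _ => simp at hc
  | split C hC _ _ hn =>
    simp only [List.mem_cons, List.not_mem_nil, or_false] at hc
    rcases hc with rfl | rfl
    · exact fun a ha b hb hbC => hn a ha b (Finset.mem_sdiff.2 ⟨hb, hbC⟩)
    · intro a ha b hb hbC hab
      refine hn b ?_ a ha hab.symm
      by_contra h
      exact hbC (Finset.mem_sdiff.2 ⟨hb, h⟩)
  | branch _ _ _ _ _ _ _ _ _ _ h _ =>
    rcases (h c hc).2 with h | ⟨z, -, h, -⟩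
    · omega
    · have := z.isLt
      omega

theorem Expands.tag_mem (h : Expands G i X r cs) {c : Node n} (hc : c ∈ cs) (ht : c.tag < n) :
    ⟨c.tag, ht⟩ ∈ X ∧ c.X ⊆ (X \ nbhd G ⟨c.tag, ht⟩).erase ⟨c.tag, ht⟩ := by
  cases h with
  | leaf _ => simp at hc
  | split C hC _ _ hn =>
    simp only [List.mem_cons, List.not_mem_nil, or_false] at hc
    rcases hc with rfl | rfl <;> simp at ht
  | branch _ _ _ _ _ _ _ _ _ _ h _ =>
    rcases (h c hc).2 with h | ⟨z, hz, h1, h2⟩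
    · omega
    · have : (⟨c.tag, ht⟩ : Fin n) = z := Fin.ext h1
      rw [this]
      exact ⟨hz, h2⟩

end

/-- The weight of the vertex described by a tag. -/
def tagWeight {n : ℕ} (w : Fin n → ℚ) (tag : ℕ) : ℚ := if h : tag < n then w ⟨tag, h⟩ else 0

/-- What holds for the partial solutions when the subproblems with an index larger than `i` have
passed on their solutions. -/
structure IsPartial {n : ℕ} (G : SimpleGraph (Fin n)) (w : Fin n → ℚ)
    (S : Finset (Fin n) → ℕ → Prop) (root : Node n) (T : List (Node n)) (i : ℕ)
    (R : ℕ → Finset (Fin n)) : Prop where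
  sub : ∀ j ≤ i, ∀ h : j < (root :: T).length, R j ⊆ (root :: T)[j].X
  indep : ∀ j ≤ i, G.IsIndepSet (R j : Set (Fin n))
  disj : ∀ l, ∀ h : l < T.length, l < i → n < T[l].tag → Disjoint (R T[l].par) T[l].X
  opt : ∀ l, ∀ h : l < T.length, i ≤ l → T[l].par ≤ i → S T[l].X T[l].r → ∀ J ⊆ T[l].X,
    G.IsIndepSet (J : Set (Fin n)) →
      (T[l].tag ≤ n → ∑ v ∈ J, w v + tagWeight w T[l].tag ≤ ∑ v ∈ R T[l].par, w v) ∧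
      (n < T[l].tag → ∑ v ∈ J, w v ≤ ∑ v ∈ R T[l].par ∩ T[l].X, w v)

section

variable {n : ℕ} {G : SimpleGraph (Fin n)} {w : Fin n → ℚ} {S : Finset (Fin n) → ℕ → Prop}
  {root : Node n} {T : List (Node n)} {i : ℕ} {R : ℕ → Finset (Fin n)}

theorem IsPartial.start : IsPartial G w S root T T.length fun _ => ∅ where
  sub := by simp
  indep := by simp [SimpleGraph.IsIndepSet]
  disj := by simp
  opt l h h' := by omega

/-- The partial solution of the current subproblem is optimal. -/
theorem IsPartial.optimal (h : IsPartial G w S root T i R) (hS : IsBudget G S)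
    (hT : IsTree G root T (root :: T).length) (hi : i < (root :: T).length)
    (hSi : S (root :: T)[i].X (root :: T)[i].r) {J : Finset (Fin n)} (hJ : J ⊆ (root :: T)[i].X)
    (hJi : G.IsIndepSet (J : Set (Fin n))) : ∑ v ∈ J, w v ≤ ∑ v ∈ R i, w v := by
  have hsub := h.sub i le_rfl hi
  have hopt : ∀ c ∈ T.filter fun c => c.par = i, S c.X c.r → ∀ J ⊆ c.X,
      G.IsIndepSet (J : Set (Fin n)) →
        (c.tag ≤ n → ∑ v ∈ J, w v + tagWeight w c.tag ≤ ∑ v ∈ R i, w v) ∧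
        (n < c.tag → ∑ v ∈ J, w v ≤ ∑ v ∈ R i ∩ c.X, w v) := by
    intro c hc
    rw [List.mem_filter] at hc
    obtain ⟨hc1, hc2⟩ := hc
    obtain ⟨l, hl, rfl⟩ := List.mem_iff_getElem.1 hc1
    have hpar : T[l].par = i := by simpa using hc2
    have := h.opt l hl (by have := (hT.par l hl).1; omega) (by omega)
    rwa [hpar] at this
  have hexp := hT.expands i hi hi
  generalize T.filter (fun c => c.par = i) = cs at *
  generalize (root :: T)[i].X = X at *
  generalize (root :: T)[i].r = r at *
  have hmono : ∀ K ⊆ J, G.IsIndepSet (K : Set (Fin n)) := fun K hK =>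
    hJi.mono (Finset.coe_subset.2 hK)
  cases hexp with
  | leaf hX =>
    -- A budget of 0 suffices for the empty set only.
    have hX' : X = ∅ := by
      rcases hX with hX | hX
      · exact hX
      · exact hS.zero X (hX ▸ hSi)
    subst hX'
    rw [Finset.subset_empty.1 hJ, Finset.subset_empty.1 hsub]
  | split C hC _ _ _ =>
    have h1 := (hopt ⟨C, r, i, n + 1⟩ (by simp) (hS.subset _ _ _ hSi hC) (J ∩ C) Finset.inter_subset_right
      (hmono _ Finset.inter_subset_left)).2 (Nat.lt_succ_self n)
    have h2 := (hopt _ (List.mem_cons_of_mem _ (List.mem_singleton_self _))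
      (hS.subset _ _ _ hSi Finset.sdiff_subset) (J \ C)
      (Finset.sdiff_subset_sdiff hJ subset_rfl) (hmono _ Finset.sdiff_subset)).2 (Nat.lt_succ_self n)
    have h3 : R i ∩ (X \ C) = R i \ C := by
      ext x
      have := @hsub x
      simp only [Finset.mem_inter, Finset.mem_sdiff]
      tauto
    simp only [h3] at h2
    rw [← Finset.sum_inter_add_sum_sdiff J C, ← Finset.sum_inter_add_sum_sdiff (R i) C]
    exact add_le_add h1 h2
  | branch cs u v hu hv hr hconn hdeg h1 h2 _ _ =>
    -- One vertex z whose two children both have sufficient budgets is enough: J - z is compared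
    -- with the child that takes z if z is in J, and J with the child that omits z otherwise.
    have key : ∀ z ∈ X, ∀ r', (⟨X.erase z, r', i, n⟩ : Node n) ∈ cs → S (X.erase z) r' →
        (⟨(X \ nbhd G z).erase z, r - 1, i, z⟩ : Node n) ∈ cs →
        S ((X \ nbhd G z).erase z) (r - 1) → ∑ v ∈ J, w v ≤ ∑ v ∈ R i, w v := by
      intro z hz r' m1 s1 m2 s2
      by_cases hzJ : z ∈ J
      · have := (hopt _ m2 s2 (J.erase z) (fun x hx => ?_) (hmono _ (Finset.erase_subset _ _))).1
          z.isLt.le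
        · rw [tagWeight, dif_pos z.isLt, Finset.sum_erase_add _ _ hzJ] at this
          exact this
        · rw [Finset.mem_erase] at hx
          rw [Finset.mem_erase, Finset.mem_sdiff, mem_nbhd]
          exact ⟨hx.1, hJ hx.2, hJi hzJ hx.2 hx.1.symm⟩
      · have := (hopt _ m1 s1 J (fun x hx => Finset.mem_erase.2
          ⟨fun h => hzJ (h ▸ hx), hJ hx⟩) hJi).1 le_rfl
        simpa [tagWeight] using this
    rcases hS.branch X r u v hSi hr hu hv hconn hdeg with ⟨s1, s2⟩ | ⟨z, hz, s1, s2⟩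
    · exact key v hv r h1 s1 (h2 v hv).2 s2
    · exact key z hz _ (h2 z hz).1 s1 (h2 z hz).2 s2

theorem IsTree.expands_par (hT : IsTree G root T (root :: T).length) (hi : i < T.length) :
    ∃ h : T[i].par < (root :: T).length, ∃ cs, T[i] ∈ cs ∧
      (∀ l (hl : l < T.length), T[l].par = T[i].par → T[l] ∈ cs ∧
        (l < i → n < T[l].tag → Disjoint T[l].X T[i].X)) ∧
      Expands G T[i].par (root :: T)[T[i].par].X (root :: T)[T[i].par].r cs := by
  have hp := (hT.par i hi).2
  have hexp := hT.expands T[i].par hp hp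
  have hmem : ∀ l (hl : l < T.length), T[l].par = T[i].par →
      T[l] ∈ T.filter fun c => c.par = T[i].par := fun l hl h =>
    List.mem_filter.2 ⟨List.getElem_mem _, by simpa using h⟩
  refine ⟨hp, _, hmem i hi rfl, fun l hl h => ⟨hmem l hl h, fun hli ht => ?_⟩, hexp⟩
  have := List.pairwise_iff_getElem.1 (List.pairwise_filter.1 hexp.pairwise) l i hl hi hli
  exact this (by simpa using h) (by simp) ht

/-- Passing on the solution of the current subproblem. -/
theorem IsPartial.step (h : IsPartial G w S root T (i + 1) R) (hS : IsBudget G S)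
    (hT : IsTree G root T (root :: T).length) (hi : i < T.length) (hw : ∀ v, 0 < w v)
    {S' : Finset (Fin n)}
    (h1 : n < T[i].tag → S' = R T[i].par ∪ R (i + 1))
    (h2 : T[i].tag ≤ n → (S' = candidate T[i].tag (R (i + 1)) ∨ S' = R T[i].par) ∧
        ∑ v ∈ candidate T[i].tag (R (i + 1)), w v ≤ ∑ v ∈ S', w v ∧
        ∑ v ∈ R T[i].par, w v ≤ ∑ v ∈ S', w v) :
    IsPartial G w S root T i (Function.update R T[i].par S') := by
  have hpi := (hT.par i hi).1
  have hoptc : S T[i].X T[i].r → ∀ J ⊆ T[i].X, G.IsIndepSet (J : Set (Fin n)) →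
      ∑ v ∈ J, w v ≤ ∑ v ∈ R (i + 1), w v := fun hSi J hJ hJi =>
    h.optimal hS hT (i := i + 1) (by simpa using hi) (by simpa using hSi) (by simpa using hJ) hJi
  have hsubc : R (i + 1) ⊆ T[i].X := 
    h.sub (i + 1) le_rfl (by simpa using hi)
  have hindc := h.indep (i + 1) le_rfl
  obtain ⟨hp, cs, hcs, hsib, hexp⟩ := hT.expands_par hi
  have hsubp := h.sub T[i].par (by omega) hp
  have hindp := h.indep T[i].par (by omega)
  have hXX := hexp.subset hcs
  have hsum : candidate T[i].tag (R (i + 1)) ⊆ (root :: T)[T[i].par].X ∧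
      G.IsIndepSet (candidate T[i].tag (R (i + 1)) : Set (Fin n)) ∧
      ∑ v ∈ candidate T[i].tag (R (i + 1)), w v =
        ∑ v ∈ R (i + 1), w v + tagWeight w T[i].tag := by
    unfold candidate tagWeight
    split_ifs with ht
    · obtain ⟨k1, k2⟩ := hexp.tag_mem hcs ht
      have k3 : ∀ x ∈ R (i + 1), x ≠ ⟨T[i].tag, ht⟩ ∧ ¬ G.Adj ⟨T[i].tag, ht⟩ x := by
        intro x hx
        have := k2 (hsubc hx)
        rw [Finset.mem_erase, Finset.mem_sdiff, mem_nbhd] at this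
        exact ⟨this.1, this.2.2⟩
      refine ⟨Finset.insert_subset k1 (hsubc.trans hXX), ?_, ?_⟩
      · rw [Finset.coe_insert, SimpleGraph.IsIndepSet, Set.pairwise_insert]
        exact ⟨hindc, fun x hx _ => ⟨(k3 x hx).2, fun h => (k3 x hx).2 h.symm⟩⟩
      · rw [Finset.sum_insert fun hx => (k3 _ hx).1 rfl, add_comm]
    · exact ⟨hsubc.trans hXX, hindc, (add_zero _).symm⟩
  have hle : ∑ v ∈ R T[i].par, w v ≤ ∑ v ∈ S', w v := by
    rcases Nat.lt_or_ge n T[i].tag with ht | ht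
    · rw [h1 ht]
      exact Finset.sum_le_sum_of_subset_of_nonneg Finset.subset_union_left fun v _ _ => (hw v).le
    · exact (h2 ht).2.2
  refine ⟨fun j hj hjl => ?_, fun j hj => ?_, fun l hl hli htl => ?_,
    fun l hl hil hpl hSl J hJ hJi => ?_⟩
  · by_cases hjp : j = T[i].par
    · subst hjp
      rw [Function.update_self]
      rcases Nat.lt_or_ge n T[i].tag with ht | ht
      · rw [h1 ht]
        exact Finset.union_subset hsubp (hsubc.trans hXX)
      · rcases (h2 ht).1 with e | e <;> rw [e]
        · exact hsum.1
        · exact hsubp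
    · rw [Function.update_of_ne hjp]
      exact h.sub j (by omega) hjl
  · by_cases hjp : j = T[i].par
    · subst hjp
      rw [Function.update_self]
      rcases Nat.lt_or_ge n T[i].tag with ht | ht
      · rw [h1 ht, Finset.coe_union, SimpleGraph.IsIndepSet, Set.pairwise_union]
        refine ⟨hindp, hindc, fun a ha b hb _ => ?_⟩
        -- The parent has not yet received anything from this part, and no edge leaves the part
        -- within the set of the parent.
        have hd := Finset.disjoint_left.1 (h.disj i hi (by omega) ht) ha
        have := hexp.not_adj hcs ht b (hsubc hb) a (hsubp ha) hd
        exact ⟨fun h => this h.symm, this⟩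
      · rcases (h2 ht).1 with e | e <;> rw [e]
        · exact hsum.2.1
        · exact hindp
    · rw [Function.update_of_ne hjp]
      exact h.indep j (by omega)
  · by_cases hjp : T[l].par = T[i].par
    · rw [hjp, Function.update_self]
      -- The children of one subproblem are all split children or none is, so the update is a union.
      have hti := hexp.tag_of_mem (hsib l hl hjp).1 hcs htl
      rw [h1 hti, Finset.disjoint_union_left]
      refine ⟨hjp ▸ h.disj l hl (by omega) htl, ?_⟩
      exact (Finset.disjoint_of_subset_right hsubc ((hsib l hl hjp).2 hli htl)).symm
    · rw [Function.update_of_ne hjp]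
      exact h.disj l hl (by omega) htl
  · by_cases hjp : T[l].par = T[i].par
    · rw [hjp, Function.update_self]
      rcases hil.eq_or_lt with rfl | hil
      · refine ⟨fun ht => ?_, fun ht => ?_⟩
        · have := hoptc hSl J hJ hJi
          have := (h2 ht).2.1
          have := hsum.2.2
          linarith
        · refine (hoptc hSl J hJ hJi).trans ?_
          refine Finset.sum_le_sum_of_subset_of_nonneg ?_ fun v _ _ => (hw v).le
          rw [h1 ht]
          exact Finset.subset_inter Finset.subset_union_right hsubc
      · obtain ⟨k1, k2⟩ := h.opt l hl hil (by omega) hSl J hJ hJi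
        rw [hjp] at k1 k2
        refine ⟨fun ht => (k1 ht).trans hle, fun ht => (k2 ht).trans ?_⟩
        refine Finset.sum_le_sum_of_subset_of_nonneg ?_ fun v _ _ => (hw v).le
        -- A union cannot destroy what an earlier split sibling has contributed.
        rw [h1 (hexp.tag_of_mem (hsib l hl hjp).1 hcs ht)]
        exact Finset.inter_subset_inter_right Finset.subset_union_left
    · rw [Function.update_of_ne hjp]
      refine h.opt l hl ?_ (by omega) hSl J hJ hJi
      rcases hil.eq_or_lt with rfl | hil
      · exact absurd rfl hjp
      · exact hil

end

/-- Passes on all solutions, and copies the solution of the root to the output. -/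
def pushProg : Program :=
  block [.add 8 4 0, .sub 6 6 5] <|
    .seq (.loop (.lt 8 6) (.seq pushStepProg (.instr (.sub 6 6 5)))) <|
      block [.add 9 8 0] (diffProg 9 2 3)

theorem runsTo_pushProg {n : ℕ} {G : SimpleGraph (Fin n)} {w : Fin n → ℚ} {r : ℕ}
    {T : List (Node n)} {s : State} {S : Finset (Fin n) → ℕ → Prop} {root : Node n}
    (hs : Queue G w (root :: T) (root :: T).length s) (hroot : root.X = Finset.univ)
    (hr : root.r = r) (hT : IsTree G root T (root :: T).length) (hS : IsBudget G S)
    (hSr : S Finset.univ r) (hw : ∀ v, 0 < w v) :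
    RunsTo pushProg s (T.length * (27 * n + 20 + 1) + 9 * n + 10) fun s' =>
      IsMaxWeightIndepSet G w (output n s') := by
  refine RunsTo.block (by simp) ?_
  simp only [List.foldl_cons, List.foldl_nil, List.length_cons, List.length_nil]
  generalize ht : (Instr.sub 6 6 5).run _ = t
  have p1 : ∀ r < 8, r ≠ 6 → t.reg r = s.reg r := fun r h1 h2 => by
    simp [← ht, Instr.run, h2, show r ≠ 8 by omega]
  have p2 : t.mem = s.mem := by simp [← ht, Instr.run]
  have p3 : t.wt = s.wt := by simp [← ht, Instr.run]
  have hpush : Push w (root :: T) T.length (fun _ => ∅) t := by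
    refine ⟨?_, ?_, ?_, ?_, ?_, ?_, ?_, ?_, ?_, ?_, ?_, ?_⟩
    · rw [p1 0 (by omega) (by omega), hs.r0]
    · rw [p1 1 (by omega) (by omega), hs.r1]
    · rw [p1 2 (by omega) (by omega), hs.r2]
    · rw [p1 3 (by omega) (by omega), hs.r3]
    · rw [p1 4 (by omega) (by omega), hs.r4]
    · rw [p1 5 (by omega) (by omega), hs.r5]
    · simp [← ht, Instr.run, hs.r6, hs.r5, addr_succ]
    · simp [← ht, Instr.run, hs.r4, hs.r0, addr]
      ring
    · rw [p2]; exact hs.zero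
    · intro j _ hj
      rw [p2]; exact hs.recs j hj
    · intro v
      rw [p3]; exact hs.weights v
    · intro j hj
      rw [p3, hs.wzero j (by simpa using Nat.lt_succ_of_le hj), Finset.sum_empty]
  clear ht
  -- The variant is the current index itself: it runs down to the root, and children are handled
  -- before their parents because they have larger indices.
  refine RunsTo.seq (RunsTo.loop (T := 27 * n + 20) (k := T.length) (fun k t => k ≤ T.length ∧
    ∃ R, Push w (root :: T) k R t ∧ IsPartial G w S root T k R) ?_
    ⟨le_rfl, _, hpush, IsPartial.start⟩) (by omega) ?_
  · rintro k a ⟨hk, R, h1, h2⟩ hb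
    simp only [Test.Holds, h1.r8, h1.r6] at hb
    obtain ⟨i, rfl⟩ : ∃ i, k = i + 1 := by
      refine ⟨k - 1, ?_⟩
      rcases Nat.eq_zero_or_pos k with rfl | h
      · omega
      · omega
    have hi : i < T.length := hk
    have hpi := (hT.par i hi).1
    obtain ⟨hp, cs, hcs, -, hexp⟩ := hT.expands_par hi
    have hsubc : R (i + 1) ⊆ T[i].X := 
      h2.sub (i + 1) le_rfl (by simpa using hi)
    refine (runsTo_pushStepProg h1 (by simpa using hi) (fun _ => hroot) hpi
      (fun ht => ?_) (fun ht hmem => ?_)).mono le_rfl ?_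
    · exact Finset.disjoint_of_subset_right hsubc (h2.disj i hi (by omega) ht)
    · have := (hexp.tag_mem hcs ht).2 (hsubc hmem)
      simp at this
    · rintro a' ⟨S', k1, k2, k3⟩
      exact ⟨i, by omega, by omega, _, k1, h2.step hS hT hi hw k2 k3⟩
  · rintro a ⟨⟨k, hk, R, h1, h2⟩, hb⟩
    simp only [Test.Holds, h1.r8, h1.r6] at hb
    obtain rfl : k = 0 := by
      by_contra h
      have := addr_add_le (n := n) (Nat.pos_of_ne_zero h)
      omega
    refine RunsTo.block (by simp; omega) ?_
    simp only [List.foldl_cons, List.foldl_nil, List.length_cons, List.length_nil]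
    have e : ((Instr.add 9 8 0).run a).mem = a.mem := rfl
    have e9 : ((Instr.add 9 8 0).run a).reg 9 = addr n 0 + n := by simp [Instr.run, h1.r8, h1.r0]
    have e2 : ((Instr.add 9 8 0).run a).reg 2 = 0 := by simp [Instr.run, h1.r2]
    have e3 : ((Instr.add 9 8 0).run a).reg 3 = n * n := by simp [Instr.run, h1.r3]
    -- The output goes into cells of the adjacency matrix, which is no longer needed, but it must
    -- not overlap the empty set stored at n².
    have hnn : n ≤ n * n := by nlinarith
    refine (runsTo_diffProg (n := n) (a := 9) (b := 2) (c := 3) (A := R 0) (B := ∅) (by omega)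
      (by omega) (by omega) (by simp [Instr.run, h1.r0]) (by simp [Instr.run, h1.r1])
      (by rw [e9, e]; exact (h1.recs 0 le_rfl (by simp)).sol) (by rw [e3, e]; exact h1.zero)
      (by rw [e9, e2]; omega) (by rw [e3, e2]; omega)).mono (by omega) ?_
    rintro c ⟨c1, -⟩
    rw [e2, Finset.sdiff_empty] at c1
    have hout : output n c = R 0 := by
      ext v
      have := c1 v
      rw [Nat.zero_add] at this
      simp [output, this]
    rw [hout]
    refine ⟨h2.indep 0 le_rfl, fun J hJ => ?_⟩
    refine h2.optimal hS hT (i := 0) (by simp) ?_ ?_ hJ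
    · change S root.X root.r
      rwa [hroot, hr]
    · change J ⊆ root.X
      rw [hroot]
      exact Finset.subset_univ J

/-! ### A sufficient budget -/

/-- The budget `r` suffices for the vertices of large degree and for the elimination depth of the
sets of small degree. -/
def Affordable {n : ℕ} (G : SimpleGraph (Fin n)) (d : ℕ) (X : Finset (Fin n)) (r : ℕ) : Prop :=
  ∃ q t, q + t ≤ r ∧ X.card ≤ q * d ∧
    ∀ Y ⊆ X, (∀ v ∈ Y, ∀ N ⊆ Y, (∀ z ∈ N, G.Adj v z) → N.card < d) → ElimDepth G Y t

/-- Here q bounds how often d vertices can still be discarded at once. If some degree in X is at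
least d, so is that of v: taking v lowers q by one, omitting v keeps q and t. If all degrees are
below d, then X has elimination depth t and, being connected, its elimination begins with a vertex
z; both children of z lower t by one. -/
theorem isBudget_affordable {n : ℕ} (G : SimpleGraph (Fin n)) (d : ℕ) :
    IsBudget G (Affordable G d) where
  zero := by
    rintro X ⟨q, t, h1, h2, -⟩
    obtain rfl : q = 0 := by omega
    simpa using h2
  subset := by
    rintro X Y r ⟨q, t, h1, h2, h3⟩ hYX
    exact ⟨q, t, h1, (Finset.card_le_card hYX).trans h2, fun Z hZ => h3 Z (hZ.trans hYX)⟩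
  branch := by
    rintro X r u v ⟨q, t, h1, h2, h3⟩ hr hu hv hconn hdeg
    by_cases hlow : ∀ v ∈ X, ∀ N ⊆ X, (∀ z ∈ N, G.Adj v z) → N.card < d
    · right
      obtain ⟨z, hz, t', rfl, h4⟩ := (h3 X subset_rfl hlow).exists_erase hu
        fun Y hYX hY => hconn Y ⟨hYX, hY⟩
      have key : ∀ Y ⊆ X.erase z, Affordable G d Y (r - 1) := fun Y hY =>
        ⟨q, t', by omega, (Finset.card_le_card (hY.trans (Finset.erase_subset _ _))).trans h2,
          fun Z hZ _ => h4.subset (hZ.trans hY)⟩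
      exact ⟨z, hz, key _ subset_rfl,
        key _ (Finset.erase_subset_erase _ Finset.sdiff_subset)⟩
    · left
      push Not at hlow
      obtain ⟨z, hz, N, hN, hadj, hd⟩ := hlow
      have hq : q ≠ 0 := by
        rintro rfl
        have := Finset.card_pos.2 ⟨u, hu⟩
        omega
      obtain ⟨q, rfl⟩ := Nat.exists_eq_succ_of_ne_zero hq
      have hsub : (X \ nbhd G v).erase v ⊆ X :=
        (Finset.erase_subset _ _).trans Finset.sdiff_subset
      have h5 : (X \ nbhd G z).card ≤ X.card - d := by
        have : X \ nbhd G z ⊆ X \ N :=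
          Finset.sdiff_subset_sdiff subset_rfl fun x hx => mem_nbhd.2 (hadj x hx)
        have := Finset.card_le_card this
        rw [Finset.card_sdiff_of_subset hN] at this
        omega
      have h6 := hdeg z hz
      have h7 := Finset.card_le_card (Finset.erase_subset v (X \ nbhd G v))
      rw [Nat.succ_mul] at h2
      exact ⟨⟨q + 1, t, h1, by
          have := Finset.card_le_card (Finset.erase_subset v X)
          rw [Nat.succ_mul]; omega,
        fun Y hY => h3 Y (hY.trans (Finset.erase_subset _ _))⟩,
        ⟨q, t, by omega, by omega, fun Y hY => h3 Y (hY.trans hsub)⟩⟩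

/-! ### Initialization and the complete algorithm -/

/-- Initializes the queue; the budget of the root is `K * (4 ^ j * (j + 1))` for the smallest `j`
with `n ≤ 8 ^ j`. -/
def setupProg (K : ℕ) : Program :=
  block [.const 1 1, .const 2 0, .const 3 0] <| .seq (forLoop 16 (.instr (.add 3 3 0))) <|
    block [.add 4 3 0, .add 5 0 0, .const 20 3, .add 5 5 20, .add 6 4 0, .add 7 6 5] <|
      .seq (forLoop 16 (block [.add 17 6 16] (.instr (.store 17 1)))) <|
        block [.const 10 1, .const 11 K, .const 12 K] <|
          .seq (.loop (.lt 10 0) (block [.add 10 10 10, .add 10 10 10, .add 10 10 10,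
            .add 12 12 11, .add 12 12 12, .add 12 12 12, .add 11 11 11] (.instr (.add 11 11 11)))) <|
            block [.add 17 6 0, .add 17 17 0, .store 17 12, .add 17 17 1] (.instr (.store 17 6))

/-- Multiplication is replaced by repeated addition. The registers 10, 11, 12 hold 8^j, K 4^j and K
4^j (j+1), and are updated by doublings and 4 (K 4^j (j+1) + K 4^j) = K 4^(j+1) (j+2). -/
theorem runsTo_setupProg {n : ℕ} (G : SimpleGraph (Fin n)) (w : Fin n → ℚ) (K : ℕ) :
    RunsTo (setupProg K) (input G w) (20 * n + 30) fun s' => ∃ j, n ≤ 8 ^ j ∧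
      (j = 0 ∨ 8 ^ (j - 1) < n) ∧ Queue G w [⟨Finset.univ, K * (4 ^ j * (j + 1)), 0, 0⟩] 0 s' := by
  classical
  have hadj : ∀ v : Fin n, Holds (input G w).mem (v * n) (nbhd G v) := by
    intro v u
    simp only [input, mem_nbhd]
    congr 1
    refine propext ⟨?_, fun h => ⟨v, u, rfl, h⟩⟩
    rintro ⟨i, j, h1, h2⟩
    have hn : 0 < n := Nat.lt_of_le_of_lt (Nat.zero_le _) v.isLt
    have e1 := congrArg (· / n) h1
    have e2 := congrArg (· % n) h1
    simp only [Nat.mul_comm _ n, Nat.mul_add_div hn, Nat.mul_add_mod, Nat.div_eq_of_lt u.isLt,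
      Nat.div_eq_of_lt j.isLt, Nat.mod_eq_of_lt u.isLt, Nat.mod_eq_of_lt j.isLt,
      Nat.add_zero] at e1 e2
    rwa [Fin.ext e1, Fin.ext e2]
  have hzero : ∀ x, n * n ≤ x → (input G w).mem x = 0 := by
    intro x hx
    simp only [input]
    rw [if_neg]
    rintro ⟨i, j, h1, -⟩
    have := row_le i
    omega
  have hwt : ∀ v : Fin n, (input G w).wt v = w v := fun v => by simp [input]
  have hwt0 : ∀ x, n ≤ x → (input G w).wt x = 0 := fun x hx => by simp [input, hx]
  have hreg : (input G w).reg 0 = n := by simp [input]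
  generalize input G w = s at *
  have hbase : addr n 0 = n * n + 2 * n := by simp [addr]
  refine RunsTo.block (by simp) ?_
  simp only [List.foldl_cons, List.foldl_nil, List.length_cons, List.length_nil]
  refine RunsTo.seq (T1 := 3 * n + 2) (R := fun t => t.reg 0 = n ∧ t.reg 1 = 1 ∧ t.reg 2 = 0 ∧
    t.reg 3 = n * n ∧ t.mem = s.mem ∧ t.wt = s.wt) ?_ (by omega) ?_
  · refine RunsTo.forLoop (n := n) (T := 1) (fun v t => t.reg 16 = v ∧ t.reg 0 = n ∧ t.reg 1 = 1 ∧
      t.reg 2 = 0 ∧ t.reg 3 = v * n ∧ t.mem = s.mem ∧ t.wt = s.wt) ?_ ?_ ?_ ?_ (by omega)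
    · rintro v t ⟨h1, h2, -⟩
      exact ⟨h1, h2⟩
    · simp [Instr.run, hreg]
    · rintro v t hv ⟨h1, h2, h3, h4, h5, h6, h7⟩
      refine RunsTo.instr le_rfl ?_
      simp [Instr.run, h1, h2, h3, h4, h5, h6, h7, Nat.succ_mul]
    · rintro t ⟨-, h⟩
      exact h
  rintro t ⟨h0, h1, h2, h3, h4, h5⟩
  refine RunsTo.block (by simp; omega) ?_
  simp only [List.foldl_cons, List.foldl_nil, List.length_cons, List.length_nil]
  generalize hr : (Instr.add 7 6 5).run _ = a
  have a0 : a.reg 0 = n ∧ a.reg 1 = 1 ∧ a.reg 2 = 0 ∧ a.reg 3 = n * n ∧ a.reg 4 = n * n + n ∧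
      a.reg 5 = 2 * n + 3 ∧ a.reg 6 = addr n 0 ∧ a.reg 7 = addr n 1 ∧ a.mem = s.mem ∧
      a.wt = s.wt := by
    rw [addr_succ, hbase]
    simp [← hr, Instr.run, h0, h1, h2, h3, h4, h5]
    omega
  clear hr
  refine RunsTo.seq (T1 := 4 * n + 2) (R := fun b => (∀ r < 16, b.reg r = a.reg r) ∧
    (∀ v < n, b.mem (addr n 0 + v) = 1) ∧
    (∀ x, x < addr n 0 ∨ addr n 0 + n ≤ x → b.mem x = s.mem x) ∧ b.wt = s.wt) ?_ (by omega) ?_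
  · refine RunsTo.forLoop (n := n) (T := 2) (fun v b => b.reg 16 = v ∧ (∀ r < 16, b.reg r = a.reg r) ∧
      (∀ z < v, b.mem (addr n 0 + z) = 1) ∧
      (∀ x, x < addr n 0 ∨ addr n 0 + v ≤ x → b.mem x = s.mem x) ∧ b.wt = s.wt) ?_ ?_ ?_ ?_ (by omega)
    · rintro v b ⟨k1, k2, -⟩
      exact ⟨k1, by rw [k2 0 (by omega), a0.1]⟩
    · refine ⟨by simp [Instr.run], fun r hr => ?_, by simp, fun x _ => ?_, ?_⟩
      · simp [Instr.run, show r ≠ 16 by omega]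
      · simp [Instr.run, a0]
      · simp [Instr.run, a0]
    · rintro v b hv ⟨k1, k2, k3, k4, k5⟩
      refine RunsTo.block (by simp) (RunsTo.instr (by simp) ?_)
      simp only [List.foldl_cons, List.foldl_nil]
      generalize hr : (Instr.store 17 1).run _ = c
      have c1 : ∀ r, r ≠ 17 → c.reg r = b.reg r := fun r hr' => by simp [← hr, Instr.run, hr']
      have c2 : c.mem = Function.update b.mem (addr n 0 + v) 1 := by
        simp [← hr, Instr.run, k1, k2, a0]
      have c3 : c.wt = b.wt := by simp [← hr, Instr.run]
      clear hr
      refine ⟨?_, fun r hr => ?_, fun z hz => ?_, fun x hx => ?_, ?_⟩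
      · simp [Instr.run, c1, k1, k2, a0]
      · simp [Instr.run, show r ≠ 16 by omega, c1 r (by omega), k2 r hr]
      · simp only [Instr.run, c2]
        rcases Nat.lt_succ_iff_lt_or_eq.1 hz with hz | rfl
        · rw [Function.update_of_ne (by omega), k3 z hz]
        · rw [Function.update_self]
      · simp only [Instr.run, c2]
        rw [Function.update_of_ne (by omega), k4 x (by omega)]
      · simp [Instr.run, c3, k5]
    · rintro b ⟨-, h⟩
      exact h
  rintro b ⟨b1, b2, b3, b4⟩
  refine RunsTo.block (by simp; omega) ?_
  simp only [List.foldl_cons, List.foldl_nil, List.length_cons, List.length_nil]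
  -- The variant is the truncated difference n + 1 - 8^j, which is n at j = 0.
  refine RunsTo.seq (RunsTo.loop (T := 8) (k := n) (fun k c => (∀ r < 10, c.reg r = a.reg r) ∧
    c.mem = b.mem ∧ c.wt = b.wt ∧ ∃ j, c.reg 10 = 8 ^ j ∧ c.reg 11 = K * 4 ^ j ∧
    c.reg 12 = K * (4 ^ j * (j + 1)) ∧ (j = 0 ∨ 8 ^ (j - 1) < n) ∧ k + 8 ^ j = max (n + 1) (8 ^ j)) ?_
    ⟨fun r hr => ?_, ?_, ?_, 0, ?_⟩) (by omega) ?_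
  · rintro k c ⟨k1, k2, k3, j, k4, k5, k6, k7, k8⟩ hb
    simp only [Test.Holds, k4, k1 0 (by omega), a0.1] at hb
    have hpos : 0 < 8 ^ j := by positivity
    refine RunsTo.block (by simp) (RunsTo.instr (by simp) ⟨max (n + 1) (8 ^ (j + 1)) - 8 ^ (j + 1), ?_, ?_⟩)
    · rw [max_eq_left (by omega)] at k8
      rw [pow_succ]
      omega
    · simp only [List.foldl_cons, List.foldl_nil]
      generalize hr : (Instr.add 11 11 11).run _ = d
      refine ⟨fun r hr' => ?_, ?_, ?_, j + 1, ?_, ?_, ?_, Or.inr hb, ?_⟩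
      · simp [← hr, Instr.run, show r ≠ 10 by omega, show r ≠ 11 by omega, show r ≠ 12 by omega,
          k1 r hr']
      · simp [← hr, Instr.run, k2]
      · simp [← hr, Instr.run, k3]
      · simp [← hr, Instr.run, k4]
        ring
      · simp [← hr, Instr.run, k5]
        ring
      · simp [← hr, Instr.run, k5, k6]
        ring
      · exact Nat.sub_add_cancel (le_max_right _ _)
  · simp [Instr.run, show r ≠ 10 by omega, show r ≠ 11 by omega, show r ≠ 12 by omega,
      b1 r (by omega)]
  · simp [Instr.run]
  · simp [Instr.run]
  · simp [Instr.run]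
  rintro c ⟨⟨k, k1, k2, k3, j, k4, k5, k6, k7, -⟩, hb⟩
  simp only [Test.Holds, k4, k1 0 (by omega), a0.1, not_lt] at hb
  refine RunsTo.block (by simp; omega) (RunsTo.instr (by simp; omega) ?_)
  simp only [List.foldl_cons, List.foldl_nil]
  generalize hr : (Instr.store 17 6).run _ = d
  have d1 : ∀ r < 10, d.reg r = a.reg r := fun r hr' => by
    simp [← hr, Instr.run, show r ≠ 17 by omega, k1 r hr']
  have d2 : d.mem = Function.update (Function.update b.mem (addr n 0 + 2 * n)
      (K * (4 ^ j * (j + 1)))) (addr n 0 + 2 * n + 1) (addr n 0) := by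
    have e : addr n 0 + n + n = addr n 0 + 2 * n := by ring
    simp [← hr, Instr.run, k1, k2, k6, a0, e]
  have d3 : d.wt = s.wt := by simp [← hr, Instr.run, k3, b4]
  clear hr
  obtain ⟨a0, a1, a2, a3, a4, a5, a6, a7, a8, a9⟩ := a0
  have dold : ∀ x < addr n 0, d.mem x = s.mem x := fun x hx => by
    rw [d2, Function.update_of_ne (by omega), Function.update_of_ne (by omega), b3 x (by omega)]
  refine ⟨j, hb, k7, ?_, ?_, ?_, ?_, ?_, ?_, ?_, ?_, ?_, ?_, ?_, ?_, ?_⟩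
  · rw [d1 0 (by omega), a0]
  · rw [d1 1 (by omega), a1]
  · rw [d1 2 (by omega), a2]
  · rw [d1 3 (by omega), a3]
  · rw [d1 4 (by omega), a4]
  · rw [d1 5 (by omega), a5]
  · rw [d1 6 (by omega), a6]
  · rw [d1 7 (by omega), a7, List.length_singleton]
  · exact fun v => (hadj v).congr fun x h1 h2 => dold x (by have := row_le v; omega)
  · intro v
    rw [dold _ (by omega), hzero _ (by omega)]
    simp
  · intro i hi
    obtain rfl : i = 0 := by simpa using hi
    refine ⟨fun v => ?_, fun v => ?_, ?_, ?_, ?_⟩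
    · rw [d2, Function.update_of_ne (by omega), Function.update_of_ne (by omega), b2 _ v.isLt]
      simp
    · rw [d2, Function.update_of_ne (by omega), Function.update_of_ne (by omega), b3 _ (by omega),
        hzero _ (by omega)]
      simp
    · rw [d2, Function.update_of_ne (by omega), Function.update_self]
      rfl
    · rw [d2, Function.update_self]
      rfl
    · rw [d2, Function.update_of_ne (by omega), Function.update_of_ne (by omega), b3 _ (by omega),
        hzero _ (by omega)]
      rfl
  · exact fun v => by rw [d3, hwt]
  · intro i hi
    obtain rfl : i = 0 := by simpa using hi
    rw [d3, hwt0 _ (by omega)]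

/-- The algorithm. -/
def mwisProg (K : ℕ) : Program := .seq (setupProg K) (.seq queueProg pushProg)

theorem runsTo_mwisProg {n k : ℕ} {G : SimpleGraph (Fin n)} (hG : OrderedFree (abbaGraph k) G)
    {w : Fin n → ℚ} (hw : ∀ v, 0 < w v) :
    ∃ j, n ≤ 8 ^ j ∧ (j = 0 ∨ 8 ^ (j - 1) < n) ∧
      RunsTo (mwisProg (200 * k + 501)) (input G w)
        (900 * (n + 1) ^ 4 * (6 * (n + 1) ^ 2) ^ ((200 * k + 501) * (4 ^ j * (j + 1))))
        fun s => IsMaxWeightIndepSet G w (output n s) := by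
  obtain ⟨s, t, h1, h2, j, h3, h4, h5⟩ := runsTo_setupProg G w (200 * k + 501)
  set r := (200 * k + 501) * (4 ^ j * (j + 1)) with hr
  refine ⟨j, h3, h4, ?_⟩
  obtain ⟨s', t', h6, h7, T, h8, h9, h10⟩ := runsTo_queueProg h5
  have hS : Affordable G (2 ^ j) Finset.univ r := by
    -- The high degrees need q = 4^j, because n ≤ 8^j = 4^j · 2^j; this is paid for by the excess of
    -- 200k + 501 over the factor in the elimination depth.
    refine ⟨4 ^ j, (200 * k + 500) * (4 ^ j * (j + 1)), ?_, ?_, fun Y _ hY =>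
      elimDepth_of_abbaFree hG h3 hY⟩
    · have : 4 ^ j ≤ 4 ^ j * (j + 1) := Nat.le_mul_of_pos_right _ (by omega)
      calc 4 ^ j + (200 * k + 500) * (4 ^ j * (j + 1))
          ≤ 4 ^ j * (j + 1) + (200 * k + 500) * (4 ^ j * (j + 1)) := Nat.add_le_add_right this _
        _ = r := by rw [hr]; ring
    · rw [Finset.card_univ, Fintype.card_fin, ← mul_pow]
      exact h3
  obtain ⟨s'', t'', h11, h12, h13⟩ := runsTo_pushProg h8 rfl rfl h9 (isBudget_affordable G (2 ^ j))
    hS hw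
  refine ⟨s'', _, .seq h1 (.seq h6 h11), ?_, h13⟩
  simp only [Finset.card_univ, Fintype.card_fin, List.length_cons] at h7 h10
  have hM1 := one_le_treeSize n n r
  have hM2 : treeSize n n r ≤ 3 * (n + 1) * (6 * (n + 1) ^ 2) ^ r := by
    have h1 : 1 ≤ (6 * (n + 1) ^ 2) ^ r := Nat.one_le_pow _ _ (by positivity)
    unfold treeSize
    split_ifs
    · nlinarith
    · exact Nat.mul_le_mul_right _ (by omega)
  have h14 : T.length * (27 * n + 20 + 1) ≤ treeSize n n r * (27 * n + 20 + 1) :=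
    Nat.mul_le_mul_right _ (by omega)
  have h15 : t + (t' + t'') ≤ treeSize n n r * (300 * (n + 1) ^ 3) := by
    have h16 : 130 * (n + 1) ^ 3 + 2 + (27 * n + 20 + 1) + (29 * n + 41) ≤ 300 * (n + 1) ^ 3 := by
      nlinarith [Nat.zero_le (n ^ 3), Nat.zero_le (n ^ 2)]
    refine le_trans ?_ (Nat.mul_le_mul_left _ h16)
    have h17 : 29 * n + 41 ≤ treeSize n n r * (29 * n + 41) := Nat.le_mul_of_pos_left _ hM1
    rw [Nat.mul_add, Nat.mul_add]
    omega
  refine h15.trans ((Nat.mul_le_mul_right _ hM2).trans (le_of_eq (by ring)))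

end RAM

/-! ### The running time as a function of n -/

/-- The running time in terms of the size of the input. -/
theorem exists_time_bound (K : ℕ) (hK : 1 ≤ K) : ∃ C : ℝ, ∀ n j : ℕ,
    (j = 0 ∨ 8 ^ (j - 1) < n) → n ≤ 8 ^ j →
    ((900 * (n + 1) ^ 4 * (6 * (n + 1) ^ 2) ^ (K * (4 ^ j * (j + 1))) : ℕ) : ℝ) ≤
      C * (n : ℝ) ^ (C * (n : ℝ) ^ (2 / 3 : ℝ) * Real.logb 2 (n : ℝ) ^ 3) := by
  -- The first summand serves the exponent for n ≥ 2. The second one is 900 · 2⁴ · (6 · 2²)^K, which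
  -- covers n ≤ 1, where the power of n equals 1.
  set C : ℝ := 300 * K + 14400 * 24 ^ K with hC
  have hC1 : (14400 * 24 ^ K : ℝ) ≤ C := by
    have : (0 : ℝ) ≤ 300 * K := by positivity
    linarith
  have hC2 : (300 * K : ℝ) ≤ C := by
    have : (0 : ℝ) ≤ 14400 * 24 ^ K := by positivity
    linarith
  have hC3 : (1 : ℝ) ≤ C := by
    have : (1 : ℝ) ≤ 24 ^ K := one_le_pow₀ (by norm_num)
    linarith
  refine ⟨C, fun n j hj hn8 => ?_⟩
  rcases Nat.lt_or_ge n 2 with hn | hn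
  · obtain rfl : j = 0 := by
      rcases hj with hj | hj
      · exact hj
      · have := Nat.one_le_pow (j - 1) 8 (by omega)
        omega
    have h1 : ((n : ℝ) ^ (C * (n : ℝ) ^ (2 / 3 : ℝ) * Real.logb 2 (n : ℝ) ^ 3)) = 1 := by
      interval_cases n <;> simp
    rw [h1, mul_one]
    refine le_trans ?_ hC1
    have h2 : 900 * (n + 1) ^ 4 * (6 * (n + 1) ^ 2) ^ (K * (4 ^ 0 * (0 + 1))) ≤
        900 * 2 ^ 4 * (6 * 2 ^ 2) ^ (K * (4 ^ 0 * (0 + 1))) := by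
      gcongr <;> omega
    refine (Nat.cast_le.2 h2).trans (le_of_eq ?_)
    norm_num
  · have hj1 : j ≠ 0 := by
      rintro rfl
      norm_num at hn8
      omega
    obtain ⟨i, rfl⟩ := Nat.exists_eq_succ_of_ne_zero hj1
    have hi : 8 ^ i < n := by simpa using hj
    set r := K * (4 ^ (i + 1) * (i + 1 + 1)) with hr
    have hr1 : 1 ≤ r := Nat.one_le_iff_ne_zero.2 (by positivity)
    -- For n ≥ 2 all constants are absorbed into powers of n, and r ≥ 1 absorbs the additive 18 into
    -- 25r.
    have hnat : 900 * (n + 1) ^ 4 * (6 * (n + 1) ^ 2) ^ r ≤ n ^ (25 * r) := by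
      have h1 : n + 1 ≤ n ^ 2 := by nlinarith
      have h2 : 6 ≤ n ^ 3 := le_trans (by norm_num) (Nat.pow_le_pow_left hn 3)
      have h3 : 900 ≤ n ^ 10 := le_trans (by norm_num) (Nat.pow_le_pow_left hn 10)
      calc 900 * (n + 1) ^ 4 * (6 * (n + 1) ^ 2) ^ r
          ≤ n ^ 10 * (n ^ 2) ^ 4 * (n ^ 3 * (n ^ 2) ^ 2) ^ r := by gcongr
        _ = n ^ (18 + 7 * r) := by ring
        _ ≤ n ^ (25 * r) := Nat.pow_le_pow_right (by omega) (by omega)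
    have hn0 : (0 : ℝ) ≤ n := Nat.cast_nonneg n
    have hn1 : (1 : ℝ) ≤ n := by exact_mod_cast (by omega : 1 ≤ n)
    have hlog1 : (1 : ℝ) ≤ Real.logb 2 n := by
      rw [Real.le_logb_iff_rpow_le (by norm_num) (by linarith), Real.rpow_one]
      exact_mod_cast hn
    have hlogi : (i : ℝ) ≤ Real.logb 2 n := by
      rw [Real.le_logb_iff_rpow_le (by norm_num) (by linarith), Real.rpow_natCast]
      have h1 : 2 ^ i ≤ 8 ^ i := Nat.pow_le_pow_left (by norm_num) i
      exact_mod_cast h1.trans hi.le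
    have h4 : (4 : ℝ) ^ i ≤ (n : ℝ) ^ (2 / 3 : ℝ) := by
      have h5 : ((8 : ℝ) ^ i) ^ (2 / 3 : ℝ) = 4 ^ i := by
        rw [← Real.rpow_natCast, ← Real.rpow_mul (by norm_num), mul_comm (i : ℝ),
          Real.rpow_mul (by norm_num), Real.rpow_natCast]
        congr 1
        rw [show (8 : ℝ) = 2 ^ (3 : ℝ) by norm_num, ← Real.rpow_mul (by norm_num)]
        norm_num
      rw [← h5]
      exact Real.rpow_le_rpow (by positivity) (by exact_mod_cast hi.le) (by norm_num)
    have hrle : ((25 * r : ℕ) : ℝ) ≤ C * (n : ℝ) ^ (2 / 3 : ℝ) * Real.logb 2 (n : ℝ) ^ 3 := by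
      -- A single logarithm would do; since it is at least 1, the cube only weakens the bound.
      have h6 : Real.logb 2 (n : ℝ) ≤ Real.logb 2 (n : ℝ) ^ 3 := le_self_pow₀ hlog1 (by norm_num)
      have h7 : ((25 * r : ℕ) : ℝ) = 100 * K * (4 ^ i * (i + 2)) := by
        rw [hr]; push_cast; ring
      have h8 : (i : ℝ) + 2 ≤ 3 * Real.logb 2 (n : ℝ) ^ 3 := by linarith
      rw [h7]
      calc 100 * K * ((4 : ℝ) ^ i * (i + 2))
          ≤ 100 * K * ((n : ℝ) ^ (2 / 3 : ℝ) * (3 * Real.logb 2 (n : ℝ) ^ 3)) := by gcongr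
        _ = 300 * K * (n : ℝ) ^ (2 / 3 : ℝ) * Real.logb 2 (n : ℝ) ^ 3 := by ring
        _ ≤ C * (n : ℝ) ^ (2 / 3 : ℝ) * Real.logb 2 (n : ℝ) ^ 3 := by
          have : (0 : ℝ) ≤ Real.logb 2 (n : ℝ) ^ 3 := by positivity
          gcongr
    calc ((900 * (n + 1) ^ 4 * (6 * (n + 1) ^ 2) ^ r : ℕ) : ℝ)
        ≤ ((n ^ (25 * r) : ℕ) : ℝ) := Nat.cast_le.2 hnat
      _ = (n : ℝ) ^ ((25 * r : ℕ) : ℝ) := by rw [Real.rpow_natCast, Nat.cast_pow]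
      _ ≤ (n : ℝ) ^ (C * (n : ℝ) ^ (2 / 3 : ℝ) * Real.logb 2 (n : ℝ) ^ 3) :=
        Real.rpow_le_rpow_of_exponent_le hn1 hrle
      _ ≤ C * (n : ℝ) ^ (C * (n : ℝ) ^ (2 / 3 : ℝ) * Real.logb 2 (n : ℝ) ^ 3) :=
        le_mul_of_one_le_left (by positivity) hC3

theorem mainTheorem5 (k : ℕ) :
    ∃ (p : RAM.Program) (C : ℝ),
      SolvesMWISInTime p (fun _ G => OrderedFree (abbaGraph k) G)
        (fun n => C * (n : ℝ) ^ (C * (n : ℝ) ^ (2 / 3 : ℝ) * Real.logb 2 (n : ℝ) ^ 3)) := by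
  obtain ⟨C, hC⟩ := exists_time_bound (200 * k + 501) (by omega)
  refine ⟨RAM.mwisProg (200 * k + 501), C, fun n G hG w hw => ?_⟩
  obtain ⟨j, hn, hj, s, t, h1, h2, h3⟩ := RAM.runsTo_mwisProg hG hw
  exact ⟨s, t, h1, (Nat.cast_le.2 h2).trans (hC n j hj hn), h3⟩
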